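/- Let $M$ be a finite-dimensional smooth manifold (Hausdorff, $\sigma$-compact, without boundary). A *bundle gerbe* $(P,Y)$ over $M$ consists of a smooth surjective submersion $\pi\colon Y\to M$, where $Y$ is a Hausdorff smooth (possibly infinite-dimensional) Banach manifold, a smooth principal $\mathbb C^\times$-bundle $P\to Y^{[2]}=Y\times_M Y$, and a smooth, associative, $\mathbb C^\times$-equivariant product $P_{(y_1,y_2)}\otimes P_{(y_2,y_3)}\to P_{(y_1,y_3)}$ for $(y_1,y_2,y_3)\in Y^{[3]}$, where $\otimes$ is the contracted product of principal $\mathbb C^\times$-spaces. The *dual* $(P^*,Y)$ is $P$ with the inverse $\mathbb C^\times$-action, and the *product* of $(P,Y)$ and $(Q,Z)$ is $(P\otimes Q,\,Y\times_M Z)$ with $(P\otimes Q)_{((y_1,z_1),(y_2,z_2))}=P_{(y_1,y_2)}\otimes Q_{(z_1,z_2)}$. An *isomorphism* $(P,Y)\to(Q,Z)$ is a diffeomorphism $f\colon Y\to Z$ over $M$ together with an isomorphism of $\mathbb C^\times$-bundles $P\to Q$ covering $f^{[2]}\colon Y^{[2]}\to Z^{[2]}$ and commuting with the products. For a smooth principal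 $\mathbb C^\times$-bundle $Q\to Y$, the bundle gerbe $(\delta(Q),Y)$ is given by $\delta(Q)_{(y_1,y_2)}=Q_{y_1}^*\otimes Q_{y_2}$, with product induced by the natural pairing $Q_{y_2}\otimes Q_{y_2}^*\to\mathbb C^\times$. A bundle gerbe is *trivial* if it is isomorphic to some $\delta(Q)$. Two bundle gerbes $P$, $Q$ over $M$ are *stably isomorphic* if there are trivial bundle gerbes $T_1$, $T_2$ over $M$ such that $P\otimes T_1$ is isomorphic to $Q\otimes T_2$. The *Dixmier–Douady class* $d(P)\in H^3(M,\mathbb Z)$ (Čech cohomology) of $(P,Y)$ is defined as follows. Choose an open cover $\{U_\alpha\}$ of $M$, smooth sections $s_\alpha\colon U_\alpha\to Y$ of $\pi$ and smooth sections $\sigma_{\alpha\beta}$ of $(s_\alpha,s_\beta)^{-1}(P)$ over $U_\alpha\cap U_\beta$, such that the functions $g_{\alpha\beta\gamma}\colon U_\alpha\cap U_\beta\cap U_\gamma\to\mathbb C^\times$ defined by $\sigma_{\alpha\beta}\sigma_{\beta\gamma}=\sigma_{\alpha\gamma}\,g_{\alpha\beta\gamma}$ have smooth logarithms, $g_{\alpha\beta\gamma}=\exp(2\pi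 i\,w_{\alpha\beta\gamma})$. Then $d(P)$ is the class of the integral Čech cocycle $w_{\beta\gamma\delta}-w_{\alpha\gamma\delta}+w_{\alpha\beta\delta}-w_{\alpha\beta\gamma}$, that is, the image of the class of $g$ under $H^2(M,\underline{\mathbb C}^\times)\cong H^3(M,\mathbb Z)$. **Proposition.** The class $d(P)$ is well defined: for every bundle gerbe $P$ over $M$ such choices exist, and the resulting class does not depend on them. For bundle gerbes $(P,Y)$ and $(Q,Z)$ over $M$ the following are equivalent: 1. $P$ and $Q$ are stably isomorphic; 2. $P\otimes Q^*$ is trivial; 3. $d(P)=d(Q)$ in $H^3(M,\mathbb Z)$. Consequently, stable isomorphism is an equivalence relation on bundle gerbes over $M$. -/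

import Mathlib

open scoped Manifold ContDiff

universe u v w

namespace BundleGerbes

open Set

noncomputable section

set_option linter.unusedSectionVars false
set_option linter.style.haveILetI false

section FibreProducts

variable {E EY EZ G M Y Z : Type*}
  [NormedAddCommGroup E] [NormedSpace ℝ E]
  [NormedAddCommGroup EY] [NormedSpace ℝ EY]
  [NormedAddCommGroup EZ] [NormedSpace ℝ EZ]
  [NormedAddCommGroup G] [NormedSpace ℝ G]
  [TopologicalSpace M] [ChartedSpace E M]
  [TopologicalSpace Y] [ChartedSpace EY Y]
  [TopologicalSpace Z] [ChartedSpace EZ Z]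
  {f : Y → M} {g : Z → M}

/-- The fibre product `Y ×_M Z` of two maps `f : Y → M` and `g : Z → M`. -/
def FibreProd (f : Y → M) (g : Z → M) : Type _ := {p : Y × Z // f p.1 = g p.2}

namespace FibreProd

instance : TopologicalSpace (FibreProd f g) :=
  inferInstanceAs (TopologicalSpace {p : Y × Z // f p.1 = g p.2})

instance [T2Space Y] [T2Space Z] : T2Space (FibreProd f g) :=
  inferInstanceAs (T2Space {p : Y × Z // f p.1 = g p.2})

/-- The first projection of a fibre product. -/
def fst (p : FibreProd f g) : Y := p.1.1

/-- The second projection of a fibre product. -/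
def snd (p : FibreProd f g) : Z := p.1.2

lemma comm (p : FibreProd f g) : f p.fst = g p.snd := p.2

/-- The point of the fibre product with given components. -/
def mk (y : Y) (z : Z) (h : f y = g z) : FibreProd f g := ⟨(y, z), h⟩

lemma ext {p q : FibreProd f g} (h₁ : p.fst = q.fst) (h₂ : p.snd = q.snd) : p = q :=
  Subtype.ext (Prod.ext h₁ h₂)

lemma continuous_fst : Continuous (fst : FibreProd f g → Y) :=
  _root_.continuous_fst.comp continuous_subtype_val

lemma continuous_snd : Continuous (snd : FibreProd f g → Z) :=
  _root_.continuous_snd.comp continuous_subtype_val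

lemma continuousOn_iff {X : Type*} [TopologicalSpace X] {k : X → FibreProd f g} {s : Set X} :
    ContinuousOn k s ↔
      ContinuousOn (fun x => (k x).fst) s ∧ ContinuousOn (fun x => (k x).snd) s := by
  have h : Topology.IsInducing (fun p : FibreProd f g => p.1) :=
    Topology.IsInducing.subtypeVal
  exact h.continuousOn_iff.trans ⟨fun h => ⟨_root_.continuous_fst.comp_continuousOn h,
    _root_.continuous_snd.comp_continuousOn h⟩, fun h => h.1.prodMk h.2⟩

variable (hf : ContMDiff 𝓘(ℝ, EY) 𝓘(ℝ, E) ∞ f)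
  (hg : Manifold.IsSubmersionOfComplement G 𝓘(ℝ, EZ) 𝓘(ℝ, E) ∞ g)

lemma normal_form {z₀ : Z}
    (h : Manifold.IsSubmersionAtOfComplement G 𝓘(ℝ, EZ) 𝓘(ℝ, E) ∞ g z₀)
    {v : EZ} (hv : v ∈ h.domChart.target) :
    h.codChart (g (h.domChart.symm v)) = (h.equiv v).1 := by
  have hv' : v ∈ (h.domChart.extend 𝓘(ℝ, EZ)).target := by simpa using hv
  simpa using h.writtenInCharts hv'

lemma normal_form_source {z₀ : Z}
    (h : Manifold.IsSubmersionAtOfComplement G 𝓘(ℝ, EZ) 𝓘(ℝ, E) ∞ g z₀)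
    {z : Z} (hz : z ∈ h.domChart.source) :
    h.codChart (g z) = (h.equiv (h.domChart z)).1 := by
  have := normal_form h (h.domChart.map_source hz)
  rwa [h.domChart.left_inv hz] at this

/-- The point of `EZ` with given base point `x` in `M` and given vertical coordinate `w`. -/
def vert {z₀ : Z} (h : Manifold.IsSubmersionAtOfComplement G 𝓘(ℝ, EZ) 𝓘(ℝ, E) ∞ g z₀)
    (x : M) (w : G) : EZ :=
  h.equiv.symm (h.codChart x, w)

lemma vert_proj {z₀ : Z}
    (h : Manifold.IsSubmersionAtOfComplement G 𝓘(ℝ, EZ) 𝓘(ℝ, E) ∞ g z₀)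
    {x : M} {w : G} (hx : x ∈ h.codChart.source) (hv : vert h x w ∈ h.domChart.target) :
    g (h.domChart.symm (vert h x w)) = x := by
  apply h.codChart.injOn (h.source_subset_preimage_source (h.domChart.map_target hv)) hx
  rw [normal_form h hv]
  simp [vert]

lemma vert_self {z₀ : Z}
    (h : Manifold.IsSubmersionAtOfComplement G 𝓘(ℝ, EZ) 𝓘(ℝ, E) ∞ g z₀)
    {z : Z} (hz : z ∈ h.domChart.source) :
    vert h (g z) (h.equiv (h.domChart z)).2 = h.domChart z := by
  rw [vert, normal_form_source h hz]
  simp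

/-- The domain of the inverse of the chart of `Y ×_M Z` built from a chart `φ` of `Y` and a
submersion chart of `g`. -/
def chartTarget (φ : OpenPartialHomeomorph Y EY) {z₀ : Z}
    (h : Manifold.IsSubmersionAtOfComplement G 𝓘(ℝ, EZ) 𝓘(ℝ, E) ∞ g z₀) (f : Y → M) :
    Set (EY × G) :=
  {w | (w.1 ∈ φ.target ∧ f (φ.symm w.1) ∈ h.codChart.source) ∧
    vert h (f (φ.symm w.1)) w.2 ∈ h.domChart.target}

lemma continuousOn_vert (hf : Continuous f) (φ : OpenPartialHomeomorph Y EY) {z₀ : Z}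
    (h : Manifold.IsSubmersionAtOfComplement G 𝓘(ℝ, EZ) 𝓘(ℝ, E) ∞ g z₀) :
    ContinuousOn (fun w : EY × G => vert h (f (φ.symm w.1)) w.2)
      {w | w.1 ∈ φ.target ∧ f (φ.symm w.1) ∈ h.codChart.source} := by
  apply h.equiv.symm.continuous.comp_continuousOn
  refine ContinuousOn.prodMk ?_ _root_.continuous_snd.continuousOn
  refine h.codChart.continuousOn.comp (hf.comp_continuousOn
    (φ.symm.continuousOn.comp _root_.continuous_fst.continuousOn fun w hw => hw.1))
    fun w hw => hw.2

open Classical in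
/-- The inverse of the chart `chart` (with a junk value outside of its domain). -/
def chartInv (φ : OpenPartialHomeomorph Y EY) {z₀ : Z}
    (h : Manifold.IsSubmersionAtOfComplement G 𝓘(ℝ, EZ) 𝓘(ℝ, E) ∞ g z₀) (p₀ : FibreProd f g)
    (w : EY × G) : FibreProd f g :=
  if hw : w ∈ chartTarget φ h f then
    mk (φ.symm w.1) (h.domChart.symm (vert h (f (φ.symm w.1)) w.2))
      (vert_proj h hw.1.2 hw.2).symm
  else p₀

lemma chartInv_fst {φ : OpenPartialHomeomorph Y EY} {z₀ : Z}
    {h : Manifold.IsSubmersionAtOfComplement G 𝓘(ℝ, EZ) 𝓘(ℝ, E) ∞ g z₀} {p₀ : FibreProd f g}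
    {w : EY × G} (hw : w ∈ chartTarget φ h f) : (chartInv φ h p₀ w).fst = φ.symm w.1 := by
  rw [chartInv, dif_pos hw]; rfl

lemma chartInv_snd {φ : OpenPartialHomeomorph Y EY} {z₀ : Z}
    {h : Manifold.IsSubmersionAtOfComplement G 𝓘(ℝ, EZ) 𝓘(ℝ, E) ∞ g z₀} {p₀ : FibreProd f g}
    {w : EY × G} (hw : w ∈ chartTarget φ h f) :
    (chartInv φ h p₀ w).snd = h.domChart.symm (vert h (f (φ.symm w.1)) w.2) := by
  rw [chartInv, dif_pos hw]; rfl

lemma isOpen_chartTarget (hf : Continuous f) (φ : OpenPartialHomeomorph Y EY) {z₀ : Z}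
    (h : Manifold.IsSubmersionAtOfComplement G 𝓘(ℝ, EZ) 𝓘(ℝ, E) ∞ g z₀) :
    IsOpen (chartTarget φ h f) := by
  refine (continuousOn_vert hf φ h).isOpen_inter_preimage ?_ h.domChart.open_target
  have h1 : ContinuousOn (fun w : EY × G => f (φ.symm w.1)) (Prod.fst ⁻¹' φ.target) :=
    hf.comp_continuousOn (φ.symm.continuousOn.comp _root_.continuous_fst.continuousOn
      fun w hw => hw)
  exact h1.isOpen_inter_preimage (φ.open_target.preimage _root_.continuous_fst)
    h.codChart.open_source

lemma mem_chartTarget {φ : OpenPartialHomeomorph Y EY} {z₀ : Z}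
    {h : Manifold.IsSubmersionAtOfComplement G 𝓘(ℝ, EZ) 𝓘(ℝ, E) ∞ g z₀} {p : FibreProd f g}
    (h₁ : p.fst ∈ φ.source) (h₂ : p.snd ∈ h.domChart.source) :
    (φ p.fst, (h.equiv (h.domChart p.snd)).2) ∈ chartTarget φ h f := by
  simp only [chartTarget, mem_ofPred_eq, φ.left_inv h₁]
  refine ⟨⟨φ.map_source h₁, ?_⟩, ?_⟩
  · rw [p.comm]; exact h.source_subset_preimage_source h₂
  · rw [p.comm, vert_self h h₂]; exact h.domChart.map_source h₂

/-- The chart of `Y ×_M Z` built from a chart `φ` of `Y` and a submersion chart of `g : Z → M`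
at a point of `Z`: it sends `(y, z)` to the coordinates of `y` and the vertical coordinates
of `z`. -/
def chart (hf : Continuous f) (φ : OpenPartialHomeomorph Y EY) {z₀ : Z}
    (h : Manifold.IsSubmersionAtOfComplement G 𝓘(ℝ, EZ) 𝓘(ℝ, E) ∞ g z₀) (p₀ : FibreProd f g) :
    OpenPartialHomeomorph (FibreProd f g) (EY × G) where
  toFun p := (φ p.fst, (h.equiv (h.domChart p.snd)).2)
  invFun := chartInv φ h p₀
  source := {p | p.fst ∈ φ.source ∧ p.snd ∈ h.domChart.source}
  target := chartTarget φ h f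
  map_source' p hp := mem_chartTarget hp.1 hp.2
  map_target' w hw := by
    simp only [mem_ofPred_eq, chartInv_fst hw, chartInv_snd hw]
    exact ⟨φ.map_target hw.1.1, h.domChart.map_target hw.2⟩
  left_inv' p hp := by
    have hw := mem_chartTarget hp.1 hp.2
    apply ext
    · rw [chartInv_fst hw, φ.left_inv hp.1]
    · rw [chartInv_snd hw, φ.left_inv hp.1, p.comm, vert_self h hp.2, h.domChart.left_inv hp.2]
  right_inv' w hw := by
    rw [chartInv_fst hw, chartInv_snd hw, φ.right_inv hw.1.1, h.domChart.right_inv hw.2]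
    simp [vert]
  open_source := (φ.open_source.preimage continuous_fst).inter
    (h.domChart.open_source.preimage continuous_snd)
  open_target := isOpen_chartTarget hf φ h
  continuousOn_toFun := by
    refine ContinuousOn.prodMk ?_ ?_
    · exact φ.continuousOn.comp continuous_fst.continuousOn fun p hp => hp.1
    · exact _root_.continuous_snd.comp_continuousOn (h.equiv.continuous.comp_continuousOn
        (h.domChart.continuousOn.comp continuous_snd.continuousOn fun p hp => hp.2))
  continuousOn_invFun := by
    rw [continuousOn_iff]
    constructor
    · refine ContinuousOn.congr ?_ fun w hw => chartInv_fst hw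
      exact φ.symm.continuousOn.comp _root_.continuous_fst.continuousOn fun w hw => hw.1.1
    · refine ContinuousOn.congr ?_ fun w hw => chartInv_snd hw
      exact h.domChart.symm.continuousOn.comp
        ((continuousOn_vert hf φ h).mono fun w hw => hw.1) fun w hw => hw.2

/-- The fibre product of a continuous map and a submersion, as a charted space. -/
@[reducible] def chartedSpace (hf : Continuous f)
    (hg : Manifold.IsSubmersionOfComplement G 𝓘(ℝ, EZ) 𝓘(ℝ, E) ∞ g) :
    ChartedSpace (EY × G) (FibreProd f g) where
  atlas := {e | ∃ p : FibreProd f g, e = chart hf (chartAt EY p.fst) (hg.isSubmersionAt p.snd) p}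
  chartAt p := chart hf (chartAt EY p.fst) (hg.isSubmersionAt p.snd) p
  mem_chart_source p := ⟨mem_chart_source EY p.fst, (hg.isSubmersionAt p.snd).mem_domChart_source⟩
  chart_mem_atlas p := ⟨p, rfl⟩

lemma contMDiffOn_chartInv_fst [IsManifold 𝓘(ℝ, EY) ∞ Y] {φ : OpenPartialHomeomorph Y EY}
    (hφ : φ ∈ IsManifold.maximalAtlas 𝓘(ℝ, EY) ∞ Y) {z₀ : Z}
    (h : Manifold.IsSubmersionAtOfComplement G 𝓘(ℝ, EZ) 𝓘(ℝ, E) ∞ g z₀) (p₀ : FibreProd f g) :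
    ContMDiffOn 𝓘(ℝ, EY × G) 𝓘(ℝ, EY) ∞ (fun w => (chartInv φ h p₀ w).fst)
      (chartTarget φ h f) := by
  refine ContMDiffOn.congr ?_ fun w hw => chartInv_fst hw
  refine (contMDiffOn_symm_of_mem_maximalAtlas hφ).comp
    (contDiff_fst.contMDiff (n := ∞)).contMDiffOn fun w hw => hw.1.1

lemma contMDiffOn_chartInv_snd (hf : ContMDiff 𝓘(ℝ, EY) 𝓘(ℝ, E) ∞ f)
    [IsManifold 𝓘(ℝ, E) ∞ M] [IsManifold 𝓘(ℝ, EY) ∞ Y]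
    [IsManifold 𝓘(ℝ, EZ) ∞ Z] {φ : OpenPartialHomeomorph Y EY}
    (hφ : φ ∈ IsManifold.maximalAtlas 𝓘(ℝ, EY) ∞ Y) {z₀ : Z}
    (h : Manifold.IsSubmersionAtOfComplement G 𝓘(ℝ, EZ) 𝓘(ℝ, E) ∞ g z₀) (p₀ : FibreProd f g) :
    ContMDiffOn 𝓘(ℝ, EY × G) 𝓘(ℝ, EZ) ∞ (fun w => (chartInv φ h p₀ w).snd)
      (chartTarget φ h f) := by
  refine ContMDiffOn.congr ?_ fun w hw => chartInv_snd hw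
  refine (contMDiffOn_symm_of_mem_maximalAtlas h.domChart_mem_maximalAtlas).comp
    ?_ fun w hw => hw.2
  refine (h.equiv.symm.contDiff.contMDiff (n := ∞)).comp_contMDiffOn ?_
  refine ContMDiffOn.prodMk_space ?_ (contDiff_snd.contMDiff.contMDiffOn)
  refine (contMDiffOn_of_mem_maximalAtlas h.codChart_mem_maximalAtlas).comp
    (hf.comp_contMDiffOn ((contMDiffOn_symm_of_mem_maximalAtlas hφ).comp
      (contDiff_fst.contMDiff (n := ∞)).contMDiffOn fun w hw => hw.1.1)) fun w hw => hw.1.2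

lemma isManifold [IsManifold 𝓘(ℝ, E) ∞ M] [IsManifold 𝓘(ℝ, EY) ∞ Y] [IsManifold 𝓘(ℝ, EZ) ∞ Z] :
    letI : ChartedSpace (EY × G) (FibreProd f g) := chartedSpace hf.continuous hg
    IsManifold 𝓘(ℝ, EY × G) ∞ (FibreProd f g) := by
  letI : ChartedSpace (EY × G) (FibreProd f g) := chartedSpace hf.continuous hg
  apply isManifold_of_contDiffOn
  rintro _ _ ⟨p, rfl⟩ ⟨q, rfl⟩
  rw [← contMDiffOn_iff_contDiffOn]
  have hs : 𝓘(ℝ, EY × G).symm ⁻¹' ((chart hf.continuous (chartAt EY p.fst)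
      (hg.isSubmersionAt p.snd) p).symm ≫ₕ (chart hf.continuous (chartAt EY q.fst)
      (hg.isSubmersionAt q.snd) q)).source ∩ range 𝓘(ℝ, EY × G) =
      {w | w ∈ chartTarget (chartAt EY p.fst) (hg.isSubmersionAt p.snd) f ∧
        (chartInv (chartAt EY p.fst) (hg.isSubmersionAt p.snd) p w).fst ∈
          (chartAt EY q.fst).source ∧
        (chartInv (chartAt EY p.fst) (hg.isSubmersionAt p.snd) p w).snd ∈
          (hg.isSubmersionAt q.snd).domChart.source} := by
    ext w
    simp only [chart, mfld_simps, mem_ofPred_eq]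
  rw [hs]
  refine ContMDiffOn.prodMk_space ?_ ?_
  · exact (contMDiffOn_of_mem_maximalAtlas (IsManifold.chart_mem_maximalAtlas q.fst)).comp
      ((contMDiffOn_chartInv_fst (IsManifold.chart_mem_maximalAtlas p.fst)
        (hg.isSubmersionAt p.snd) p).mono fun w hw => hw.1) fun w hw => hw.2.1
  · refine (contDiff_snd.contMDiff (n := ∞)).comp_contMDiffOn
      (((hg.isSubmersionAt q.snd).equiv.contDiff.contMDiff (n := ∞)).comp_contMDiffOn ?_)
    exact (contMDiffOn_of_mem_maximalAtlas
      (hg.isSubmersionAt q.snd).domChart_mem_maximalAtlas).comp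
      ((contMDiffOn_chartInv_snd hf (IsManifold.chart_mem_maximalAtlas p.fst)
        (hg.isSubmersionAt p.snd) p).mono fun w hw => hw.1) fun w hw => hw.2.2

lemma contMDiff_fst [IsManifold 𝓘(ℝ, E) ∞ M] [IsManifold 𝓘(ℝ, EY) ∞ Y]
    [IsManifold 𝓘(ℝ, EZ) ∞ Z] :
    letI : ChartedSpace (EY × G) (FibreProd f g) := chartedSpace hf.continuous hg
    ContMDiff 𝓘(ℝ, EY × G) 𝓘(ℝ, EY) ∞ (fst : FibreProd f g → Y) := by
  letI : ChartedSpace (EY × G) (FibreProd f g) := chartedSpace hf.continuous hg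
  haveI := isManifold hf hg
  intro p
  have h1 := contMDiffOn_chart (I := 𝓘(ℝ, EY × G)) (n := ∞) (x := p)
  have h2 := (contMDiffOn_chartInv_fst (IsManifold.chart_mem_maximalAtlas (I := 𝓘(ℝ, EY)) (n := ∞)
    p.fst) (hg.isSubmersionAt p.snd) p).comp h1
      fun q hq => (chartAt (EY × G) p).map_source hq
  refine (h2.congr fun q hq => ?_).contMDiffAt
    ((chartAt (EY × G) p).open_source.mem_nhds (mem_chart_source (EY × G) p))
  exact congrArg fst ((chartAt (EY × G) p).left_inv hq).symm

lemma contMDiff_snd [IsManifold 𝓘(ℝ, E) ∞ M] [IsManifold 𝓘(ℝ, EY) ∞ Y]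
    [IsManifold 𝓘(ℝ, EZ) ∞ Z] :
    letI : ChartedSpace (EY × G) (FibreProd f g) := chartedSpace hf.continuous hg
    ContMDiff 𝓘(ℝ, EY × G) 𝓘(ℝ, EZ) ∞ (snd : FibreProd f g → Z) := by
  letI : ChartedSpace (EY × G) (FibreProd f g) := chartedSpace hf.continuous hg
  haveI := isManifold hf hg
  intro p
  have h1 := contMDiffOn_chart (I := 𝓘(ℝ, EY × G)) (n := ∞) (x := p)
  have h2 := (contMDiffOn_chartInv_snd hf (IsManifold.chart_mem_maximalAtlas (I := 𝓘(ℝ, EY))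
    (n := ∞) p.fst) (hg.isSubmersionAt p.snd) p).comp h1
      fun q hq => (chartAt (EY × G) p).map_source hq
  refine (h2.congr fun q hq => ?_).contMDiffAt
    ((chartAt (EY × G) p).open_source.mem_nhds (mem_chart_source (EY × G) p))
  exact congrArg snd ((chartAt (EY × G) p).left_inv hq).symm

lemma contMDiffOn_chart_of_components [IsManifold 𝓘(ℝ, EZ) ∞ Z] {EX X : Type*}
    [NormedAddCommGroup EX] [NormedSpace ℝ EX] [TopologicalSpace X] [ChartedSpace EX X]
    {φ : OpenPartialHomeomorph Y EY} [IsManifold 𝓘(ℝ, EY) ∞ Y]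
    (hφ : φ ∈ IsManifold.maximalAtlas 𝓘(ℝ, EY) ∞ Y) {z₀ : Z}
    (h : Manifold.IsSubmersionAtOfComplement G 𝓘(ℝ, EZ) 𝓘(ℝ, E) ∞ g z₀) {k : X → FibreProd f g}
    {s : Set X} {x : X}
    (h₁ : ContMDiffWithinAt 𝓘(ℝ, EX) 𝓘(ℝ, EY) ∞ (fun x => (k x).fst) s x)
    (h₂ : ContMDiffWithinAt 𝓘(ℝ, EX) 𝓘(ℝ, EZ) ∞ (fun x => (k x).snd) s x)
    (hx₁ : (k x).fst ∈ φ.source) (hx₂ : (k x).snd ∈ h.domChart.source) :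
    ContMDiffWithinAt 𝓘(ℝ, EX) 𝓘(ℝ, EY × G) ∞
      (fun x => (φ (k x).fst, (h.equiv (h.domChart (k x).snd)).2)) s x := by
  refine ContMDiffWithinAt.prodMk_space ?_ ?_
  · exact ContMDiffAt.comp_contMDiffWithinAt x
      ((contMDiffOn_of_mem_maximalAtlas hφ).contMDiffAt (φ.open_source.mem_nhds hx₁)) h₁
  · refine ContMDiffAt.comp_contMDiffWithinAt (g := fun z => (h.equiv (h.domChart z)).2) x ?_ h₂
    have h3 := ((contDiff_snd.comp h.equiv.contDiff).contMDiff (n := ∞)).comp_contMDiffOn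
      (contMDiffOn_of_mem_maximalAtlas h.domChart_mem_maximalAtlas)
    exact h3.contMDiffAt (h.domChart.open_source.mem_nhds hx₂)

lemma contMDiffWithinAt_of_components [IsManifold 𝓘(ℝ, EY) ∞ Y] [IsManifold 𝓘(ℝ, EZ) ∞ Z]
    {EX X : Type*}
    [NormedAddCommGroup EX] [NormedSpace ℝ EX] [TopologicalSpace X] [ChartedSpace EX X]
    {k : X → FibreProd f g} {s : Set X} {x : X}
    (h₁ : ContMDiffWithinAt 𝓘(ℝ, EX) 𝓘(ℝ, EY) ∞ (fun x => (k x).fst) s x)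
    (h₂ : ContMDiffWithinAt 𝓘(ℝ, EX) 𝓘(ℝ, EZ) ∞ (fun x => (k x).snd) s x) :
    letI : ChartedSpace (EY × G) (FibreProd f g) := chartedSpace hf.continuous hg
    ContMDiffWithinAt 𝓘(ℝ, EX) 𝓘(ℝ, EY × G) ∞ k s x := by
  letI : ChartedSpace (EY × G) (FibreProd f g) := chartedSpace hf.continuous hg
  rw [contMDiffWithinAt_iff_target]
  constructor
  · have h : Topology.IsInducing (fun p : FibreProd f g => p.1) :=
      Topology.IsInducing.subtypeVal
    rw [h.continuousWithinAt_iff]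
    exact h₁.continuousWithinAt.prodMk h₂.continuousWithinAt
  · exact contMDiffOn_chart_of_components (IsManifold.chart_mem_maximalAtlas (k x).fst)
      (hg.isSubmersionAt (k x).snd) h₁ h₂ (mem_chart_source EY _)
      (hg.isSubmersionAt (k x).snd).mem_domChart_source

lemma chart_mem_maximalAtlas [IsManifold 𝓘(ℝ, E) ∞ M] [IsManifold 𝓘(ℝ, EY) ∞ Y]
    [IsManifold 𝓘(ℝ, EZ) ∞ Z] {φ : OpenPartialHomeomorph Y EY}
    (hφ : φ ∈ IsManifold.maximalAtlas 𝓘(ℝ, EY) ∞ Y) {z₀ : Z}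
    (h : Manifold.IsSubmersionAtOfComplement G 𝓘(ℝ, EZ) 𝓘(ℝ, E) ∞ g z₀) (p₀ : FibreProd f g) :
    letI : ChartedSpace (EY × G) (FibreProd f g) := chartedSpace hf.continuous hg
    chart hf.continuous φ h p₀ ∈ IsManifold.maximalAtlas 𝓘(ℝ, EY × G) ∞ (FibreProd f g) := by
  letI : ChartedSpace (EY × G) (FibreProd f g) := chartedSpace hf.continuous hg
  haveI := isManifold hf hg
  apply OpenPartialHomeomorph.mem_maximalAtlas_of_contMDiffOn
  · intro p hp
    exact contMDiffOn_chart_of_components (k := fun p : FibreProd f g => p) hφ h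
      (contMDiff_fst hf hg).contMDiffAt.contMDiffWithinAt
      (contMDiff_snd hf hg).contMDiffAt.contMDiffWithinAt hp.1 hp.2
  · intro w hw
    exact contMDiffWithinAt_of_components hf hg (contMDiffOn_chartInv_fst hφ h p₀ w hw)
      (contMDiffOn_chartInv_snd hf hφ h p₀ w hw)

/-- The map `Y ×_M Z → M` is a submersion if `Y → M` and `Z → M` are. -/
lemma isSubmersionOfComplement [IsManifold 𝓘(ℝ, E) ∞ M] [IsManifold 𝓘(ℝ, EY) ∞ Y]
    [IsManifold 𝓘(ℝ, EZ) ∞ Z] {F : Type*} [NormedAddCommGroup F] [NormedSpace ℝ F]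
    (hF : Manifold.IsSubmersionOfComplement F 𝓘(ℝ, EY) 𝓘(ℝ, E) ∞ f) :
    letI : ChartedSpace (EY × G) (FibreProd f g) := chartedSpace hf.continuous hg
    Manifold.IsSubmersionOfComplement (F × G) 𝓘(ℝ, EY × G) 𝓘(ℝ, E) ∞
      (fun p : FibreProd f g => f p.fst) := by
  letI : ChartedSpace (EY × G) (FibreProd f g) := chartedSpace hf.continuous hg
  intro p
  have hp := hF.isSubmersionAt p.fst
  refine Manifold.IsSubmersionAtOfComplement.mk_of_charts
    ((hp.equiv.prodCongr (ContinuousLinearEquiv.refl ℝ G)).trans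
      (ContinuousLinearEquiv.prodAssoc ℝ E F G))
    (chart hf.continuous hp.domChart (hg.isSubmersionAt p.snd) p) hp.codChart
    ⟨hp.mem_domChart_source, (hg.isSubmersionAt p.snd).mem_domChart_source⟩
    hp.mem_codChart_source
    (chart_mem_maximalAtlas hf hg hp.domChart_mem_maximalAtlas (hg.isSubmersionAt p.snd) p)
    hp.codChart_mem_maximalAtlas
    (fun q hq => hp.source_subset_preimage_source hq.1) ?_
  intro w hw
  have hw' : w ∈ chartTarget hp.domChart (hg.isSubmersionAt p.snd) f := by
    simpa [chart] using hw
  have h1 : (chartInv hp.domChart (hg.isSubmersionAt p.snd) p w).fst = hp.domChart.symm w.1 :=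
    chartInv_fst hw'
  have h2 := normal_form hp hw'.1.1
  rw [← h1] at h2
  simpa [chart] using h2

end FibreProd

end FibreProducts
/-! ### Surjective submersions onto `M` -/

/-- A locally split map `Y → M` in the category of smooth manifolds, that is, a smooth surjective
submersion `proj : Y → M`. Here `Y` is a Hausdorff smooth Banach manifold (finite or infinite
dimensional, without boundary) modelled on `model`, and `fibModel` is the model space of the fibres:
around each of its points `proj` is, in suitable smooth charts, the projection of
`model ≃ E × fibModel` to `E`. Equivalently, `proj` is surjective and has smooth local sections
through every point of `Y`. -/
structure FibredManifold (E : Type*) [NormedAddCommGroup E] [NormedSpace ℝ E]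
    (M : Type*) [TopologicalSpace M] [ChartedSpace E M] where
  Y : Type v
  model : Type v
  fibModel : Type v
  [normedAddCommGroupModel : NormedAddCommGroup model]
  [normedSpaceModel : NormedSpace ℝ model]
  [completeSpaceModel : CompleteSpace model]
  [normedAddCommGroupFibModel : NormedAddCommGroup fibModel]
  [normedSpaceFibModel : NormedSpace ℝ fibModel]
  [completeSpaceFibModel : CompleteSpace fibModel]
  [topologicalSpace : TopologicalSpace Y]
  [t2Space : T2Space Y]
  [chartedSpace : ChartedSpace model Y]
  [isManifold : IsManifold 𝓘(ℝ, model) ∞ Y]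
  proj : Y → M
  isSubmersion : Manifold.IsSubmersionOfComplement fibModel 𝓘(ℝ, model) 𝓘(ℝ, E) ∞ proj
  surjective : Function.Surjective proj

attribute [instance] FibredManifold.normedAddCommGroupModel FibredManifold.normedSpaceModel
  FibredManifold.completeSpaceModel FibredManifold.normedAddCommGroupFibModel
  FibredManifold.normedSpaceFibModel FibredManifold.completeSpaceFibModel
  FibredManifold.topologicalSpace FibredManifold.t2Space FibredManifold.chartedSpace
  FibredManifold.isManifold

namespace FibredManifold

variable {E : Type*} [NormedAddCommGroup E] [NormedSpace ℝ E]
  {M : Type*} [TopologicalSpace M] [ChartedSpace E M] [IsManifold 𝓘(ℝ, E) ∞ M]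

/-- The fibre product `Y ×_M Z` of two surjective submersions. -/
def prod (A B : FibredManifold.{v} E M) : FibredManifold.{v} E M where
  Y := FibreProd A.proj B.proj
  model := A.model × B.fibModel
  fibModel := A.fibModel × B.fibModel
  chartedSpace := FibreProd.chartedSpace A.isSubmersion.contMDiff.continuous B.isSubmersion
  isManifold := FibreProd.isManifold A.isSubmersion.contMDiff B.isSubmersion
  proj p := A.proj p.fst
  isSubmersion := FibreProd.isSubmersionOfComplement A.isSubmersion.contMDiff B.isSubmersion
    A.isSubmersion
  surjective x := by
    obtain ⟨y, hy⟩ := A.surjective x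
    obtain ⟨z, hz⟩ := B.surjective x
    exact ⟨FibreProd.mk y z (hy.trans hz.symm), hy⟩

variable {A B : FibredManifold.{v} E M}

/-- The point `(y, z)` of `Y ×_M Z`. -/
def pair (y : A.Y) (z : B.Y) (h : A.proj y = B.proj z) : (A.prod B).Y := FibreProd.mk y z h

/-- The projection `Y ×_M Z → Y`. -/
def fst (p : (A.prod B).Y) : A.Y := FibreProd.fst p

/-- The projection `Y ×_M Z → Z`. -/
def snd (p : (A.prod B).Y) : B.Y := FibreProd.snd p

lemma proj_fst_eq (p : (A.prod B).Y) : A.proj (fst p) = B.proj (snd p) := FibreProd.comm p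

lemma contMDiff_fst :
    ContMDiff 𝓘(ℝ, (A.prod B).model) 𝓘(ℝ, A.model) ∞ (fst : (A.prod B).Y → A.Y) :=
  FibreProd.contMDiff_fst A.isSubmersion.contMDiff B.isSubmersion

lemma contMDiff_snd :
    ContMDiff 𝓘(ℝ, (A.prod B).model) 𝓘(ℝ, B.model) ∞ (snd : (A.prod B).Y → B.Y) :=
  FibreProd.contMDiff_snd A.isSubmersion.contMDiff B.isSubmersion

lemma contMDiff_pair {EX X : Type*} [NormedAddCommGroup EX] [NormedSpace ℝ EX]
    [TopologicalSpace X] [ChartedSpace EX X] {k : X → A.Y} {l : X → B.Y}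
    (hk : ContMDiff 𝓘(ℝ, EX) 𝓘(ℝ, A.model) ∞ k) (hl : ContMDiff 𝓘(ℝ, EX) 𝓘(ℝ, B.model) ∞ l)
    (h : ∀ x, A.proj (k x) = B.proj (l x)) :
    ContMDiff 𝓘(ℝ, EX) 𝓘(ℝ, (A.prod B).model) ∞ (fun x => pair (k x) (l x) (h x)) :=
  fun x => FibreProd.contMDiffWithinAt_of_components
    (k := fun x => FibreProd.mk (k x) (l x) (h x)) A.isSubmersion.contMDiff B.isSubmersion
    (hk x) (hl x)

end FibredManifold

/-! ### Spaces with a free and transitive action of `ℂˣ` -/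

/-- The dual `T*` of a principal `ℂˣ`-space `T`: the same space with the inverse action. -/
def DualTorsor (T : Type*) : Type _ := T

instance DualTorsor.instTorsor {T : Type*} [Torsor ℂˣ T] : Torsor ℂˣ (DualTorsor T) where
  smul z p := (z⁻¹ • (show T from p) : T)
  one_smul := fun (p : T) => (by simp : (1 : ℂˣ)⁻¹ • p = p)
  mul_smul := fun z w (p : T) => (by rw [smul_smul, mul_inv] : (z * w)⁻¹ • p = z⁻¹ • w⁻¹ • p)
  sdiv p q := (show T from q) /ₛ (show T from p)
  nonempty := inferInstanceAs (Nonempty T)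
  sdiv_smul' := fun (p q : T) => (by simp : (q /ₛ p)⁻¹ • q = p)
  smul_sdiv' := fun z (p : T) => (by simp [sdiv_smul_eq_sdiv_div] : p /ₛ (z⁻¹ • p) = z)

/-- The equivalence relation on `T × S` whose classes are the orbits of the subgroup
`{(z, z⁻¹)}` of `ℂˣ × ℂˣ`. -/
def tensorSetoid (T S : Type*) [Torsor ℂˣ T] [Torsor ℂˣ S] : Setoid (T × S) where
  r p q := ∃ z : ℂˣ, q = (z • p.1, z⁻¹ • p.2)
  iseqv :=
    { refl := fun p => ⟨1, by simp⟩
      symm := by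
        rintro p _ ⟨z, rfl⟩
        exact ⟨z⁻¹, by simp⟩
      trans := by
        rintro p _ _ ⟨z, rfl⟩ ⟨w, rfl⟩
        exact ⟨w * z, by simp only [mul_smul, mul_inv]⟩ }

/-- The contracted product `T ⊗ S` of two principal `ℂˣ`-spaces. -/
def TensorTorsor (T S : Type*) [Torsor ℂˣ T] [Torsor ℂˣ S] : Type _ :=
  Quotient (tensorSetoid T S)

namespace TensorTorsor

variable {T S : Type*} [Torsor ℂˣ T] [Torsor ℂˣ S]

/-- The class of `(p, q)` in `T ⊗ S`. -/
def tmul (p : T) (q : S) : TensorTorsor T S := Quotient.mk (tensorSetoid T S) (p, q)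

lemma ind {C : TensorTorsor T S → Prop} (h : ∀ p q, C (tmul p q)) (t : TensorTorsor T S) : C t :=
  Quotient.ind (fun x => h x.1 x.2) t

lemma tmul_smul_inv (z : ℂˣ) (p : T) (q : S) : tmul (z • p) (z⁻¹ • q) = tmul p q :=
  (Quotient.sound (s := tensorSetoid T S) (a := (p, q)) ⟨z, rfl⟩).symm

/-- The map out of `T ⊗ S` defined by a function which is invariant under `{(z, z⁻¹)}`. -/
def lift {R : Type*} (k : T → S → R) (hk : ∀ (z : ℂˣ) p q, k (z • p) (z⁻¹ • q) = k p q) :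
    TensorTorsor T S → R :=
  Quotient.lift (s := tensorSetoid T S) (fun x => k x.1 x.2)
    (by rintro x _ ⟨z, rfl⟩; exact (hk z x.1 x.2).symm)

lemma lift_tmul {R : Type*} (k : T → S → R) (hk : ∀ (z : ℂˣ) p q, k (z • p) (z⁻¹ • q) = k p q)
    (p : T) (q : S) : lift k hk (tmul p q) = k p q := rfl

instance : SMul ℂˣ (TensorTorsor T S) where
  smul z := lift (fun p q => tmul (z • p) q) fun w p q => by
    rw [smul_comm z w p, tmul_smul_inv]

lemma smul_tmul (z : ℂˣ) (p : T) (q : S) : z • tmul p q = tmul (z • p) q := rfl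

lemma tmul_smul (z : ℂˣ) (p : T) (q : S) : tmul p (z • q) = z • tmul p q := by
  rw [smul_tmul, ← tmul_smul_inv z p (z • q), inv_smul_smul]

instance : SDiv ℂˣ (TensorTorsor T S) where
  sdiv s t := lift (fun p q => lift (fun p' q' => (p /ₛ p') * (q /ₛ q')) (fun z p' q' => by
      rw [sdiv_smul_eq_sdiv_div, sdiv_smul_eq_sdiv_div, div_mul_div_comm, mul_inv_cancel, div_one]) t)
    (fun z p q => by
      induction t using ind with
      | h p' q' => simp only [lift_tmul, smul_sdiv_assoc]; rw [mul_mul_mul_comm]; simp) s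

lemma tmul_sdiv_tmul (p p' : T) (q q' : S) :
    tmul p q /ₛ tmul p' q' = (p /ₛ p') * (q /ₛ q') := rfl

instance instTorsor : Torsor ℂˣ (TensorTorsor T S) where
  one_smul t := by
    induction t using ind with
    | h p q => rw [smul_tmul, one_smul]
  mul_smul z w t := by
    induction t using ind with
    | h p q => simp only [smul_tmul, mul_smul]
  nonempty := (Torsor.nonempty (G := ℂˣ) (P := T)).elim fun p =>
    (Torsor.nonempty (G := ℂˣ) (P := S)).elim fun q => ⟨tmul p q⟩
  sdiv_smul' s t := by
    induction s using ind with
    | h p q =>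
      induction t using ind with
      | h p' q' =>
        rw [tmul_sdiv_tmul, mul_comm, smul_tmul, mul_smul, sdiv_smul, ← smul_tmul, ← tmul_smul,
          sdiv_smul]
  smul_sdiv' z t := by
    induction t using ind with
    | h p q => rw [smul_tmul, tmul_sdiv_tmul, smul_sdiv, sdiv_self, mul_one]

end TensorTorsor

/-! ### Principal `ℂˣ`-bundles -/

section Smooth

variable {EX X : Type*} [NormedAddCommGroup EX] [NormedSpace ℝ EX]
  [TopologicalSpace X] [ChartedSpace EX X]

lemma contMDiffOn_units_mul {u w : X → ℂˣ} {s : Set X}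
    (hu : ContMDiffOn 𝓘(ℝ, EX) 𝓘(ℝ, ℂ) ∞ (fun x => (u x : ℂ)) s)
    (hw : ContMDiffOn 𝓘(ℝ, EX) 𝓘(ℝ, ℂ) ∞ (fun x => (w x : ℂ)) s) :
    ContMDiffOn 𝓘(ℝ, EX) 𝓘(ℝ, ℂ) ∞ (fun x => ((u x * w x : ℂˣ) : ℂ)) s :=
  ((contDiff_fst.mul contDiff_snd : ContDiff ℝ ∞ fun z : ℂ × ℂ => z.1 * z.2).contMDiff).comp_contMDiffOn
    (hu.prodMk_space hw)

lemma contMDiffOn_units_inv {u : X → ℂˣ} {s : Set X}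
    (hu : ContMDiffOn 𝓘(ℝ, EX) 𝓘(ℝ, ℂ) ∞ (fun x => (u x : ℂ)) s) :
    ContMDiffOn 𝓘(ℝ, EX) 𝓘(ℝ, ℂ) ∞ (fun x => ((u x)⁻¹ : ℂ)) s := by
  intro x hx
  have h : ContDiffAt ℝ ∞ (fun z : ℂ => z⁻¹) (u x) := contDiffAt_inv ℝ (u x).ne_zero
  exact h.contMDiffAt.comp_contMDiffWithinAt x (hu x hx)

end Smooth

/-- A smooth principal `ℂˣ`-bundle over a manifold `X`: a family of principal `ℂˣ`-spaces
`fiber x` (that is, `ℂˣ` acts freely and transitively on the non-empty set `fiber x`), together with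
a local trivialisation around every point `a` of `X`, given by a local section `sec a` over an open
neighbourhood `baseSet a` of `a` (the values of `sec a` outside of `baseSet a` are irrelevant), such
that the transition functions between these trivialisations are smooth. The total space
`⋃ x, fiber x` has then exactly one smooth structure for which the maps
`(x, z) ↦ z • sec a x` are diffeomorphisms from `baseSet a × ℂˣ` onto open subsets. -/
structure CStarBundle (EX : Type*) [NormedAddCommGroup EX] [NormedSpace ℝ EX]
    (X : Type*) [TopologicalSpace X] [ChartedSpace EX X] where
  fiber : X → Type v
  [torsor : ∀ x, Torsor ℂˣ (fiber x)]
  baseSet : X → Set X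
  isOpen_baseSet : ∀ a, IsOpen (baseSet a)
  mem_baseSet : ∀ a, a ∈ baseSet a
  sec : ∀ (_ : X) (x : X), fiber x
  contMDiffOn_transition : ∀ a b, ContMDiffOn 𝓘(ℝ, EX) 𝓘(ℝ, ℂ) ∞
    (fun x => ((sec a x /ₛ sec b x : ℂˣ) : ℂ)) (baseSet a ∩ baseSet b)

attribute [instance] CStarBundle.torsor

namespace CStarBundle

variable {EX X : Type*} [NormedAddCommGroup EX] [NormedSpace ℝ EX]
  [TopologicalSpace X] [ChartedSpace EX X]
  {EX' X' : Type*} [NormedAddCommGroup EX'] [NormedSpace ℝ EX']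
  [TopologicalSpace X'] [ChartedSpace EX' X']

/-- The pull-back of a `ℂˣ`-bundle along a smooth map. -/
def pullback (P : CStarBundle.{v} EX X) (k : X' → X) (hk : ContMDiff 𝓘(ℝ, EX') 𝓘(ℝ, EX) ∞ k) :
    CStarBundle.{v} EX' X' where
  fiber x := P.fiber (k x)
  baseSet a := k ⁻¹' P.baseSet (k a)
  isOpen_baseSet _ := (P.isOpen_baseSet _).preimage hk.continuous
  mem_baseSet _ := P.mem_baseSet _
  sec a x := P.sec (k a) (k x)
  contMDiffOn_transition a b :=
    (P.contMDiffOn_transition (k a) (k b)).comp hk.contMDiffOn fun _ hx => hx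

/-- The dual of a `ℂˣ`-bundle. -/
def dual (P : CStarBundle.{v} EX X) : CStarBundle.{v} EX X where
  fiber x := DualTorsor (P.fiber x)
  baseSet := P.baseSet
  isOpen_baseSet := P.isOpen_baseSet
  mem_baseSet := P.mem_baseSet
  sec := P.sec
  contMDiffOn_transition a b :=
    (P.contMDiffOn_transition b a).mono fun _ hx => ⟨hx.2, hx.1⟩

/-- The contracted product of two `ℂˣ`-bundles. -/
def tensor (P Q : CStarBundle.{v} EX X) : CStarBundle.{v} EX X where
  fiber x := TensorTorsor (P.fiber x) (Q.fiber x)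
  baseSet a := P.baseSet a ∩ Q.baseSet a
  isOpen_baseSet a := (P.isOpen_baseSet a).inter (Q.isOpen_baseSet a)
  mem_baseSet a := ⟨P.mem_baseSet a, Q.mem_baseSet a⟩
  sec a x := TensorTorsor.tmul (P.sec a x) (Q.sec a x)
  contMDiffOn_transition a b :=
    contMDiffOn_units_mul
      ((P.contMDiffOn_transition a b).mono fun _ hx => ⟨hx.1.1, hx.2.1⟩)
      ((Q.contMDiffOn_transition a b).mono fun _ hx => ⟨hx.1.2, hx.2.2⟩)

end CStarBundle

/-! ### Bundle gerbes -/

section Gerbes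

variable {E : Type*} [NormedAddCommGroup E] [NormedSpace ℝ E]
  {M : Type*} [TopologicalSpace M] [ChartedSpace E M] [IsManifold 𝓘(ℝ, E) ∞ M]

namespace FibredManifold

/-- `Y^[2] = Y ×_M Y`. -/
abbrev sq (A : FibredManifold.{v} E M) : FibredManifold.{v} E M := A.prod A

/-- `Y^[3] = Y ×_M Y ×_M Y`. -/
abbrev cube (A : FibredManifold.{v} E M) : FibredManifold.{v} E M := A.sq.prod A

variable {A B : FibredManifold.{v} E M}

/-- The map `Y^[3] → Y^[2]`, `(y₁, y₂, y₃) ↦ (y₁, y₂)`. -/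
def p₁₂ (t : A.cube.Y) : A.sq.Y := pair (fst (fst t)) (snd (fst t)) (proj_fst_eq (fst t))

lemma proj_snd_fst_eq (t : A.cube.Y) : A.proj (snd (fst t)) = A.proj (snd t) :=
  (proj_fst_eq (fst t)).symm.trans (proj_fst_eq t)

/-- The map `Y^[3] → Y^[2]`, `(y₁, y₂, y₃) ↦ (y₂, y₃)`. -/
def p₂₃ (t : A.cube.Y) : A.sq.Y :=
  pair (snd (fst t)) (snd t) (proj_snd_fst_eq t)

/-- The map `Y^[3] → Y^[2]`, `(y₁, y₂, y₃) ↦ (y₁, y₃)`. -/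
def p₁₃ (t : A.cube.Y) : A.sq.Y :=
  pair (fst (fst t)) (snd t) ((proj_fst_eq (fst t)).trans (proj_snd_fst_eq t))

/-- The map `k^[2] : Y^[2] → Z^[2]` induced by a map `k : Y → Z` over `M`. -/
def mapSq (k : A.Y → B.Y) (hk : ∀ y, B.proj (k y) = A.proj y) (p : A.sq.Y) : B.sq.Y :=
  pair (k (fst p)) (k (snd p)) (by rw [hk, hk]; exact proj_fst_eq p)

lemma contMDiff_mapSq {k : A.Y → B.Y} (hk : ∀ y, B.proj (k y) = A.proj y)
    (h : ContMDiff 𝓘(ℝ, A.model) 𝓘(ℝ, B.model) ∞ k) :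
    ContMDiff 𝓘(ℝ, A.sq.model) 𝓘(ℝ, B.sq.model) ∞ (mapSq k hk) :=
  contMDiff_pair (h.comp contMDiff_fst) (h.comp contMDiff_snd) _

lemma contMDiff_mapCube {k : A.Y → B.Y} (hk : ∀ y, B.proj (k y) = A.proj y)
    (h : ContMDiff 𝓘(ℝ, A.model) 𝓘(ℝ, B.model) ∞ k) :
    ContMDiff 𝓘(ℝ, A.cube.model) 𝓘(ℝ, B.cube.model) ∞
      (fun t : A.cube.Y => pair (B := B) (mapSq k hk (fst t)) (k (snd t))
        ((hk _).trans ((proj_fst_eq t).trans (hk _).symm))) :=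
  contMDiff_pair ((contMDiff_mapSq hk h).comp contMDiff_fst) (h.comp contMDiff_snd) _

lemma fst_proj (p : (A.prod B).Y) : A.proj (fst p) = (A.prod B).proj p := rfl

lemma snd_proj (p : (A.prod B).Y) : B.proj (snd p) = (A.prod B).proj p := (proj_fst_eq p).symm

end FibredManifold

open FibredManifold

variable (E M) in
/-- A bundle gerbe `(P, Y)` over `M`: a surjective submersion `base : Y → M`, a smooth principal
`ℂˣ`-bundle `bundle : P → Y^[2]`, and a bundle gerbe product
`mul : P_(y₁,y₂) ⊗ P_(y₂,y₃) → P_(y₁,y₃)`, which is `ℂˣ`-equivariant, associative, and smooth as a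
map of bundles over `Y^[3]`. -/
structure BundleGerbe where
  base : FibredManifold.{v} E M
  bundle : CStarBundle.{v} base.sq.model base.sq.Y
  mul : ∀ {y₁ y₂ y₃ : base.Y} (h₁₂ : base.proj y₁ = base.proj y₂)
    (h₂₃ : base.proj y₂ = base.proj y₃), bundle.fiber (pair y₁ y₂ h₁₂) →
      bundle.fiber (pair y₂ y₃ h₂₃) → bundle.fiber (pair y₁ y₃ (h₁₂.trans h₂₃))
  smul_mul : ∀ {y₁ y₂ y₃ : base.Y} (h₁₂ : base.proj y₁ = base.proj y₂)
    (h₂₃ : base.proj y₂ = base.proj y₃) (z : ℂˣ) (p : bundle.fiber (pair y₁ y₂ h₁₂))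
    (q : bundle.fiber (pair y₂ y₃ h₂₃)), mul h₁₂ h₂₃ (z • p) q = z • mul h₁₂ h₂₃ p q
  mul_smul : ∀ {y₁ y₂ y₃ : base.Y} (h₁₂ : base.proj y₁ = base.proj y₂)
    (h₂₃ : base.proj y₂ = base.proj y₃) (z : ℂˣ) (p : bundle.fiber (pair y₁ y₂ h₁₂))
    (q : bundle.fiber (pair y₂ y₃ h₂₃)), mul h₁₂ h₂₃ p (z • q) = z • mul h₁₂ h₂₃ p q
  mul_assoc : ∀ {y₁ y₂ y₃ y₄ : base.Y} (h₁₂ : base.proj y₁ = base.proj y₂)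
    (h₂₃ : base.proj y₂ = base.proj y₃) (h₃₄ : base.proj y₃ = base.proj y₄)
    (p : bundle.fiber (pair y₁ y₂ h₁₂)) (q : bundle.fiber (pair y₂ y₃ h₂₃))
    (r : bundle.fiber (pair y₃ y₄ h₃₄)),
    mul (h₁₂.trans h₂₃) h₃₄ (mul h₁₂ h₂₃ p q) r = mul h₁₂ (h₂₃.trans h₃₄) p (mul h₂₃ h₃₄ q r)
  /-- With respect to all local trivialisations of `P`, the product is given by a smooth function
  on an open subset of `Y^[3]`. -/
  mul_smooth : ∀ a b c : base.sq.Y, ContMDiffOn 𝓘(ℝ, base.cube.model) 𝓘(ℝ, ℂ) ∞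
    (fun t : base.cube.Y => ((mul (proj_fst_eq (fst t)) (proj_snd_fst_eq t)
        (bundle.sec a (p₁₂ t)) (bundle.sec b (p₂₃ t)) /ₛ bundle.sec c (p₁₃ t) : ℂˣ) : ℂ))
    (p₁₂ ⁻¹' bundle.baseSet a ∩ p₂₃ ⁻¹' bundle.baseSet b ∩ p₁₃ ⁻¹' bundle.baseSet c)

/-- An isomorphism of bundle gerbes `(P, Y) → (Q, Z)`: a diffeomorphism `f : Y → Z` over `M` and an
isomorphism of `ℂˣ`-bundles `g : P → Q` covering `f^[2]` and commuting with the products. -/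
structure BundleGerbe.Iso (P Q : BundleGerbe.{v} E M) where
  toDiffeomorph : Diffeomorph 𝓘(ℝ, P.base.model) 𝓘(ℝ, Q.base.model) P.base.Y Q.base.Y ∞
  proj_comp : ∀ y, Q.base.proj (toDiffeomorph y) = P.base.proj y
  map : ∀ p : P.base.sq.Y, P.bundle.fiber p → Q.bundle.fiber (mapSq toDiffeomorph proj_comp p)
  map_smul : ∀ (p : P.base.sq.Y) (z : ℂˣ) (u : P.bundle.fiber p), map p (z • u) = z • map p u
  /-- With respect to all local trivialisations of `P` and `Q`, the map is given by a smooth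
  function on an open subset of `Y^[2]`. -/
  map_smooth : ∀ (a : P.base.sq.Y) (b : Q.base.sq.Y),
    ContMDiffOn 𝓘(ℝ, P.base.sq.model) 𝓘(ℝ, ℂ) ∞
      (fun p => ((map p (P.bundle.sec a p) /ₛ
        Q.bundle.sec b (mapSq toDiffeomorph proj_comp p) : ℂˣ) : ℂ))
      (P.bundle.baseSet a ∩ mapSq toDiffeomorph proj_comp ⁻¹' Q.bundle.baseSet b)
  map_mul : ∀ {y₁ y₂ y₃ : P.base.Y} (h₁₂ : P.base.proj y₁ = P.base.proj y₂)
    (h₂₃ : P.base.proj y₂ = P.base.proj y₃) (p : P.bundle.fiber (pair y₁ y₂ h₁₂))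
    (q : P.bundle.fiber (pair y₂ y₃ h₂₃)),
    map (pair y₁ y₃ (h₁₂.trans h₂₃)) (P.mul h₁₂ h₂₃ p q) =
      Q.mul (by rw [proj_comp, proj_comp]; exact h₁₂) (by rw [proj_comp, proj_comp]; exact h₂₃)
        (map (pair y₁ y₂ h₁₂) p) (map (pair y₂ y₃ h₂₃) q)

/-- Two bundle gerbes are isomorphic. -/
def BundleGerbe.Isomorphic (P Q : BundleGerbe.{v} E M) : Prop := Nonempty (BundleGerbe.Iso P Q)

namespace BundleGerbe

/-- The dual `(P*, Y)` of a bundle gerbe `(P, Y)`. -/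
def dual (P : BundleGerbe.{v} E M) : BundleGerbe.{v} E M where
  base := P.base
  bundle := P.bundle.dual
  mul h₁₂ h₂₃ p q := P.mul h₁₂ h₂₃ p q
  smul_mul h₁₂ h₂₃ z p q := P.smul_mul h₁₂ h₂₃ z⁻¹ p q
  mul_smul h₁₂ h₂₃ z p q := P.mul_smul h₁₂ h₂₃ z⁻¹ p q
  mul_assoc h₁₂ h₂₃ h₃₄ p q r := P.mul_assoc h₁₂ h₂₃ h₃₄ p q r
  mul_smooth a b c := by
    refine (contMDiffOn_units_inv (P.mul_smooth a b c)).congr fun t _ => ?_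
    rw [← Units.val_inv_eq_inv_val]
    exact congrArg Units.val (inv_sdiv_eq_sdiv_rev _ _).symm

/-- The product of `P_(y₁,y₂) ⊗ Q_(z₁,z₂)` and `P_(y₂,y₃) ⊗ Q_(z₂,z₃)` in the product of two
bundle gerbes. -/
def tensorMul (P Q : BundleGerbe.{v} E M) {y₁ y₂ y₃ : P.base.Y} {z₁ z₂ z₃ : Q.base.Y}
    (h₁₂ : P.base.proj y₁ = P.base.proj y₂) (h₂₃ : P.base.proj y₂ = P.base.proj y₃)
    (k₁₂ : Q.base.proj z₁ = Q.base.proj z₂) (k₂₃ : Q.base.proj z₂ = Q.base.proj z₃)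
    (s : TensorTorsor (P.bundle.fiber (pair y₁ y₂ h₁₂)) (Q.bundle.fiber (pair z₁ z₂ k₁₂)))
    (t : TensorTorsor (P.bundle.fiber (pair y₂ y₃ h₂₃)) (Q.bundle.fiber (pair z₂ z₃ k₂₃))) :
    TensorTorsor (P.bundle.fiber (pair y₁ y₃ (h₁₂.trans h₂₃)))
      (Q.bundle.fiber (pair z₁ z₃ (k₁₂.trans k₂₃))) :=
  TensorTorsor.lift (fun p q => TensorTorsor.lift
      (fun p' q' => TensorTorsor.tmul (P.mul h₁₂ h₂₃ p p') (Q.mul k₁₂ k₂₃ q q'))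
      (fun w p' q' => by rw [P.mul_smul, Q.mul_smul, TensorTorsor.tmul_smul_inv]) t)
    (fun w p q => by
      induction t using TensorTorsor.ind with
      | h p' q' =>
        simp only [TensorTorsor.lift_tmul, P.smul_mul, Q.smul_mul,
          TensorTorsor.tmul_smul_inv]) s

/-- The product `(P ⊗ Q, Y ×_M Z)` of two bundle gerbes `(P, Y)` and `(Q, Z)`, with
`(P ⊗ Q)_((y₁,z₁),(y₂,z₂)) = P_(y₁,y₂) ⊗ Q_(z₁,z₂)`. -/
def tensor (P Q : BundleGerbe.{v} E M) : BundleGerbe.{v} E M where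
  base := P.base.prod Q.base
  bundle := (P.bundle.pullback (mapSq (A := P.base.prod Q.base) fst fst_proj)
      (contMDiff_mapSq fst_proj contMDiff_fst)).tensor
    (Q.bundle.pullback (mapSq (A := P.base.prod Q.base) snd snd_proj)
      (contMDiff_mapSq snd_proj contMDiff_snd))
  mul {y₁ y₂ y₃} h₁₂ h₂₃ s t :=
    tensorMul P Q (y₁ := fst y₁) (y₂ := fst y₂) (y₃ := fst y₃)
      (z₁ := snd y₁) (z₂ := snd y₂) (z₃ := snd y₃) h₁₂ h₂₃
      (by rw [snd_proj, snd_proj]; exact h₁₂) (by rw [snd_proj, snd_proj]; exact h₂₃) s t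
  smul_mul h₁₂ h₂₃ w s t := by
    revert s t
    refine TensorTorsor.ind fun p q => TensorTorsor.ind fun p' q' => ?_
    exact congrArg (fun x => TensorTorsor.tmul x _) (P.smul_mul _ _ w p p')
  mul_smul h₁₂ h₂₃ w s t := by
    revert s t
    refine TensorTorsor.ind fun p q => TensorTorsor.ind fun p' q' => ?_
    exact congrArg (fun x => TensorTorsor.tmul x _) (P.mul_smul _ _ w p p')
  mul_assoc h₁₂ h₂₃ h₃₄ s t u := by
    revert s t u
    refine TensorTorsor.ind fun p q => TensorTorsor.ind fun p' q' =>
      TensorTorsor.ind fun p'' q'' => ?_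
    exact congrArg₂ TensorTorsor.tmul (P.mul_assoc _ _ _ p p' p'') (Q.mul_assoc _ _ _ q q' q'')
  mul_smooth a b c := by
    have hP := (P.mul_smooth (mapSq fst fst_proj a) (mapSq fst fst_proj b)
      (mapSq fst fst_proj c)).comp
        (contMDiff_mapCube (A := P.base.prod Q.base) fst_proj contMDiff_fst).contMDiffOn
        fun _ hx => hx
    have hQ := (Q.mul_smooth (mapSq snd snd_proj a) (mapSq snd snd_proj b)
      (mapSq snd snd_proj c)).comp
        (contMDiff_mapCube (A := P.base.prod Q.base) snd_proj contMDiff_snd).contMDiffOn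
        fun _ hx => hx
    exact contMDiffOn_units_mul
      (hP.mono fun _ hx => ⟨⟨hx.1.1.1, hx.1.2.1⟩, hx.2.1⟩)
      (hQ.mono fun _ hx => ⟨⟨hx.1.1.2, hx.1.2.2⟩, hx.2.2⟩)

/-- The natural pairing `S ⊗ S* → ℂˣ`. -/
def pairing {S : Type*} [Torsor ℂˣ S] (q : S) (q' : DualTorsor S) : ℂˣ := q /ₛ (show S from q')

lemma pairing_smul_left {S : Type*} [Torsor ℂˣ S] (z : ℂˣ) (q : S) (q' : DualTorsor S) :
    pairing (z • q) q' = z * pairing q q' := smul_sdiv_assoc _ _ _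

lemma pairing_smul_right {S : Type*} [Torsor ℂˣ S] (z : ℂˣ) (q : S) (q' : DualTorsor S) :
    pairing q (z • q') = z * pairing q q' := by
  have h : pairing q (z • q') = (q /ₛ (show S from q')) / z⁻¹ := sdiv_smul_eq_sdiv_div _ _ _
  rw [h, div_inv_eq_mul, mul_comm]
  rfl

/-- The map `(T* ⊗ S) × (S* ⊗ R) → T* ⊗ R` induced by the natural pairing `S ⊗ S* → ℂˣ`. -/
def deltaMul {T S R : Type*} [Torsor ℂˣ T] [Torsor ℂˣ S] [Torsor ℂˣ R]
    (s : TensorTorsor (DualTorsor T) S) (t : TensorTorsor (DualTorsor S) R) :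
    TensorTorsor (DualTorsor T) R :=
  TensorTorsor.lift (fun p q => TensorTorsor.lift
      (fun q' r => pairing q q' • TensorTorsor.tmul p r)
      (fun w q' r => by
        rw [pairing_smul_right, TensorTorsor.tmul_smul, smul_smul, mul_inv_cancel_comm]) t)
    (fun w p q => by
      induction t using TensorTorsor.ind with
      | h q' r =>
        rw [TensorTorsor.lift_tmul, TensorTorsor.lift_tmul, pairing_smul_left,
          ← TensorTorsor.smul_tmul, smul_smul, inv_mul_cancel_comm]) s

lemma deltaMul_tmul {T S R : Type*} [Torsor ℂˣ T] [Torsor ℂˣ S] [Torsor ℂˣ R]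
    (p : DualTorsor T) (q : S) (q' : DualTorsor S) (r : R) :
    deltaMul (TensorTorsor.tmul p q) (TensorTorsor.tmul q' r) =
      pairing q q' • TensorTorsor.tmul p r := rfl

lemma deltaMul_smul_left {T S R : Type*} [Torsor ℂˣ T] [Torsor ℂˣ S] [Torsor ℂˣ R]
    (z : ℂˣ) (s : TensorTorsor (DualTorsor T) S) (t : TensorTorsor (DualTorsor S) R) :
    deltaMul (z • s) t = z • deltaMul s t := by
  induction s using TensorTorsor.ind with
  | h p q =>
    induction t using TensorTorsor.ind with
    | h q' r =>
      rw [TensorTorsor.smul_tmul, deltaMul_tmul, deltaMul_tmul, ← TensorTorsor.smul_tmul,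
        smul_smul, smul_smul, mul_comm]

lemma deltaMul_smul_right {T S R : Type*} [Torsor ℂˣ T] [Torsor ℂˣ S] [Torsor ℂˣ R]
    (z : ℂˣ) (s : TensorTorsor (DualTorsor T) S) (t : TensorTorsor (DualTorsor S) R) :
    deltaMul s (z • t) = z • deltaMul s t := by
  induction s using TensorTorsor.ind with
  | h p q =>
    induction t using TensorTorsor.ind with
    | h q' r =>
      rw [TensorTorsor.smul_tmul, deltaMul_tmul, deltaMul_tmul, pairing_smul_right, smul_smul]

lemma deltaMul_assoc {T S R W : Type*} [Torsor ℂˣ T] [Torsor ℂˣ S] [Torsor ℂˣ R] [Torsor ℂˣ W]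
    (s : TensorTorsor (DualTorsor T) S) (t : TensorTorsor (DualTorsor S) R)
    (u : TensorTorsor (DualTorsor R) W) :
    deltaMul (deltaMul s t) u = deltaMul s (deltaMul t u) := by
  induction s using TensorTorsor.ind with
  | h p q =>
    induction t using TensorTorsor.ind with
    | h q' r =>
      induction u using TensorTorsor.ind with
      | h r' x =>
        rw [deltaMul_tmul, deltaMul_tmul, deltaMul_smul_left, deltaMul_smul_right, deltaMul_tmul,
          deltaMul_tmul, smul_smul, smul_smul, mul_comm]

/-- The bundle gerbe `(δ(Q), Y)` defined by a `ℂˣ`-bundle `Q → Y`, with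
`δ(Q)_(y₁,y₂) = Q_{y₁}* ⊗ Q_{y₂}`. -/
def delta (A : FibredManifold.{v} E M) (Q : CStarBundle.{v} A.model A.Y) :
    BundleGerbe.{v} E M where
  base := A
  bundle := (Q.pullback (fst : A.sq.Y → A.Y) contMDiff_fst).dual.tensor
    (Q.pullback (snd : A.sq.Y → A.Y) contMDiff_snd)
  mul {y₁ y₂ y₃} _ _ s t :=
    deltaMul (T := Q.fiber y₁) (S := Q.fiber y₂) (R := Q.fiber y₃) s t
  smul_mul {y₁ y₂ y₃} _ _ w s t :=
    deltaMul_smul_left (T := Q.fiber y₁) (S := Q.fiber y₂) (R := Q.fiber y₃) w s t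
  mul_smul {y₁ y₂ y₃} _ _ w s t :=
    deltaMul_smul_right (T := Q.fiber y₁) (S := Q.fiber y₂) (R := Q.fiber y₃) w s t
  mul_assoc {y₁ y₂ y₃ y₄} _ _ _ s t u :=
    deltaMul_assoc (T := Q.fiber y₁) (S := Q.fiber y₂) (R := Q.fiber y₃) (W := Q.fiber y₄) s t u
  mul_smooth a b c := by
    have h₁ := (Q.contMDiffOn_transition (fst c) (fst a)).comp
      ((contMDiff_fst (A := A) (B := A)).comp (contMDiff_fst (A := A.sq) (B := A))).contMDiffOn
      fun _ hx => hx
    have h₂ := (Q.contMDiffOn_transition (snd a) (fst b)).comp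
      ((contMDiff_snd (A := A) (B := A)).comp (contMDiff_fst (A := A.sq) (B := A))).contMDiffOn
      fun _ hx => hx
    have h₃ := (Q.contMDiffOn_transition (snd b) (snd c)).comp
      (contMDiff_snd (A := A.sq) (B := A)).contMDiffOn fun _ hx => hx
    refine (contMDiffOn_units_mul (h₂.mono fun _ hx => ⟨hx.1.1.2, hx.1.2.1⟩)
      (contMDiffOn_units_mul (h₁.mono fun _ hx => ⟨hx.2.1, hx.1.1.1⟩)
        (h₃.mono fun _ hx => ⟨hx.1.2.2, hx.2.2⟩))).congr fun t _ => ?_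
    exact congrArg Units.val (smul_sdiv_assoc _ _ _)

/-- A bundle gerbe over `M` is trivial if it is isomorphic to `δ(Q)` for some `ℂˣ`-bundle `Q` on
the total space of some surjective submersion onto `M`. -/
def IsTrivial (P : BundleGerbe.{v} E M) : Prop :=
  ∃ (A : FibredManifold.{v} E M) (Q : CStarBundle.{v} A.model A.Y), Isomorphic (delta A Q) P

/-- Two bundle gerbes `P` and `Q` are stably isomorphic if `P ⊗ T₁` is isomorphic to `Q ⊗ T₂` for
some trivial bundle gerbes `T₁` and `T₂`. -/
def StablyIsomorphic (P Q : BundleGerbe.{v} E M) : Prop :=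
  ∃ T₁ T₂ : BundleGerbe.{v} E M, T₁.IsTrivial ∧ T₂.IsTrivial ∧
    Isomorphic (P.tensor T₁) (Q.tensor T₂)

end BundleGerbe

end Gerbes

/-! ### Čech cohomology with integer coefficients -/

section Cech

variable (X : Type*) [TopologicalSpace X]

variable {X} in
/-- An open cover `{U x}` of `X` indexed by the points of `X`, with `x ∈ U x`. Every open cover has
a refinement of this form. -/
def IsPointedCover (U : X → Set X) : Prop := ∀ x, IsOpen (U x) ∧ x ∈ U x

variable {X} in
/-- The intersection `U_{x₀} ∩ … ∩ U_{x_{k-1}}`. -/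
def overlap {k : ℕ} (U : X → Set X) (x : Fin k → X) : Set X := ⋂ i, U (x i)

lemma IsPointedCover.inter {U V : X → Set X} (hU : IsPointedCover U) (hV : IsPointedCover V) :
    IsPointedCover (fun x => U x ∩ V x) :=
  fun x => ⟨(hU x).1.inter (hV x).1, (hU x).2, (hV x).2⟩

lemma overlap_inter_left {k : ℕ} {U V : X → Set X} {x : Fin k → X} :
    overlap (fun y => U y ∩ V y) x ⊆ overlap U x :=
  iInter_mono fun _ => inter_subset_left

lemma overlap_inter_right {k : ℕ} {U V : X → Set X} {x : Fin k → X} :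
    overlap (fun y => U y ∩ V y) x ⊆ overlap V x :=
  iInter_mono fun _ => inter_subset_right

variable {X} in
/-- The Čech differential
`(δn)_{x₀…x_k} = ∑ i, (-1)^i n_{x₀…x_{i-1}x_{i+1}…x_k}`. -/
def cechD {k : ℕ} (n : (Fin k → X) → X → ℤ) : (Fin (k + 1) → X) → X → ℤ :=
  fun x p => ∑ i : Fin (k + 1), (-1) ^ (i : ℕ) * n (fun j => x (i.succAbove j)) p

variable {X} in
lemma cechD_add {k : ℕ} (n m : (Fin k → X) → X → ℤ) : cechD (n + m) = cechD n + cechD m := by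
  funext x p
  simp [cechD, mul_add, Finset.sum_add_distrib]

variable {X} in
lemma cechD_neg {k : ℕ} (n : (Fin k → X) → X → ℤ) : cechD (-n) = -cechD n := by
  funext x p
  simp [cechD]

variable {X} in
lemma cechD_zero {k : ℕ} : cechD (0 : (Fin k → X) → X → ℤ) = 0 := by
  funext x p
  simp [cechD]

/-- Families `n_{x₀…x_{k-1}}` of integer valued functions which, for some cover `U` indexed by the
points of `X`, restrict to a Čech `(k-1)`-cocycle of `U`: `n_{x₀…x_{k-1}}` is locally constant on
`U_{x₀} ∩ … ∩ U_{x_{k-1}}` and `δn = 0` on the intersections of `k + 1` members of `U`. -/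
def cechCocycles (k : ℕ) : AddSubgroup ((Fin k → X) → X → ℤ) where
  carrier := {n | ∃ U : X → Set X, IsPointedCover U ∧
    (∀ x, ContinuousOn (n x) (overlap U x)) ∧ ∀ x, ∀ p ∈ overlap U x, cechD n x p = 0}
  zero_mem' := ⟨fun _ => univ, fun _ => ⟨isOpen_univ, mem_univ _⟩,
    fun _ => continuousOn_const, fun x p _ => by rw [cechD_zero]; rfl⟩
  add_mem' := by
    rintro n m ⟨U, hU, hn, hn'⟩ ⟨V, hV, hm, hm'⟩
    refine ⟨_, hU.inter X hV, fun x => ?_, fun x p hp => ?_⟩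
    · exact ((hn x).mono (overlap_inter_left X)).add ((hm x).mono (overlap_inter_right X))
    · rw [cechD_add, Pi.add_apply, Pi.add_apply, hn' x p (overlap_inter_left X hp),
        hm' x p (overlap_inter_right X hp), add_zero]
  neg_mem' := by
    rintro n ⟨U, hU, hn, hn'⟩
    refine ⟨U, hU, fun x => (hn x).neg, fun x p hp => ?_⟩
    rw [cechD_neg, Pi.neg_apply, Pi.neg_apply, hn' x p hp, neg_zero]

/-- Families `n_{x₀…x_k}` of integer valued functions which, for some cover `U` indexed by the
points of `X`, restrict to a Čech coboundary of `U`: `n = δb` on the intersections of `k + 1` members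
of `U`, where `b_{x₀…x_{k-1}}` is locally constant on `U_{x₀} ∩ … ∩ U_{x_{k-1}}`. -/
def cechCoboundaries (k : ℕ) : AddSubgroup ((Fin (k + 1) → X) → X → ℤ) where
  carrier := {n | ∃ (U : X → Set X) (b : (Fin k → X) → X → ℤ), IsPointedCover U ∧
    (∀ x, ContinuousOn (b x) (overlap U x)) ∧ ∀ x, ∀ p ∈ overlap U x, n x p = cechD b x p}
  zero_mem' := ⟨fun _ => univ, 0, fun _ => ⟨isOpen_univ, mem_univ _⟩,
    fun _ => continuousOn_const, fun x p _ => by rw [cechD_zero]⟩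
  add_mem' := by
    rintro n m ⟨U, b, hU, hb, hn⟩ ⟨V, c, hV, hc, hm⟩
    refine ⟨_, b + c, hU.inter X hV, fun x => ?_, fun x p hp => ?_⟩
    · exact ((hb x).mono (overlap_inter_left X)).add ((hc x).mono (overlap_inter_right X))
    · rw [cechD_add, Pi.add_apply, Pi.add_apply, Pi.add_apply, Pi.add_apply,
        hn x p (overlap_inter_left X hp), hm x p (overlap_inter_right X hp)]
  neg_mem' := by
    rintro n ⟨U, b, hU, hb, hn⟩
    refine ⟨U, -b, hU, fun x => (hb x).neg, fun x p hp => ?_⟩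
    rw [cechD_neg, Pi.neg_apply, Pi.neg_apply, Pi.neg_apply, Pi.neg_apply, hn x p hp]

/-- The Čech cohomology group `H^k(X, ℤ)`, `k ≥ 1`, with values in the constant sheaf `ℤ`: the
direct limit, over all open covers of `X`, of the cohomology of the Čech complex of the cover. The
covers indexed by the points of `X`, with `x ∈ U x`, ordered by `U x ⊆ V x` for all `x`, are
cofinal, and for these the transition maps are restrictions, so that the direct limit is the group
of cocycles modulo coboundaries of some such cover. (For manifolds this is also the singular
cohomology.) -/
abbrev CechCohomology (k : ℕ) : Type _ :=
  cechCocycles X (k + 1) ⧸ (cechCoboundaries X k).addSubgroupOf (cechCocycles X (k + 1))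

end Cech

/-! ### The Dixmier-Douady class -/

section DixmierDouady

variable {E : Type*} [NormedAddCommGroup E] [NormedSpace ℝ E]
  {M : Type u} [TopologicalSpace M] [ChartedSpace E M] [IsManifold 𝓘(ℝ, E) ∞ M]

open FibredManifold

/-- The choices in the construction of the Dixmier-Douady class of a bundle gerbe `(P, Y)`: an open
cover `U i` of `M`, smooth sections `s i : U i → Y`, smooth sections `σ i j` of `(s i, s j)⁻¹(P)`
over `U i ∩ U j`, the functions `g i j k` with `σ i j * σ j k = σ i k * g i j k`, and smooth
logarithms `w i j k` with `exp (2πi * w i j k) = g i j k`. For a cover by open sets over which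
`Y → M` has smooth sections, and all of whose finite intersections are contractible, such `σ` and `w`
always exist; but contractibility is not needed for the class they define. -/
structure BundleGerbe.CocycleData (P : BundleGerbe.{v} E M) where
  ι : Type u
  U : ι → Set M
  isOpen_U : ∀ i, IsOpen (U i)
  cover : ∀ x, ∃ i, x ∈ U i
  s : ι → M → P.base.Y
  s_smooth : ∀ i, ContMDiffOn 𝓘(ℝ, E) 𝓘(ℝ, P.base.model) ∞ (s i) (U i)
  proj_s : ∀ i, ∀ x ∈ U i, P.base.proj (s i x) = x
  σ : ∀ (i j : ι) (x : M) (hi : x ∈ U i) (hj : x ∈ U j),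
    P.bundle.fiber (pair (s i x) (s j x) ((proj_s i x hi).trans (proj_s j x hj).symm))
  /-- In every local trivialisation of `P`, the section `σ i j` is given by a smooth function. -/
  σ_smooth : ∀ (i j : ι) (a : P.base.sq.Y), ∃ k : M → ℂ,
    ContMDiffOn 𝓘(ℝ, E) 𝓘(ℝ, ℂ) ∞ k {x | ∃ (hi : x ∈ U i) (hj : x ∈ U j),
      pair (s i x) (s j x) ((proj_s i x hi).trans (proj_s j x hj).symm) ∈ P.bundle.baseSet a} ∧
    ∀ (x : M) (hi : x ∈ U i) (hj : x ∈ U j),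
      pair (s i x) (s j x) ((proj_s i x hi).trans (proj_s j x hj).symm) ∈ P.bundle.baseSet a →
      ((σ i j x hi hj /ₛ P.bundle.sec a
        (pair (s i x) (s j x) ((proj_s i x hi).trans (proj_s j x hj).symm)) : ℂˣ) : ℂ) = k x
  g : ι → ι → ι → M → ℂˣ
  mul_σ : ∀ (i j k : ι) (x : M) (hi : x ∈ U i) (hj : x ∈ U j) (hk : x ∈ U k),
    P.mul ((proj_s i x hi).trans (proj_s j x hj).symm) ((proj_s j x hj).trans (proj_s k x hk).symm)
      (σ i j x hi hj) (σ j k x hj hk) = g i j k x • σ i k x hi hk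
  w : ι → ι → ι → M → ℂ
  w_smooth : ∀ i j k, ContMDiffOn 𝓘(ℝ, E) 𝓘(ℝ, ℂ) ∞ (w i j k) (U i ∩ U j ∩ U k)
  exp_w : ∀ i j k, ∀ x ∈ U i ∩ U j ∩ U k,
    Complex.exp (2 * Real.pi * Complex.I * w i j k x) = (g i j k x : ℂ)

/-- `c ∈ H³(M, ℤ)` is the Dixmier-Douady class of `P` if it is the image of the class of the
cocycle `g i j k` under the connecting homomorphism `H²(M, ℂˣ) → H³(M, ℤ)` of the exponential
sequence `0 → ℤ → ℂ → ℂˣ → 0`, that is, if it is represented by the cocycle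
`w j k l - w i k l + w i j l - w i j k` of integers, for some choices as above. Here
the cover is re-indexed by the points of `M` by choosing an index `r x` with `x ∈ U (r x)`. -/
def BundleGerbe.IsDixmierDouadyClass (P : BundleGerbe.{v} E M) (c : CechCohomology M 3) : Prop :=
  ∃ (D : P.CocycleData) (r : M → D.ι) (_ : ∀ x, x ∈ D.U (r x)) (n : cechCocycles M 4),
    (∀ (x : Fin 4 → M), ∀ p ∈ overlap (fun y => D.U (r y)) x,
      (n.1 x p : ℂ) = D.w (r (x 1)) (r (x 2)) (r (x 3)) p - D.w (r (x 0)) (r (x 2)) (r (x 3)) p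
        + D.w (r (x 0)) (r (x 1)) (r (x 3)) p - D.w (r (x 0)) (r (x 1)) (r (x 2)) p) ∧
    c = QuotientAddGroup.mk n

/-- The Dixmier-Douady class `d(P) ∈ H³(M, ℤ)` of a bundle gerbe `P`: the unique class with the
property `IsDixmierDouadyClass`. -/
def BundleGerbe.dixmierDouady (P : BundleGerbe.{v} E M) : CechCohomology M 3 :=
  Classical.epsilon P.IsDixmierDouadyClass

end DixmierDouady

end

end BundleGerbes

namespace BundleGerbes

open Set
open Topology

noncomputable section

set_option linter.unusedSectionVars false

/-! ### Čech cochains and refinements -/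

section Refinement

/-! The mechanism is the exponential sequence. Local sections `s x` of `Y → M` and `σ x y` of `P`
over `(s x, s y)` give a `ℂˣ`-valued cocycle `g`, and associativity of the product is exactly the
cocycle identity. After a refinement (`exists_small_refinement`) `g` has logarithms `w`, and `δw` is
integral (`exists_represents`). Two choices of sections are compared through sections `τ x` of `P`
over `(s x, s' x)`. The resulting cocycles differ by a coboundary (`SecData.exists_cohomologous`),
so the integral class is the same (`Represents.eq_of_cohomologous`).

The class is invariant under isomorphism, changes sign under duals, is additive under products, and
vanishes on `δ(Q)`, because sections of `Q` give the constant cocycle `1`. Hence each of (1) and (2)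
implies (3).

The substantial point is that a vanishing class forces triviality. If `δw = δb` with `b` integral,
then `w - b` is a cocycle of smooth functions and hence a coboundary, by a partition of unity.
Exponentiating makes `g` a coboundary (`Represents.exists_eq_coboundary`), and rescaling `σ` makes
the sections strictly multiplicative. The bundles `P_(s x (π y), y)` over `π⁻¹ (V x)` are then
identified consistently by the `σ`, and glue to a bundle `Q` on `Y` (`SecData.glue`). Left division
`(p, q) ↦ p⁻¹q` is an isomorphism `δ(Q) → P` (`SecData.glueIso`). No quotient is needed for the
gluing: covers are indexed by points of `M`, so the fibre at `y` can use the index `x = π y`.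

Applied to `P ⊗ Q*` this gives (3) ⇒ (2). For (3) ⇒ (1), both `Q* ⊗ Q` and `P ⊗ Q*` are trivial, and
`P ⊗ (Q* ⊗ Q)` is isomorphic to `Q ⊗ (P ⊗ Q*)` by permuting factors. Stable isomorphism is thus
equality of classes, which is an equivalence relation. -/

/-- On a paracompact Hausdorff space, every open cover `U` has a refinement `W x ⊆ U (ρ x)` such that
every non-empty intersection `W (x 0) ∩ … ∩ W (x (k - 1))` is contained in prescribed neighbourhoods
inside of the corresponding intersection of members of `U`. -/
theorem exists_small_refinement {X ι : Type*} [TopologicalSpace X] [T2Space X] [ParacompactSpace X]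
    {k : ℕ} (U : ι → Set X) (hU : ∀ i, IsOpen (U i)) (hc : ∀ x, ∃ i, x ∈ U i)
    (N : (Fin k → ι) → X → Set X) (hN : ∀ t p, (∀ j, p ∈ U (t j)) → N t p ∈ 𝓝 p) :
    ∃ (W : X → Set X) (ρ : X → ι), IsPointedCover W ∧ (∀ x, W x ⊆ U (ρ x)) ∧
      ∀ (x : Fin k → X) (p : X), (∀ j, p ∈ W (x j)) → ∀ j,
        (∀ i, x j ∈ U (ρ (x i))) ∧ W (x j) ⊆ N (fun i => ρ (x i)) (x j) := by
  obtain ⟨U', hU'o, hU'c, hU'f, hU'⟩ := precise_refinement U hU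
    (iUnion_eq_univ_iff.2 hc)
  obtain ⟨C, hCc, hCo, hCU⟩ := exists_subset_iUnion_closure_subset isClosed_univ hU'o
    (fun x _ => hU'f.point_finite x) hU'c.ge
  have hρ : ∀ x, ∃ i, x ∈ C i := fun x => mem_iUnion.1 (hCc (mem_univ x))
  choose ρ hρ using hρ
  have hCf : LocallyFinite fun i => closure (C i) := hU'f.subset hCU
  -- Local finiteness makes it possible to remove from a neighbourhood of `x` all the closures that
  -- miss `x` at once.
  have hD : ∀ x : X, IsClosed (⋃ i : {i // x ∉ closure (C i)}, closure (C i)) := fun x =>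
    LocallyFinite.isClosed_iUnion (hCf.comp_injective Subtype.val_injective)
      fun i => isClosed_closure
  have hS : ∀ x : X, {t : Fin k → ι | ∀ j, x ∈ U' (t j)}.Finite := fun x =>
    (Set.Finite.pi' fun _ : Fin k => hU'f.point_finite x)
  -- Only finitely many tuples `t` matter at `x`, because the refined cover is point finite. So the
  -- intersection of the `N t x` is still a neighbourhood of `x`.
  refine ⟨fun x => interior (C (ρ x) ∩ ((⋃ i : {i // x ∉ closure (C i)}, closure (C i))ᶜ ∩
    ⋂ t ∈ {t : Fin k → ι | ∀ j, x ∈ U' (t j)}, N t x)), ρ, fun x => ⟨isOpen_interior, ?_⟩,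
    fun x => interior_subset.trans (inter_subset_left.trans
      (subset_closure.trans ((hCU _).trans (hU' _)))), ?_⟩
  · rw [mem_interior_iff_mem_nhds]
    refine Filter.inter_mem ((hCo _).mem_nhds (hρ x)) (Filter.inter_mem
      ((hD x).isOpen_compl.mem_nhds fun h => ?_) ((Filter.biInter_mem (hS x)).2 fun t ht =>
        hN t x fun j => hU' _ (ht j)))
    obtain ⟨i, hi⟩ := mem_iUnion.1 h
    exact i.2 hi
  · intro x p hp j
    -- Otherwise `W (x j)` would avoid `C (ρ (x i))`, yet `p` lies in both. A common point of the
    -- small sets therefore puts the centres themselves into each other's original sets.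
    have key : ∀ i, x j ∈ U' (ρ (x i)) := by
      intro i
      by_contra h
      have h1 : x j ∉ closure (C (ρ (x i))) := fun h' => h (hCU _ h')
      refine (interior_subset (hp j)).2.1 (mem_iUnion.2 ⟨⟨_, h1⟩, ?_⟩)
      exact subset_closure (interior_subset (hp i)).1
    refine ⟨fun i => hU' _ (key i), fun q hq => ?_⟩
    exact mem_iInter₂.1 (interior_subset hq).2.2 (fun i => ρ (x i)) key

end Refinement

/-! ### Explicit Čech differentials and invariance of classes under re-indexing. -/

section CechLemmas

variable {X : Type*} [TopologicalSpace X]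

lemma mem_overlap {k : ℕ} {U : X → Set X} {x : Fin k → X} {p : X} :
    p ∈ overlap U x ↔ ∀ i, p ∈ U (x i) := mem_iInter

lemma IsPointedCover.isOpen_overlap {k : ℕ} {U : X → Set X} (hU : IsPointedCover U)
    (x : Fin k → X) : IsOpen (overlap U x) :=
  isOpen_iInter_of_finite fun i => (hU (x i)).1

lemma cechD_three (b : (Fin 3 → X) → X → ℤ) (x : Fin 4 → X) (p : X) :
    cechD b x p = b ![x 1, x 2, x 3] p - b ![x 0, x 2, x 3] p + b ![x 0, x 1, x 3] p
      - b ![x 0, x 1, x 2] p := by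
  have h0 : (fun j => x (Fin.succAbove 0 j)) = ![x 1, x 2, x 3] := by
    funext j; fin_cases j <;> rfl
  have h1 : (fun j => x (Fin.succAbove 1 j)) = ![x 0, x 2, x 3] := by
    funext j; fin_cases j <;> rfl
  have h2 : (fun j => x (Fin.succAbove 2 j)) = ![x 0, x 1, x 3] := by
    funext j; fin_cases j <;> rfl
  have h3 : (fun j => x (Fin.succAbove 3 j)) = ![x 0, x 1, x 2] := by
    funext j; fin_cases j <;> rfl
  refine (Fin.sum_univ_four fun i : Fin 4 =>
    (-1 : ℤ) ^ (i : ℕ) * b (fun j => x (i.succAbove j)) p).trans ?_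
  rw [h0, h1, h2, h3]
  norm_num
  ring

lemma cechD_four (n : (Fin 4 → X) → X → ℤ) (x : Fin 5 → X) (p : X) :
    cechD n x p = n ![x 1, x 2, x 3, x 4] p - n ![x 0, x 2, x 3, x 4] p
      + n ![x 0, x 1, x 3, x 4] p - n ![x 0, x 1, x 2, x 4] p + n ![x 0, x 1, x 2, x 3] p := by
  have h0 : (fun j => x (Fin.succAbove 0 j)) = ![x 1, x 2, x 3, x 4] := by
    funext j; fin_cases j <;> rfl
  have h1 : (fun j => x (Fin.succAbove 1 j)) = ![x 0, x 2, x 3, x 4] := by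
    funext j; fin_cases j <;> rfl
  have h2 : (fun j => x (Fin.succAbove 2 j)) = ![x 0, x 1, x 3, x 4] := by
    funext j; fin_cases j <;> rfl
  have h3 : (fun j => x (Fin.succAbove 3 j)) = ![x 0, x 1, x 2, x 4] := by
    funext j; fin_cases j <;> rfl
  have h4 : (fun j => x (Fin.succAbove 4 j)) = ![x 0, x 1, x 2, x 3] := by
    funext j; fin_cases j <;> rfl
  refine (Fin.sum_univ_five fun i : Fin 5 =>
    (-1 : ℤ) ^ (i : ℕ) * n (fun j => x (i.succAbove j)) p).trans ?_
  rw [h0, h1, h2, h3, h4]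
  norm_num
  ring

lemma eq_vec_four {α : Type*} (x : Fin 4 → α) : x = ![x 0, x 1, x 2, x 3] := by
  funext j; fin_cases j <;> rfl

/-- Re-indexing a cocycle along a refinement map `ρ` does not change its class. -/
lemma reindex_mem_cechCoboundaries {n : (Fin 4 → X) → X → ℤ} {U W : X → Set X}
    (hn : ∀ x, ContinuousOn (n x) (overlap U x))
    (hn' : ∀ x, ∀ p ∈ overlap U x, cechD n x p = 0)
    (hW : IsPointedCover W) {ρ : X → X} (h₁ : ∀ x, W x ⊆ U x) (h₂ : ∀ x, W x ⊆ U (ρ x)) :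
    (fun x p => n x p - n (fun i => ρ (x i)) p) ∈ cechCoboundaries X 3 := by
  have hc : ∀ (a b c d : X) (V : Set X), V ⊆ U a → V ⊆ U b → V ⊆ U c → V ⊆ U d →
      ContinuousOn (n ![a, b, c, d]) V := fun a b c d V ha hb hc hd =>
    (hn _).mono fun p hp => mem_overlap.2 fun i => by
      fin_cases i
      exacts [ha hp, hb hp, hc hp, hd hp]
  have hd : ∀ (a b c d e p : X), p ∈ U a → p ∈ U b → p ∈ U c → p ∈ U d → p ∈ U e →
      n ![b, c, d, e] p - n ![a, c, d, e] p + n ![a, b, d, e] p - n ![a, b, c, e] p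
        + n ![a, b, c, d] p = 0 := fun a b c d e p ha hb hc hd he => by
    rw [← hn' ![a, b, c, d, e] p (mem_overlap.2 fun i => by
      fin_cases i
      exacts [ha, hb, hc, hd, he]), cechD_four]
    rfl
  -- This is the prism homotopy between the identity and `ρ`. The alternating sum of the cocycle
  -- identities on `(ρ x₀, …, ρ xᵢ, xᵢ, …, x₃)` telescopes to the required equation.
  refine ⟨W, fun x p => n ![ρ (x 0), x 0, x 1, x 2] p - n ![ρ (x 0), ρ (x 1), x 1, x 2] p
    + n ![ρ (x 0), ρ (x 1), ρ (x 2), x 2] p, hW, fun x => ?_, fun x p hp => ?_⟩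
  · have hx : ∀ i, overlap W x ⊆ W (x i) := fun i p hp => mem_overlap.1 hp i
    have hx₁ : ∀ i, overlap W x ⊆ U (x i) := fun i => (hx i).trans (h₁ _)
    have hx₂ : ∀ i, overlap W x ⊆ U (ρ (x i)) := fun i => (hx i).trans (h₂ _)
    exact ((hc _ _ _ _ _ (hx₂ _) (hx₁ _) (hx₁ _) (hx₁ _)).sub
      (hc _ _ _ _ _ (hx₂ _) (hx₂ _) (hx₁ _) (hx₁ _))).add
      (hc _ _ _ _ _ (hx₂ _) (hx₂ _) (hx₂ _) (hx₁ _))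
  · have hx₁ : ∀ i, p ∈ U (x i) := fun i => h₁ _ (mem_overlap.1 hp i)
    have hx₂ : ∀ i, p ∈ U (ρ (x i)) := fun i => h₂ _ (mem_overlap.1 hp i)
    have e₀ := hd _ _ _ _ _ p (hx₂ 0) (hx₁ 0) (hx₁ 1) (hx₁ 2) (hx₁ 3)
    have e₁ := hd _ _ _ _ _ p (hx₂ 0) (hx₂ 1) (hx₁ 1) (hx₁ 2) (hx₁ 3)
    have e₂ := hd _ _ _ _ _ p (hx₂ 0) (hx₂ 1) (hx₂ 2) (hx₁ 2) (hx₁ 3)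
    have e₃ := hd _ _ _ _ _ p (hx₂ 0) (hx₂ 1) (hx₂ 2) (hx₂ 3) (hx₁ 3)
    have f₁ := eq_vec_four x
    have f₂ := eq_vec_four fun i => ρ (x i)
    rw [cechD_three]
    simp only [Matrix.cons_val]
    rw [f₂]
    conv_lhs => rw [f₁]
    simp only [Matrix.cons_val]
    linarith

/-- Integral cochains arise below as floors of continuous complex expressions that happen to be
integers. They are locally constant because `ℤ` is embedded in `ℝ`. -/
lemma continuousOn_of_intCast {f : X → ℤ} {g : X → ℂ} {s : Set X} (hg : ContinuousOn g s)
    (h : ∀ x ∈ s, (f x : ℂ) = g x) : ContinuousOn f s := by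
  have hr : ContinuousOn (fun x => (f x : ℝ)) s :=
    (Complex.continuous_re.comp_continuousOn hg).congr fun x hx => by simp [← h x hx]
  exact Int.isClosedEmbedding_coe_real.isInducing.continuousOn_iff.2 hr

end CechLemmas

/-! ### The connecting homomorphism of the exponential sequence -/

section Bockstein

variable {E : Type*} [NormedAddCommGroup E] [NormedSpace ℝ E]
  {M : Type*} [TopologicalSpace M] [ChartedSpace E M]

lemma contMDiffAt_units_mul {u u' : M → ℂˣ} {p : M}
    (hu : ContMDiffAt 𝓘(ℝ, E) 𝓘(ℝ, ℂ) ∞ (fun x => (u x : ℂ)) p)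
    (hu' : ContMDiffAt 𝓘(ℝ, E) 𝓘(ℝ, ℂ) ∞ (fun x => (u' x : ℂ)) p) :
    ContMDiffAt 𝓘(ℝ, E) 𝓘(ℝ, ℂ) ∞ (fun x => ((u x * u' x : ℂˣ) : ℂ)) p := by
  rw [← contMDiffWithinAt_univ] at *
  exact ((contDiff_fst.mul contDiff_snd : ContDiff ℝ ∞ fun z : ℂ × ℂ => z.1 * z.2).contMDiff
    ).contMDiffAt.comp_contMDiffWithinAt p (hu.prodMk_space hu')

lemma contMDiffAt_units_inv {u : M → ℂˣ} {p : M}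
    (hu : ContMDiffAt 𝓘(ℝ, E) 𝓘(ℝ, ℂ) ∞ (fun x => (u x : ℂ)) p) :
    ContMDiffAt 𝓘(ℝ, E) 𝓘(ℝ, ℂ) ∞ (fun x => ((u x)⁻¹ : ℂˣ).val) p := by
  have h : ContDiffAt ℝ ∞ (fun z : ℂ => z⁻¹) (u p) := contDiffAt_inv ℝ (u p).ne_zero
  simp only [Units.val_inv_eq_inv_val]
  exact h.contMDiffAt.comp p hu

/-- A logarithm (divided by `2πi`) of a function `u`, which is smooth wherever `u` is smooth and
`u q / u p` is not a non-positive real number. -/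
def logAt {X : Type*} (u : X → ℂˣ) (p q : X) : ℂ :=
  (Complex.log ((u q : ℂ) / u p) + Complex.log (u p)) / (2 * Real.pi * Complex.I)

lemma exp_logAt {X : Type*} (u : X → ℂˣ) (p q : X) :
    Complex.exp (2 * Real.pi * Complex.I * logAt u p q) = u q := by
  rw [logAt, mul_div_cancel₀ _ Complex.two_pi_I_ne_zero, Complex.exp_add,
    Complex.exp_log (div_ne_zero (u q).ne_zero (u p).ne_zero), Complex.exp_log (u p).ne_zero,
    div_mul_cancel₀ _ (u p).ne_zero]

lemma contMDiffAt_logAt {u : M → ℂˣ} {p q : M}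
    (hu : ContMDiffAt 𝓘(ℝ, E) 𝓘(ℝ, ℂ) ∞ (fun x => (u x : ℂ)) q)
    (hq : (u q : ℂ) / u p ∈ Complex.slitPlane) :
    ContMDiffAt 𝓘(ℝ, E) 𝓘(ℝ, ℂ) ∞ (logAt u p) q := by
  have h : ContDiffAt ℝ ∞ (fun z : ℂ => (Complex.log (z / u p) + Complex.log (u p)) /
      (2 * Real.pi * Complex.I)) (u q) := by
    refine ContDiffAt.div_const (ContDiffAt.add ?_ contDiffAt_const) _
    have h1 : ContDiffAt ℂ ∞ Complex.log ((u q : ℂ) / u p) := Complex.contDiffAt_log hq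
    exact (h1.restrict_scalars ℝ).comp (u q : ℂ) (contDiffAt_id.div_const _)
  exact h.contMDiffAt.comp q hu

/-- The ratio equals `1` at `p`. These are the neighbourhoods fed into `exists_small_refinement`, so
that `logAt` becomes smooth on overlaps. -/
lemma slitPlane_mem_nhds {X : Type*} [TopologicalSpace X] {u : X → ℂˣ} {p : X}
    (hu : ContinuousAt (fun x => (u x : ℂ)) p) :
    {q | (u q : ℂ) / u p ∈ Complex.slitPlane} ∈ 𝓝 p := by
  refine (hu.div_const (u p : ℂ)).preimage_mem_nhds (Complex.isOpen_slitPlane.mem_nhds ?_)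
  rw [div_self (u p).ne_zero]
  exact Complex.one_mem_slitPlane

/-- Naming the integer as a floor lets cochains be defined by a formula on all of `M`, with no
choice of integers on overlaps. -/
lemma exists_int_of_exp_eq_one {z : ℂ} (h : Complex.exp (2 * Real.pi * Complex.I * z) = 1) :
    ((⌊z.re⌋ : ℤ) : ℂ) = z := by
  obtain ⟨n, hn⟩ := Complex.exp_eq_one_iff.1 h
  have : z = n := by
    rw [mul_comm] at hn
    exact mul_right_cancel₀ Complex.two_pi_I_ne_zero hn
  rw [this]
  simp

/-- The cocycle `g` is, over some cover indexed by the points of `M`, of the form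
`exp (2πi * w)`, and `c ∈ H³(M, ℤ)` is the class of the integral cocycle `δw`. -/
def Represents (E : Type*) [NormedAddCommGroup E] [NormedSpace ℝ E] {M : Type*}
    [TopologicalSpace M] [ChartedSpace E M] (g : M → M → M → M → ℂˣ)
    (c : CechCohomology M 3) : Prop :=
  ∃ (V : M → Set M) (w : M → M → M → M → ℂ) (n : cechCocycles M 4), IsPointedCover V ∧
    (∀ x y z p, p ∈ V x → p ∈ V y → p ∈ V z → ContMDiffAt 𝓘(ℝ, E) 𝓘(ℝ, ℂ) ∞ (w x y z) p) ∧
    (∀ x y z p, p ∈ V x → p ∈ V y → p ∈ V z →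
      Complex.exp (2 * Real.pi * Complex.I * w x y z p) = g x y z p) ∧
    (∀ (x : Fin 4 → M), ∀ p ∈ overlap V x,
      (n.1 x p : ℂ) = w (x 1) (x 2) (x 3) p - w (x 0) (x 2) (x 3) p + w (x 0) (x 1) (x 3) p
        - w (x 0) (x 1) (x 2) p) ∧
    c = QuotientAddGroup.mk n

lemma Represents.mul {g g' : M → M → M → M → ℂˣ} {c c' : CechCohomology M 3}
    (h : Represents E g c) (h' : Represents E g' c') :
    Represents E (fun x y z p => g x y z p * g' x y z p) (c + c') := by
  obtain ⟨V, w, n, hV, hw, he, hn, rfl⟩ := h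
  obtain ⟨V', w', n', hV', hw', he', hn', rfl⟩ := h'
  refine ⟨fun x => V x ∩ V' x, fun x y z p => w x y z p + w' x y z p, n + n', hV.inter M hV',
    fun x y z p hx hy hz => ?_, fun x y z p hx hy hz => ?_, fun x p hp => ?_, rfl⟩
  · exact (hw x y z p hx.1 hy.1 hz.1).add (hw' x y z p hx.2 hy.2 hz.2)
  · rw [mul_add, Complex.exp_add, he x y z p hx.1 hy.1 hz.1, he' x y z p hx.2 hy.2 hz.2,
      Units.val_mul]
  · have h₁ := hn x p (overlap_inter_left M hp)
    have h₂ := hn' x p (overlap_inter_right M hp)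
    rw [AddSubgroup.coe_add, Pi.add_apply, Pi.add_apply, Int.cast_add, h₁, h₂]
    ring

lemma Represents.inv {g : M → M → M → M → ℂˣ} {c : CechCohomology M 3}
    (h : Represents E g c) : Represents E (fun x y z p => (g x y z p)⁻¹) (-c) := by
  obtain ⟨V, w, n, hV, hw, he, hn, rfl⟩ := h
  refine ⟨V, fun x y z p => -w x y z p, -n, hV,
    fun x y z p hx hy hz => (hw x y z p hx hy hz).neg, fun x y z p hx hy hz => ?_,
    fun x p hp => ?_, rfl⟩
  · rw [mul_neg, Complex.exp_neg, he x y z p hx hy hz, Units.val_inv_eq_inv_val]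
  · rw [AddSubgroup.coe_neg, Pi.neg_apply, Pi.neg_apply, Int.cast_neg, hn x p hp]
    ring

lemma represents_one : Represents E (fun _ _ _ _ : M => (1 : ℂˣ)) 0 :=
  ⟨fun _ => univ, fun _ _ _ _ => 0, 0, fun _ => ⟨isOpen_univ, mem_univ _⟩,
    fun _ _ _ _ _ _ _ => contMDiffAt_const, fun _ _ _ _ _ _ _ => by simp,
    fun _ _ _ => by simp, rfl⟩

/-- Every smooth cocycle has smooth logarithms after passing to a refinement. -/
theorem exists_represents [T2Space M] [ParacompactSpace M] {g : M → M → M → M → ℂˣ}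
    {V : M → Set M} (hV : IsPointedCover V)
    (hg : ∀ x y z p, p ∈ V x → p ∈ V y → p ∈ V z →
      ContMDiffAt 𝓘(ℝ, E) 𝓘(ℝ, ℂ) ∞ (fun q => (g x y z q : ℂ)) p)
    (hc : ∀ x y z t p, p ∈ V x → p ∈ V y → p ∈ V z → p ∈ V t →
      g y z t p * g x y t p = g x z t p * g x y z p) :
    ∃ (W : M → Set M) (ρ : M → M) (c : CechCohomology M 3), IsPointedCover W ∧
      (∀ x, W x ⊆ V (ρ x)) ∧ Represents E (fun x y z => g (ρ x) (ρ y) (ρ z)) c := by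
  obtain ⟨W, ρ, hW, hWV, hWN⟩ := exists_small_refinement (k := 3) V (fun x => (hV x).1)
    (fun x => ⟨x, (hV x).2⟩)
    (fun t p => {q | (g (t 0) (t 1) (t 2) q : ℂ) / g (t 0) (t 1) (t 2) p ∈ Complex.slitPlane})
    (fun t p hp => slitPlane_mem_nhds (hg _ _ _ p (hp 0) (hp 1) (hp 2)).continuousAt)
  -- The logarithm is based at the first index `x`, a point of `M`. Whenever the triple overlap is
  -- non-empty, `W x` lies in the region around `x` where this logarithm is smooth.
  set w : M → M → M → M → ℂ := fun x y z => logAt (g (ρ x) (ρ y) (ρ z)) x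
  have hw : ∀ x y z p, p ∈ W x → p ∈ W y → p ∈ W z →
      ContMDiffAt 𝓘(ℝ, E) 𝓘(ℝ, ℂ) ∞ (w x y z) p := fun x y z p hx hy hz =>
    contMDiffAt_logAt (hg _ _ _ p (hWV x hx) (hWV y hy) (hWV z hz))
      ((hWN ![x, y, z] p (fun j => by fin_cases j; exacts [hx, hy, hz]) 0).2 hx)
  have he : ∀ x y z p, Complex.exp (2 * Real.pi * Complex.I * w x y z p) =
      g (ρ x) (ρ y) (ρ z) p := fun x y z p => exp_logAt _ _ _
  set d : (Fin 4 → M) → M → ℂ := fun x p => w (x 1) (x 2) (x 3) p - w (x 0) (x 2) (x 3) p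
    + w (x 0) (x 1) (x 3) p - w (x 0) (x 1) (x 2) p with hd_def
  have hd : ∀ x, ∀ p ∈ overlap W x, ((⌊(d x p).re⌋ : ℤ) : ℂ) = d x p := by
    intro x p hp
    apply exists_int_of_exp_eq_one
    have h := congrArg Units.val (hc _ _ _ _ p (hWV _ (mem_overlap.1 hp 0))
      (hWV _ (mem_overlap.1 hp 1)) (hWV _ (mem_overlap.1 hp 2)) (hWV _ (mem_overlap.1 hp 3)))
    simp only [Units.val_mul] at h
    simp only [hd_def, mul_sub, mul_add, Complex.exp_sub, Complex.exp_add, he]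
    rw [div_mul_eq_mul_div, h, div_div, div_self]
    exact mul_ne_zero (Units.ne_zero _) (Units.ne_zero _)
  have hdc : ∀ x, ContinuousOn (d x) (overlap W x) := by
    intro x p hp
    have hp' := mem_overlap.1 hp
    have h := fun i j k => (hw (x i) (x j) (x k) p (hp' i) (hp' j) (hp' k)).continuousAt
    exact (((h 1 2 3).sub (h 0 2 3)).add (h 0 1 3) |>.sub (h 0 1 2)).continuousWithinAt
  -- Off the overlaps the floor is a junk value, which no condition on cocycles sees.
  refine ⟨W, ρ, QuotientAddGroup.mk ⟨fun x p => ⌊(d x p).re⌋, W, hW, fun x =>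
    continuousOn_of_intCast (hdc x) (hd x), fun x p hp => ?_⟩, hW, hWV, W, w, _, hW, hw,
    fun x y z p _ _ _ => he x y z p, hd, rfl⟩
  have hp' := mem_overlap.1 hp
  have h : ∀ i j k l : Fin 5, ((⌊(d ![x i, x j, x k, x l] p).re⌋ : ℤ) : ℂ) =
      w (x j) (x k) (x l) p - w (x i) (x k) (x l) p + w (x i) (x j) (x l) p
        - w (x i) (x j) (x k) p := fun i j k l =>
    hd _ p (mem_overlap.2 fun m => by fin_cases m; exacts [hp' i, hp' j, hp' k, hp' l])
  rw [cechD_four, ← Int.cast_inj (α := ℂ)]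
  push_cast [h]
  ring

/-- Cohomologous smooth cocycles represent the same class. -/
theorem Represents.eq_of_cohomologous [T2Space M] [ParacompactSpace M]
    {g g' : M → M → M → M → ℂˣ} {c c' : CechCohomology M 3}
    (hg : Represents E g c) (hg' : Represents E g' c') {V : M → Set M} (hV : IsPointedCover V)
    {h : M → M → M → ℂˣ}
    (hh : ∀ x y p, p ∈ V x → p ∈ V y → ContMDiffAt 𝓘(ℝ, E) 𝓘(ℝ, ℂ) ∞ (fun q => (h x y q : ℂ)) p)
    (hgh : ∀ x y z p, p ∈ V x → p ∈ V y → p ∈ V z →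
      g' x y z p * h x z p = g x y z p * (h x y p * h y z p)) : c = c' := by
  obtain ⟨V₁, w, n, hV₁, hw, he, hn, rfl⟩ := hg
  obtain ⟨V₂, w', n', hV₂, hw', he', hn', rfl⟩ := hg'
  -- The cover on which `n` is a cocycle need not be the cover `V₁` on which it equals `δw`, so both
  -- enter the common refinement.
  obtain ⟨V₃, hV₃, hnc, hnd⟩ := n.2
  obtain ⟨V₄, hV₄, hnc', hnd'⟩ := n'.2
  set U : M → Set M := fun x => V x ∩ ((V₁ x ∩ V₂ x) ∩ (V₃ x ∩ V₄ x))
  have hU : IsPointedCover U := hV.inter M ((hV₁.inter M hV₂).inter M (hV₃.inter M hV₄))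
  obtain ⟨W, ρ, hW, hWV, hWN⟩ := exists_small_refinement (k := 2) U (fun x => (hU x).1)
    (fun x => ⟨x, (hU x).2⟩)
    (fun t p => {q | (h (t 0) (t 1) q : ℂ) / h (t 0) (t 1) p ∈ Complex.slitPlane})
    (fun t p hp => slitPlane_mem_nhds (hh _ _ p (hp 0).1 (hp 1).1).continuousAt)
  set m : M → M → M → ℂ := fun x y => logAt (h (ρ x) (ρ y)) x
  have hm : ∀ x y p, p ∈ W x → p ∈ W y → ContinuousAt (m x y) p := fun x y p hx hy =>
    (contMDiffAt_logAt (hh _ _ p (hWV x hx).1 (hWV y hy).1)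
      ((hWN ![x, y] p (fun j => by fin_cases j; exacts [hx, hy]) 0).2 hx)).continuousAt
  have hme : ∀ x y p, Complex.exp (2 * Real.pi * Complex.I * m x y p) = h (ρ x) (ρ y) p :=
    fun x y p => exp_logAt _ _ _
  -- This is `w' - w - δm`, where `m` is a logarithm of `h`. It is integral because `g' = g · δh`,
  -- and its differential is `n' - n` re-indexed by `ρ`, since `δδm = 0`.
  set d : (Fin 3 → M) → M → ℂ := fun x p => w' (ρ (x 0)) (ρ (x 1)) (ρ (x 2)) p
    - w (ρ (x 0)) (ρ (x 1)) (ρ (x 2)) p - (m (x 0) (x 1) p + m (x 1) (x 2) p - m (x 0) (x 2) p)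
    with hd_def
  have hd : ∀ x, ∀ p ∈ overlap W x, ((⌊(d x p).re⌋ : ℤ) : ℂ) = d x p := by
    intro x p hp
    have hp' := fun i => hWV _ (mem_overlap.1 hp i)
    apply exists_int_of_exp_eq_one
    have h := congrArg Units.val (hgh _ _ _ p (hp' 0).1 (hp' 1).1 (hp' 2).1)
    simp only [Units.val_mul] at h
    simp only [hd_def, mul_sub, mul_add, Complex.exp_sub, Complex.exp_add, hme]
    rw [he _ _ _ p (hp' 0).2.1.1 (hp' 1).2.1.1 (hp' 2).2.1.1,
      he' _ _ _ p (hp' 0).2.1.2 (hp' 1).2.1.2 (hp' 2).2.1.2, div_div, mul_div_assoc', ← h]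
    field_simp
  have hdc : ∀ x, ContinuousOn (d x) (overlap W x) := by
    intro x p hp
    have hp₀ := mem_overlap.1 hp
    have hp' := fun i => hWV _ (hp₀ i)
    exact (((hw' _ _ _ p (hp' 0).2.1.2 (hp' 1).2.1.2 (hp' 2).2.1.2).continuousAt.sub
      (hw _ _ _ p (hp' 0).2.1.1 (hp' 1).2.1.1 (hp' 2).2.1.1).continuousAt).sub
      (((hm _ _ p (hp₀ 0) (hp₀ 1)).add (hm _ _ p (hp₀ 1) (hp₀ 2))).sub
        (hm _ _ p (hp₀ 0) (hp₀ 2)))).continuousWithinAt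
  have key : (fun x p => n'.1 (fun i => ρ (x i)) p - n.1 (fun i => ρ (x i)) p) ∈
      cechCoboundaries M 3 := by
    refine ⟨W, fun x p => ⌊(d x p).re⌋, hW, fun x => continuousOn_of_intCast (hdc x) (hd x),
      fun x p hp => ?_⟩
    have hp₀ := mem_overlap.1 hp
    have hp' := fun i => hWV _ (hp₀ i)
    have h : ∀ i j k : Fin 4, ((⌊(d ![x i, x j, x k] p).re⌋ : ℤ) : ℂ) =
        w' (ρ (x i)) (ρ (x j)) (ρ (x k)) p - w (ρ (x i)) (ρ (x j)) (ρ (x k)) p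
          - (m (x i) (x j) p + m (x j) (x k) p - m (x i) (x k) p) := fun i j k =>
      hd _ p (mem_overlap.2 fun l => by fin_cases l; exacts [hp₀ i, hp₀ j, hp₀ k])
    rw [cechD_three, ← Int.cast_inj (α := ℂ)]
    push_cast [h]
    rw [hn _ p (mem_overlap.2 fun i => (hp' i).2.1.1),
      hn' _ p (mem_overlap.2 fun i => (hp' i).2.1.2)]
    ring
  -- Removing `ρ` requires the small set at `x` to lie in the cocycle cover at `x` as well as at `ρ
  -- x`; intersecting with `U` supplies the former.
  have hWU := hW.inter M hU
  have r₁ := reindex_mem_cechCoboundaries hnc hnd hWU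
    (fun x p hp => hp.2.2.2.1) (fun x p hp => (hWV x hp.1).2.2.1)
  have r₂ := reindex_mem_cechCoboundaries hnc' hnd' hWU
    (fun x p hp => hp.2.2.2.2) (fun x p hp => (hWV x hp.1).2.2.2)
  rw [QuotientAddGroup.eq, AddSubgroup.mem_addSubgroupOf]
  convert add_mem (sub_mem r₂ r₁) key using 1
  funext x p
  simp only [AddSubgroup.coe_add, AddSubgroup.coe_neg, Pi.add_apply, Pi.neg_apply, Pi.sub_apply]
  ring

/-- A smooth cocycle representing `0` is a coboundary. -/
theorem Represents.exists_eq_coboundary [FiniteDimensional ℝ E] [IsManifold 𝓘(ℝ, E) ∞ M]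
    [T2Space M] [SigmaCompactSpace M] {g : M → M → M → M → ℂˣ} (hg : Represents E g 0) :
    ∃ (V : M → Set M) (h : M → M → M → ℂˣ), IsPointedCover V ∧
      (∀ x y p, p ∈ V x → p ∈ V y →
        ContMDiffAt 𝓘(ℝ, E) 𝓘(ℝ, ℂ) ∞ (fun q => (h x y q : ℂ)) p) ∧
      ∀ x y z p, p ∈ V x → p ∈ V y → p ∈ V z → g x y z p * h x z p = h x y p * h y z p := by
  obtain ⟨V₁, w, n, hV₁, hw, he, hn, h0⟩ := hg
  rw [eq_comm, QuotientAddGroup.eq_zero_iff, AddSubgroup.mem_addSubgroupOf] at h0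
  obtain ⟨V₂, b, hV₂, hb, hnb⟩ := h0
  set V : M → Set M := fun x => V₁ x ∩ V₂ x
  have hV : IsPointedCover V := hV₁.inter M hV₂
  -- Since `δw = n = δb`, the difference `w - b` is an honest additive cocycle, and it is still a
  -- logarithm of `g` because `b` is integral.
  set u : M → M → M → M → ℂ := fun x y z p => w x y z p - b ![x, y, z] p with hu_def
  have hu : ∀ x y z p, p ∈ V x → p ∈ V y → p ∈ V z →
      ContMDiffAt 𝓘(ℝ, E) 𝓘(ℝ, ℂ) ∞ (u x y z) p := by
    intro x y z p hx hy hz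
    refine (hw x y z p hx.1 hy.1 hz.1).sub ?_
    have hp : p ∈ overlap V₂ ![x, y, z] :=
      mem_overlap.2 fun i => by fin_cases i; exacts [hx.2, hy.2, hz.2]
    have h1 : ContinuousAt (b ![x, y, z]) p :=
      (hb _).continuousAt ((hV₂.isOpen_overlap _).mem_nhds hp)
    have h2 : ∀ᶠ q in 𝓝 p, b ![x, y, z] q = b ![x, y, z] p :=
      h1.preimage_mem_nhds (isOpen_discrete {b ![x, y, z] p} |>.mem_nhds rfl)
    exact contMDiffAt_const.congr_of_eventuallyEq
      (h2.mono fun q hq => congrArg (Int.cast : ℤ → ℂ) hq)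
  have hcoc : ∀ x y z t p, p ∈ V x → p ∈ V y → p ∈ V z → p ∈ V t →
      u y z t p - u x z t p + u x y t p = u x y z p := by
    intro x y z t p hx hy hz ht
    have h1 := hn ![x, y, z, t] p
      (mem_overlap.2 fun i => by fin_cases i; exacts [hx.1, hy.1, hz.1, ht.1])
    have h2 := hnb ![x, y, z, t] p
      (mem_overlap.2 fun i => by fin_cases i; exacts [hx.2, hy.2, hz.2, ht.2])
    rw [h2, cechD_three] at h1
    simp only [Matrix.cons_val] at h1
    push_cast at h1
    simp only [hu_def]
    linear_combination -h1
  obtain ⟨f, hf⟩ := SmoothPartitionOfUnity.exists_isSubordinate 𝓘(ℝ, E) isClosed_univ V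
    (fun x => (hV x).1) fun x _ => mem_iUnion.2 ⟨x, (hV x).2⟩
  -- This is the contracting homotopy for a fine sheaf: the last index of `u` is averaged against
  -- the partition of unity, so that `δk = u`.
  set k : M → M → M → ℂ := fun x y p => ∑ᶠ t, f t p • u x y t p with hk_def
  have hk : ∀ x y p, p ∈ V x → p ∈ V y → ContMDiffAt 𝓘(ℝ, E) 𝓘(ℝ, ℂ) ∞ (k x y) p :=
    fun x y p hx hy => f.contMDiffAt_finsum fun t ht => hu x y t p hx hy (hf t ht)
  have hfin : ∀ x y p, (Function.support fun t => f t p • u x y t p).Finite := fun x y p =>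
    (f.locallyFinite.point_finite p).subset fun t ht h => ht (by
      have : f t p = 0 := by simpa using h
      simp [this])
  have hkc : ∀ x y z p, p ∈ V x → p ∈ V y → p ∈ V z →
      k y z p - k x z p + k x y p = u x y z p := by
    intro x y z p hx hy hz
    simp only [hk_def]
    rw [← finsum_sub_distrib (hfin _ _ _) (hfin _ _ _), ← finsum_add_distrib _ (hfin _ _ _)]
    · have : ∀ t, f t p • u y z t p - f t p • u x z t p + f t p • u x y t p =
          f t p • u x y z p := by
        intro t
        -- The cocycle identity with fourth index `t` is available only for `p ∈ V t`; elsewhere the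
        -- weight `f t p` vanishes.
        by_cases ht : f t p = 0
        · simp [ht]
        · rw [← hcoc x y z t p hx hy hz (hf t (subset_tsupport _ ht))]
          simp only [Complex.real_smul]
          ring
      simp only [this]
      rw [← finsum_smul, f.sum_eq_one (mem_univ p), one_smul]
    · exact ((hfin y z p).union (hfin x z p)).subset (Function.support_sub _ _)
  refine ⟨V, fun x y p => Units.mk0 (Complex.exp (2 * Real.pi * Complex.I * k x y p))
    (Complex.exp_ne_zero _), hV, fun x y p hx hy => ?_, fun x y z p hx hy hz => ?_⟩
  · have h : ContDiff ℝ ∞ fun z : ℂ => Complex.exp (2 * Real.pi * Complex.I * z) :=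
      (contDiff_const.mul contDiff_id).cexp
    exact h.contMDiff.contMDiffAt.comp p (hk x y p hx hy)
  · apply Units.ext
    simp only [Units.val_mul, Units.val_mk0]
    rw [← he x y z p hx.1 hy.1 hz.1, ← Complex.exp_add, ← Complex.exp_add,
      Complex.exp_eq_exp_iff_exists_int]
    -- As `δk = w - b`, the two exponents differ by `2πi` times the integer `b`.
    refine ⟨b ![x, y, z] p, ?_⟩
    have h1 := hkc x y z p hx hy hz
    simp only [hu_def] at h1
    linear_combination (-2 * Real.pi * Complex.I) * h1

end Bockstein

/-! ### Smooth local sections of `ℂˣ`-bundles -/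

section SmoothSections

variable {EX X : Type*} [NormedAddCommGroup EX] [NormedSpace ℝ EX]
  [TopologicalSpace X] [ChartedSpace EX X]
  {EX' X' : Type*} [NormedAddCommGroup EX'] [NormedSpace ℝ EX']
  [TopologicalSpace X'] [ChartedSpace EX' X']

namespace CStarBundle

/-- A section `τ` of the pull-back of a `ℂˣ`-bundle along a map `φ` is smooth at `x`. -/
def SmoothAt (EX' : Type*) [NormedAddCommGroup EX'] [NormedSpace ℝ EX'] {X' : Type*}
    [TopologicalSpace X'] [ChartedSpace EX' X'] (P : CStarBundle.{v} EX X) (φ : X' → X)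
    (τ : ∀ x', P.fiber (φ x')) (x : X') : Prop :=
  ContMDiffAt 𝓘(ℝ, EX') 𝓘(ℝ, ℂ) ∞ (fun x' => ((τ x' /ₛ P.sec (φ x) (φ x') : ℂˣ) : ℂ)) x

variable {P : CStarBundle.{v} EX X} {φ : X' → X} {τ τ' : ∀ x', P.fiber (φ x')} {x : X'}

lemma SmoothAt.sdiv (h : P.SmoothAt EX' φ τ x) (h' : P.SmoothAt EX' φ τ' x) :
    ContMDiffAt 𝓘(ℝ, EX') 𝓘(ℝ, ℂ) ∞ (fun x' => ((τ x' /ₛ τ' x' : ℂˣ) : ℂ)) x := by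
  refine (contMDiffAt_units_mul h (contMDiffAt_units_inv h')).congr_of_eventuallyEq
    (Filter.Eventually.of_forall fun x' => ?_)
  simp only
  rw [inv_sdiv_eq_sdiv_rev, sdiv_mul_sdiv_cancel]

lemma SmoothAt.smul (h : P.SmoothAt EX' φ τ x) {u : X' → ℂˣ}
    (hu : ContMDiffAt 𝓘(ℝ, EX') 𝓘(ℝ, ℂ) ∞ (fun x' => (u x' : ℂ)) x) :
    P.SmoothAt EX' φ (fun x' => u x' • τ x') x := by
  refine (contMDiffAt_units_mul hu h).congr_of_eventuallyEq
    (Filter.Eventually.of_forall fun x' => ?_)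
  simp only
  rw [smul_sdiv_assoc]

lemma smoothAt_sec (hφ : ContMDiffAt 𝓘(ℝ, EX') 𝓘(ℝ, EX) ∞ φ x) {a : X}
    (ha : φ x ∈ P.baseSet a) : P.SmoothAt EX' φ (fun x' => P.sec a (φ x')) x :=
  ((P.contMDiffOn_transition a (φ x)).contMDiffAt
    (((P.isOpen_baseSet a).inter (P.isOpen_baseSet _)).mem_nhds
      ⟨ha, P.mem_baseSet _⟩)).comp x hφ

/-- `SmoothAt` tests only the trivialisation centred at `φ x`. Smooth transition functions extend
the test to any trivialisation whose domain contains `φ x`. -/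
lemma SmoothAt.sdiv_sec (h : P.SmoothAt EX' φ τ x) (hφ : ContMDiffAt 𝓘(ℝ, EX') 𝓘(ℝ, EX) ∞ φ x)
    {a : X} (ha : φ x ∈ P.baseSet a) :
    ContMDiffAt 𝓘(ℝ, EX') 𝓘(ℝ, ℂ) ∞ (fun x' => ((τ x' /ₛ P.sec a (φ x') : ℂˣ) : ℂ)) x :=
  h.sdiv (smoothAt_sec hφ ha)

lemma SmoothAt.of_sdiv (h : P.SmoothAt EX' φ τ' x)
    (h' : ContMDiffAt 𝓘(ℝ, EX') 𝓘(ℝ, ℂ) ∞ (fun x' => ((τ x' /ₛ τ' x' : ℂˣ) : ℂ)) x) :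
    P.SmoothAt EX' φ τ x := by
  have := h.smul h'
  simpa only [sdiv_smul] using this

end CStarBundle

end SmoothSections

/-! ### Local sections of submersions, and smoothness of products and left divisions. -/

section GerbeCalculus

variable {E : Type*} [NormedAddCommGroup E] [NormedSpace ℝ E]
  {M : Type*} [TopologicalSpace M] [ChartedSpace E M] [IsManifold 𝓘(ℝ, E) ∞ M]
  {EX X : Type*} [NormedAddCommGroup EX] [NormedSpace ℝ EX]
  [TopologicalSpace X] [ChartedSpace EX X]

open FibredManifold

namespace FibredManifold

variable {A B : FibredManifold.{v} E M}

lemma contMDiff_proj : ContMDiff 𝓘(ℝ, A.model) 𝓘(ℝ, E) ∞ A.proj := A.isSubmersion.contMDiff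

lemma contMDiffAt_pair {k : X → A.Y} {l : X → B.Y} {x : X}
    (hk : ContMDiffAt 𝓘(ℝ, EX) 𝓘(ℝ, A.model) ∞ k x)
    (hl : ContMDiffAt 𝓘(ℝ, EX) 𝓘(ℝ, B.model) ∞ l x) (h : ∀ x, A.proj (k x) = B.proj (l x)) :
    ContMDiffAt 𝓘(ℝ, EX) 𝓘(ℝ, (A.prod B).model) ∞ (fun x => pair (k x) (l x) (h x)) x :=
  FibreProd.contMDiffWithinAt_of_components (s := univ)
    (k := fun x => FibreProd.mk (k x) (l x) (h x)) A.isSubmersion.contMDiff B.isSubmersion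
    hk hl

/-- A surjective submersion has smooth local sections. -/
lemma exists_local_section (A : FibredManifold.{v} E M) (p : M) :
    ∃ (U : Set M) (s : M → A.Y), IsOpen U ∧ p ∈ U ∧ (∀ q, A.proj (s q) = q) ∧
      ∀ q ∈ U, ContMDiffAt 𝓘(ℝ, E) 𝓘(ℝ, A.model) ∞ s q := by
  classical
  obtain ⟨y, rfl⟩ := A.surjective p
  have h := A.isSubmersion.isSubmersionAt y
  -- The section keeps the vertical coordinate of `y` constant: it is the horizontal slice through
  -- `y` in a submersion chart.
  set e : M → A.model := fun q => FibreProd.vert h q (h.equiv (h.domChart y)).2 with he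
  have he' : ContMDiffOn 𝓘(ℝ, E) 𝓘(ℝ, A.model) ∞ e h.codChart.source :=
    (h.equiv.symm.contDiff.contMDiff (n := ∞)).comp_contMDiffOn
      ((contMDiffOn_of_mem_maximalAtlas h.codChart_mem_maximalAtlas).prodMk_space
        contMDiffOn_const)
  set U : Set M := h.codChart.source ∩ e ⁻¹' h.domChart.target with hU
  have hUo : IsOpen U := he'.continuousOn.isOpen_inter_preimage h.codChart.open_source
    h.domChart.open_target
  -- Outside `U` an arbitrary set-theoretic section is used. Then `proj ∘ s = id` everywhere, and
  -- later fibre types need no membership proofs.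
  set s : M → A.Y := fun q => if q ∈ U then h.domChart.symm (e q)
    else Function.surjInv A.surjective q with hs
  refine ⟨U, s, hUo, ⟨h.mem_codChart_source, ?_⟩, fun q => ?_, fun q hq => ?_⟩
  · have h1 := FibreProd.vert_self h h.mem_domChart_source
    simp only [mem_preimage, he, h1]
    exact h.domChart.map_source h.mem_domChart_source
  · by_cases hq : q ∈ U
    · simp only [hs, if_pos hq]
      exact FibreProd.vert_proj h hq.1 hq.2
    · simp only [hs, if_neg hq]
      exact Function.surjInv_eq A.surjective q
  · have h1 : ContMDiffOn 𝓘(ℝ, E) 𝓘(ℝ, A.model) ∞ s U := by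
      refine ContMDiffOn.congr ?_ fun q hq => if_pos hq
      exact (contMDiffOn_symm_of_mem_maximalAtlas h.domChart_mem_maximalAtlas).comp
        (he'.mono inter_subset_left) fun q hq => hq.2
    exact h1.contMDiffAt (hUo.mem_nhds hq)

end FibredManifold

namespace BundleGerbe

variable (P : BundleGerbe.{v} E M)

/-- Equivariance in both variables determines the product from its value on one reference pair, so
products of sections can be computed in local trivialisations. -/
lemma mul_eq_smul_mul {y₁ y₂ y₃ : P.base.Y} (h₁₂ : P.base.proj y₁ = P.base.proj y₂)
    (h₂₃ : P.base.proj y₂ = P.base.proj y₃) (p p' : P.bundle.fiber (pair y₁ y₂ h₁₂))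
    (q q' : P.bundle.fiber (pair y₂ y₃ h₂₃)) :
    P.mul h₁₂ h₂₃ p q = ((p /ₛ p') * (q /ₛ q')) • P.mul h₁₂ h₂₃ p' q' := by
  conv_lhs => rw [← sdiv_smul (G := ℂˣ) p p', ← sdiv_smul (G := ℂˣ) q q', P.smul_mul, P.mul_smul,
    smul_smul]

lemma mul_left_cancel {y₁ y₂ y₃ : P.base.Y} (h₁₂ : P.base.proj y₁ = P.base.proj y₂)
    (h₂₃ : P.base.proj y₂ = P.base.proj y₃) {p : P.bundle.fiber (pair y₁ y₂ h₁₂)}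
    {q q' : P.bundle.fiber (pair y₂ y₃ h₂₃)} (h : P.mul h₁₂ h₂₃ p q = P.mul h₁₂ h₂₃ p q') :
    q = q' := by
  rw [P.mul_eq_smul_mul h₁₂ h₂₃ p p q q', sdiv_self, one_mul] at h
  have h1 := smul_right_cancel _ (h.trans (one_smul ℂˣ _).symm)
  exact eq_of_sdiv_eq_one h1

/-- Left division in a bundle gerbe. -/
def ldiv {y₁ y₂ y₃ : P.base.Y} (h₁₂ : P.base.proj y₁ = P.base.proj y₂)
    (h₂₃ : P.base.proj y₂ = P.base.proj y₃) (p : P.bundle.fiber (pair y₁ y₂ h₁₂))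
    (r : P.bundle.fiber (pair y₁ y₃ (h₁₂.trans h₂₃))) : P.bundle.fiber (pair y₂ y₃ h₂₃) :=
  (r /ₛ P.mul h₁₂ h₂₃ p (P.bundle.sec (pair y₂ y₃ h₂₃) (pair y₂ y₃ h₂₃))) •
    P.bundle.sec (pair y₂ y₃ h₂₃) (pair y₂ y₃ h₂₃)

lemma mul_ldiv {y₁ y₂ y₃ : P.base.Y} (h₁₂ : P.base.proj y₁ = P.base.proj y₂)
    (h₂₃ : P.base.proj y₂ = P.base.proj y₃) (p : P.bundle.fiber (pair y₁ y₂ h₁₂))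
    (r : P.bundle.fiber (pair y₁ y₃ (h₁₂.trans h₂₃))) :
    P.mul h₁₂ h₂₃ p (P.ldiv h₁₂ h₂₃ p r) = r := by
  rw [ldiv, P.mul_smul, sdiv_smul]

variable {P} {y₁ y₂ y₃ : X → P.base.Y} {h₁₂ : ∀ x, P.base.proj (y₁ x) = P.base.proj (y₂ x)}
  {h₂₃ : ∀ x, P.base.proj (y₂ x) = P.base.proj (y₃ x)} {x : X}
  (hy₁ : ContMDiffAt 𝓘(ℝ, EX) 𝓘(ℝ, P.base.model) ∞ y₁ x)
  (hy₂ : ContMDiffAt 𝓘(ℝ, EX) 𝓘(ℝ, P.base.model) ∞ y₂ x)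
  (hy₃ : ContMDiffAt 𝓘(ℝ, EX) 𝓘(ℝ, P.base.model) ∞ y₃ x)
  {τ : ∀ x, P.bundle.fiber (pair (y₁ x) (y₂ x) (h₁₂ x))}
  {τ' : ∀ x, P.bundle.fiber (pair (y₂ x) (y₃ x) (h₂₃ x))}

-- Both factors are compared with the trivialising sections centred at the given point. The
-- remaining factor is the product of those sections, the function of `mul_smooth` pulled back along
-- `(y₁, y₂, y₃)` to `Y^[3]`.
include hy₁ hy₂ hy₃ in
lemma smoothAt_mul (h : P.bundle.SmoothAt EX _ τ x) (h' : P.bundle.SmoothAt EX _ τ' x) :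
    P.bundle.SmoothAt EX (fun x => pair (y₁ x) (y₃ x) ((h₁₂ x).trans (h₂₃ x)))
      (fun x => P.mul (h₁₂ x) (h₂₃ x) (τ x) (τ' x)) x := by
  set t : X → P.base.cube.Y := fun x => pair (A := P.base.sq) (pair (y₁ x) (y₂ x) (h₁₂ x)) (y₃ x)
    ((h₁₂ x).trans (h₂₃ x))
  have ht : ContMDiffAt 𝓘(ℝ, EX) 𝓘(ℝ, P.base.cube.model) ∞ t x :=
    contMDiffAt_pair (contMDiffAt_pair hy₁ hy₂ h₁₂) hy₃ _
  have c₁ : ContMDiff 𝓘(ℝ, P.base.cube.model) 𝓘(ℝ, P.base.sq.model) ∞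
      (p₁₂ : P.base.cube.Y → P.base.sq.Y) :=
    contMDiff_pair (FibredManifold.contMDiff_fst.comp FibredManifold.contMDiff_fst) (FibredManifold.contMDiff_snd.comp FibredManifold.contMDiff_fst) _
  have c₂ : ContMDiff 𝓘(ℝ, P.base.cube.model) 𝓘(ℝ, P.base.sq.model) ∞
      (p₂₃ : P.base.cube.Y → P.base.sq.Y) :=
    contMDiff_pair (FibredManifold.contMDiff_snd.comp FibredManifold.contMDiff_fst) FibredManifold.contMDiff_snd _
  have c₃ : ContMDiff 𝓘(ℝ, P.base.cube.model) 𝓘(ℝ, P.base.sq.model) ∞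
      (p₁₃ : P.base.cube.Y → P.base.sq.Y) :=
    contMDiff_pair (FibredManifold.contMDiff_fst.comp FibredManifold.contMDiff_fst) FibredManifold.contMDiff_snd _
  have h₀ := ((P.mul_smooth (p₁₂ (t x)) (p₂₃ (t x)) (p₁₃ (t x))).contMDiffAt
    ((((P.bundle.isOpen_baseSet _).preimage c₁.continuous).inter
      ((P.bundle.isOpen_baseSet _).preimage c₂.continuous)).inter
      ((P.bundle.isOpen_baseSet _).preimage c₃.continuous) |>.mem_nhds
      ⟨⟨P.bundle.mem_baseSet _, P.bundle.mem_baseSet _⟩, P.bundle.mem_baseSet _⟩)).comp x ht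
  refine (contMDiffAt_units_mul (contMDiffAt_units_mul h h') h₀).congr_of_eventuallyEq
    (Filter.Eventually.of_forall fun x' => ?_)
  have e := P.mul_eq_smul_mul (h₁₂ x') (h₂₃ x') (τ x')
    (P.bundle.sec (pair (y₁ x) (y₂ x) (h₁₂ x)) (pair (y₁ x') (y₂ x') (h₁₂ x'))) (τ' x')
    (P.bundle.sec (pair (y₂ x) (y₃ x) (h₂₃ x)) (pair (y₂ x') (y₃ x') (h₂₃ x')))
  exact congrArg Units.val ((congrArg (fun r => r /ₛ _) e).trans (smul_sdiv_assoc _ _ _))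

-- For fixed `τ` the ratio of `τ·τ'` to `τ·s` is that of `τ'` to `s`, so a smooth product with a
-- smooth first factor has a smooth second factor. This gives smoothness of left division.
include hy₁ hy₂ hy₃ in
lemma smoothAt_of_mul (h : P.bundle.SmoothAt EX _ τ x)
    (h' : P.bundle.SmoothAt EX (fun x => pair (y₁ x) (y₃ x) ((h₁₂ x).trans (h₂₃ x)))
      (fun x => P.mul (h₁₂ x) (h₂₃ x) (τ x) (τ' x)) x) :
    P.bundle.SmoothAt EX _ τ' x := by
  have hs : P.bundle.SmoothAt EX (fun x => pair (y₂ x) (y₃ x) (h₂₃ x))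
      (fun x' => P.bundle.sec (pair (y₂ x) (y₃ x) (h₂₃ x)) (pair (y₂ x') (y₃ x') (h₂₃ x'))) x :=
    CStarBundle.smoothAt_sec (contMDiffAt_pair hy₂ hy₃ h₂₃) (P.bundle.mem_baseSet _)
  refine hs.of_sdiv ?_
  refine (h'.sdiv (smoothAt_mul hy₁ hy₂ hy₃ h hs)).congr_of_eventuallyEq
    (Filter.Eventually.of_forall fun x' => ?_)
  simp only
  rw [P.mul_eq_smul_mul (h₁₂ x') (h₂₃ x') (τ x') (τ x') (τ' x')
    (P.bundle.sec (pair (y₂ x) (y₃ x) (h₂₃ x)) (pair (y₂ x') (y₃ x') (h₂₃ x'))), smul_sdiv,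
    sdiv_self, one_mul]

end BundleGerbe

end GerbeCalculus

/-! ### Local sections of a bundle gerbe and their cocycle -/

section SectionData

variable {E : Type*} [NormedAddCommGroup E] [NormedSpace ℝ E]
  {M : Type u} [TopologicalSpace M] [ChartedSpace E M] [IsManifold 𝓘(ℝ, E) ∞ M]

open FibredManifold

namespace BundleGerbe

/-- Local sections `s x` of `Y → M` and `σ x y` of `(s x, s y)⁻¹(P)`, for a cover of `M` indexed by
its points. The sections are defined everywhere, but smooth only over `V x` and `V x ∩ V y`. -/
structure SecData (P : BundleGerbe.{v} E M) where
  V : M → Set M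
  isPointedCover : IsPointedCover V
  s : M → M → P.base.Y
  proj_s : ∀ x p, P.base.proj (s x p) = p
  s_smooth : ∀ x p, p ∈ V x → ContMDiffAt 𝓘(ℝ, E) 𝓘(ℝ, P.base.model) ∞ (s x) p
  σ : ∀ x y p, P.bundle.fiber (pair (s x p) (s y p) ((proj_s x p).trans (proj_s y p).symm))
  σ_smooth : ∀ x y p, p ∈ V x → p ∈ V y → P.bundle.SmoothAt E _ (σ x y) p

namespace SecData

variable {P : BundleGerbe.{v} E M} (D : P.SecData)

lemma proj_eq (x y p : M) : P.base.proj (D.s x p) = P.base.proj (D.s y p) :=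
  (D.proj_s x p).trans (D.proj_s y p).symm

/-- The cocycle defined by local sections of a bundle gerbe. -/
def g (x y z p : M) : ℂˣ :=
  P.mul (D.proj_eq x y p) (D.proj_eq y z p) (D.σ x y p) (D.σ y z p) /ₛ D.σ x z p

lemma mul_σ (x y z p : M) :
    P.mul (D.proj_eq x y p) (D.proj_eq y z p) (D.σ x y p) (D.σ y z p) =
      D.g x y z p • D.σ x z p := (sdiv_smul _ _).symm

lemma g_smooth (x y z p : M) (hx : p ∈ D.V x) (hy : p ∈ D.V y) (hz : p ∈ D.V z) :
    ContMDiffAt 𝓘(ℝ, E) 𝓘(ℝ, ℂ) ∞ (fun q => (D.g x y z q : ℂ)) p :=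
  (smoothAt_mul (D.s_smooth x p hx) (D.s_smooth y p hy) (D.s_smooth z p hz)
    (D.σ_smooth x y p hx hy) (D.σ_smooth y z p hy hz)).sdiv (D.σ_smooth x z p hx hz)

/-- The two bracketings of `σ x y · σ y z · σ z t` are compared. No overlap condition is needed, as
the sections are defined everywhere. -/
lemma g_cocycle (x y z t p : M) :
    D.g y z t p * D.g x y t p = D.g x z t p * D.g x y z p := by
  have h := P.mul_assoc (D.proj_eq x y p) (D.proj_eq y z p) (D.proj_eq z t p) (D.σ x y p)
    (D.σ y z p) (D.σ z t p)
  rw [mul_σ, mul_σ, P.smul_mul, P.mul_smul, mul_σ, mul_σ, smul_smul, smul_smul] at h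
  rw [← smul_right_cancel _ h, mul_comm]

/-- The restriction of local sections to a refinement of the cover. -/
def reindex (W : M → Set M) (hW : IsPointedCover W) (ρ : M → M) (h : ∀ x, W x ⊆ D.V (ρ x)) :
    P.SecData where
  V := W
  isPointedCover := hW
  s x := D.s (ρ x)
  proj_s x := D.proj_s (ρ x)
  s_smooth x p hp := D.s_smooth (ρ x) p (h x hp)
  σ x y := D.σ (ρ x) (ρ y)
  σ_smooth x y p hx hy := D.σ_smooth (ρ x) (ρ y) p (h x hx) (h y hy)

variable (P) in
/-- Local sections of a bundle gerbe exist for sufficiently fine covers. -/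
lemma nonempty_secData [T2Space M] [ParacompactSpace M] : Nonempty P.SecData := by
  choose U s hUo hxU hs hsU using P.base.exists_local_section
  have hs' : ∀ x y p, P.base.proj (s x p) = P.base.proj (s y p) := fun x y p =>
    (hs x p).trans (hs y p).symm
  set φ : M → M → M → P.base.sq.Y := fun x y p => pair (s x p) (s y p) (hs' x y p)
  have hφ : ∀ x y p, p ∈ U x → p ∈ U y →
      ContMDiffAt 𝓘(ℝ, E) 𝓘(ℝ, P.base.sq.model) ∞ (φ x y) p := fun x y p hx hy =>
    contMDiffAt_pair (hsU x p hx) (hsU y p hy) (hs' x y)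
  -- On a non-empty double overlap, `W x` is mapped into the one trivialising set centred at `φ (ρ
  -- x) (ρ y) x`. Its section is then taken as `σ x y`.
  obtain ⟨W, ρ, hW, hWU, hWN⟩ := exists_small_refinement (k := 2) U hUo (fun x => ⟨x, hxU x⟩)
    (fun t p => φ (t 0) (t 1) ⁻¹' P.bundle.baseSet (φ (t 0) (t 1) p)) fun t p hp =>
      (hφ _ _ p (hp 0) (hp 1)).continuousAt.preimage_mem_nhds
        ((P.bundle.isOpen_baseSet _).mem_nhds (P.bundle.mem_baseSet _))
  exact ⟨{ V := W
           isPointedCover := hW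
           s := fun x => s (ρ x)
           proj_s := fun x => hs (ρ x)
           s_smooth := fun x p hp => hsU _ p (hWU x hp)
           σ := fun x y p => P.bundle.sec (φ (ρ x) (ρ y) x) (φ (ρ x) (ρ y) p)
           σ_smooth := fun x y p hx hy =>
             CStarBundle.smoothAt_sec (hφ _ _ p (hWU x hx) (hWU y hy))
               ((hWN ![x, y] p (fun j => by fin_cases j; exacts [hx, hy]) 0).2 hx) }⟩

/-- The cocycles of two choices of local sections are cohomologous. -/
lemma exists_cohomologous (D D' : P.SecData) :
    ∃ (V : M → Set M) (h : M → M → M → ℂˣ), IsPointedCover V ∧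
      (∀ x y p, p ∈ V x → p ∈ V y →
        ContMDiffAt 𝓘(ℝ, E) 𝓘(ℝ, ℂ) ∞ (fun q => (h x y q : ℂ)) p) ∧
      ∀ x y z p, D'.g x y z p * h x z p = D.g x y z p * (h x y p * h y z p) := by
  have e : ∀ x y p, P.base.proj (D.s x p) = P.base.proj (D'.s y p) := fun x y p =>
    (D.proj_s x p).trans (D'.proj_s y p).symm
  set φ : M → M → P.base.sq.Y := fun x p => pair (D.s x p) (D'.s x p) (e x x p)
  have hφ : ∀ x p, p ∈ D.V x → p ∈ D'.V x →
      ContMDiffAt 𝓘(ℝ, E) 𝓘(ℝ, P.base.sq.model) ∞ (φ x) p := fun x p h h' =>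
    contMDiffAt_pair (D.s_smooth x p h) (D'.s_smooth x p h') (e x x)
  set τ : ∀ x p, P.bundle.fiber (φ x p) := fun x p => P.bundle.sec (φ x x) (φ x p)
  -- The scalar `h x y` measures the failure of `τ x · σ' x y` and `σ x y · τ y` to agree.
  set h : M → M → M → ℂˣ := fun x y p =>
    P.mul (e x x p) (D'.proj_eq x y p) (τ x p) (D'.σ x y p) /ₛ
      P.mul (D.proj_eq x y p) (e y y p) (D.σ x y p) (τ y p)
  have hh : ∀ x y p, P.mul (e x x p) (D'.proj_eq x y p) (τ x p) (D'.σ x y p) =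
      h x y p • P.mul (D.proj_eq x y p) (e y y p) (D.σ x y p) (τ y p) := fun x y p =>
    (sdiv_smul _ _).symm
  refine ⟨fun x => interior ((D.V x ∩ D'.V x) ∩ φ x ⁻¹' P.bundle.baseSet (φ x x)), h,
    fun x => ⟨isOpen_interior, ?_⟩, fun x y p hx hy => ?_, fun x y z p => ?_⟩
  · rw [mem_interior_iff_mem_nhds]
    have hx := D.isPointedCover x
    have hx' := D'.isPointedCover x
    exact Filter.inter_mem ((hx.1.inter hx'.1).mem_nhds ⟨hx.2, hx'.2⟩)
      ((hφ x x hx.2 hx'.2).continuousAt.preimage_mem_nhds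
        ((P.bundle.isOpen_baseSet _).mem_nhds (P.bundle.mem_baseSet _)))
  · obtain ⟨⟨hx₁, hx₂⟩, hx₃⟩ := interior_subset hx
    obtain ⟨⟨hy₁, hy₂⟩, hy₃⟩ := interior_subset hy
    exact (smoothAt_mul (D.s_smooth x p hx₁) (D'.s_smooth x p hx₂) (D'.s_smooth y p hy₂)
        (CStarBundle.smoothAt_sec (hφ x p hx₁ hx₂) hx₃) (D'.σ_smooth x y p hx₂ hy₂)).sdiv
      (smoothAt_mul (D.s_smooth x p hx₁) (D.s_smooth y p hy₁) (D'.s_smooth y p hy₂)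
        (D.σ_smooth x y p hx₁ hy₁) (CStarBundle.smoothAt_sec (hφ y p hy₁ hy₂) hy₃))
  · have h₁ := P.mul_assoc (e x x p) (D'.proj_eq x y p) (D'.proj_eq y z p) (τ x p) (D'.σ x y p)
      (D'.σ y z p)
    have h₂ := P.mul_assoc (D.proj_eq x y p) (e y y p) (D'.proj_eq y z p) (D.σ x y p) (τ y p)
      (D'.σ y z p)
    have h₃ := P.mul_assoc (D.proj_eq x y p) (D.proj_eq y z p) (e z z p) (D.σ x y p)
      (D.σ y z p) (τ z p)
    rw [mul_σ, P.mul_smul, hh, hh, P.smul_mul, h₂, hh, P.mul_smul, ← h₃, mul_σ, P.smul_mul,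
      smul_smul, smul_smul, smul_smul] at h₁
    rw [← smul_right_cancel _ h₁]
    ac_rfl

end SecData

/-! ### Transport of fibres along equalities of base points. -/

section Cast

variable {P : BundleGerbe.{v} E M} {y₁ y₁' y₂ y₂' y₃ y₃' : P.base.Y}

/-- The identification of fibres over equal points of `Y^[2]`. -/
def castPair (e₁ : y₁ = y₁') (e₂ : y₂ = y₂') {h : P.base.proj y₁ = P.base.proj y₂}
    (h' : P.base.proj y₁' = P.base.proj y₂') (τ : P.bundle.fiber (pair y₁ y₂ h)) :
    P.bundle.fiber (pair y₁' y₂' h') :=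
  cast (by subst e₁ e₂; rfl) τ

lemma castPair_smul (e₁ : y₁ = y₁') (e₂ : y₂ = y₂') {h : P.base.proj y₁ = P.base.proj y₂}
    (h' : P.base.proj y₁' = P.base.proj y₂') (z : ℂˣ) (τ : P.bundle.fiber (pair y₁ y₂ h)) :
    castPair e₁ e₂ h' (z • τ) = z • castPair e₁ e₂ h' τ := by
  subst e₁ e₂; rfl

lemma castPair_sdiv_sec (e₁ : y₁ = y₁') (e₂ : y₂ = y₂') {h : P.base.proj y₁ = P.base.proj y₂}
    (h' : P.base.proj y₁' = P.base.proj y₂') (τ : P.bundle.fiber (pair y₁ y₂ h)) (a : P.base.sq.Y) :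
    (castPair e₁ e₂ h' τ /ₛ P.bundle.sec a (pair y₁' y₂' h') : ℂˣ) =
      τ /ₛ P.bundle.sec a (pair y₁ y₂ h) := by
  subst e₁ e₂; rfl

lemma mul_castPair (e₁ : y₁ = y₁') (e₂ : y₂ = y₂') (e₃ : y₃ = y₃')
    {h₁₂ : P.base.proj y₁ = P.base.proj y₂} {h₂₃ : P.base.proj y₂ = P.base.proj y₃}
    (h₁₂' : P.base.proj y₁' = P.base.proj y₂') (h₂₃' : P.base.proj y₂' = P.base.proj y₃')
    (τ : P.bundle.fiber (pair y₁ y₂ h₁₂)) (τ' : P.bundle.fiber (pair y₂ y₃ h₂₃)) :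
    P.mul h₁₂' h₂₃' (castPair e₁ e₂ h₁₂' τ) (castPair e₂ e₃ h₂₃' τ') =
      castPair e₁ e₃ (h₁₂'.trans h₂₃') (P.mul h₁₂ h₂₃ τ τ') := by
  subst e₁ e₂ e₃; rfl

end Cast

open Classical in
/-- The local sections underlying the choices in the construction of the Dixmier-Douady class,
re-indexed by the points of `M` and extended arbitrarily to all of `M`. -/
def CocycleData.toSecData {P : BundleGerbe.{v} E M} (D : P.CocycleData) (r : M → D.ι)
    (hr : ∀ x, x ∈ D.U (r x)) :
    {D' : P.SecData // (∀ x, D'.V x = D.U (r x)) ∧ ∀ x y z p, p ∈ D.U (r x) → p ∈ D.U (r y) →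
      p ∈ D.U (r z) → D'.g x y z p = D.g (r x) (r y) (r z) p} :=
  let s : M → M → P.base.Y := fun x p =>
    if p ∈ D.U (r x) then D.s (r x) p else Function.surjInv P.base.surjective p
  have hs : ∀ x p, p ∈ D.U (r x) → D.s (r x) p = s x p := fun _ _ hp => (if_pos hp).symm
  have proj_s : ∀ x p, P.base.proj (s x p) = p := fun x p => by
    by_cases hp : p ∈ D.U (r x)
    · rw [← hs x p hp, D.proj_s _ _ hp]
    · exact (congrArg _ (if_neg hp)).trans (Function.surjInv_eq P.base.surjective p)
  have e : ∀ x y p, P.base.proj (s x p) = P.base.proj (s y p) := fun x y p =>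
    (proj_s x p).trans (proj_s y p).symm
  -- The globally extended `s` agrees with the given sections only propositionally, so the given `σ`
  -- must be transported. Off the overlap any element of the fibre will do.
  let σ : ∀ x y p, P.bundle.fiber (pair (s x p) (s y p) (e x y p)) := fun x y p =>
    if h : p ∈ D.U (r x) ∧ p ∈ D.U (r y) then
      castPair (hs x p h.1) (hs y p h.2) (e x y p) (D.σ (r x) (r y) p h.1 h.2)
    else P.bundle.sec (pair (s x p) (s y p) (e x y p)) (pair (s x p) (s y p) (e x y p))
  have hσ : ∀ x y p (hx : p ∈ D.U (r x)) (hy : p ∈ D.U (r y)), σ x y p =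
      castPair (hs x p hx) (hs y p hy) (e x y p) (D.σ (r x) (r y) p hx hy) :=
    fun x y p hx hy => dif_pos ⟨hx, hy⟩
  have s_smooth : ∀ x p, p ∈ D.U (r x) →
      ContMDiffAt 𝓘(ℝ, E) 𝓘(ℝ, P.base.model) ∞ (s x) p := fun x p hp =>
    ((D.s_smooth (r x)).congr fun q hq => (hs x q hq).symm).contMDiffAt
      ((D.isOpen_U _).mem_nhds hp)
  have σ_smooth : ∀ x y p, p ∈ D.U (r x) → p ∈ D.U (r y) →
      P.bundle.SmoothAt E _ (σ x y) p := by
    intro x y p hx hy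
    obtain ⟨k, hk, hk'⟩ := D.σ_smooth (r x) (r y) (pair (s x p) (s y p) (e x y p))
    have hev : ∀ᶠ q in 𝓝 p, ∃ (hi : q ∈ D.U (r x)) (hj : q ∈ D.U (r y)),
        pair (D.s (r x) q) (D.s (r y) q) ((D.proj_s _ q hi).trans (D.proj_s _ q hj).symm) ∈
          P.bundle.baseSet (pair (s x p) (s y p) (e x y p)) := by
      have h₁ := (contMDiffAt_pair (s_smooth x p hx) (s_smooth y p hy) (e x y)).continuousAt
      filter_upwards [(D.isOpen_U _).mem_nhds hx, (D.isOpen_U _).mem_nhds hy,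
        h₁.preimage_mem_nhds ((P.bundle.isOpen_baseSet _).mem_nhds (P.bundle.mem_baseSet _))]
        with q hqx hqy hq
      refine ⟨hqx, hqy, ?_⟩
      have hpq : pair (s x q) (s y q) (e x y q) = pair (D.s (r x) q) (D.s (r y) q)
          ((D.proj_s _ q hqx).trans (D.proj_s _ q hqy).symm) :=
        FibreProd.ext (hs x q hqx).symm (hs y q hqy).symm
      rwa [mem_preimage, hpq] at hq
    refine (hk.contMDiffAt hev).congr_of_eventuallyEq (hev.mono fun q hq => ?_)
    obtain ⟨hqx, hqy, hq⟩ := hq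
    rw [← hk' q hqx hqy hq, ← castPair_sdiv_sec (hs x q hqx) (hs y q hqy) (e x y q)]
    simp only [hσ x y q hqx hqy]
  ⟨{ V := fun x => D.U (r x)
     isPointedCover := fun x => ⟨D.isOpen_U _, hr x⟩
     s := s
     proj_s := proj_s
     s_smooth := s_smooth
     σ := σ
     σ_smooth := σ_smooth }, fun x => rfl, fun x y z p hx hy hz => by
      refine (eq_smul_iff_sdiv_eq _ _ _).1 ?_
      simp only [hσ x y p hx hy, hσ y z p hy hz, hσ x z p hx hz]
      rw [mul_castPair (hs x p hx) (hs y p hy) (hs z p hz) (e x y p) (e y z p),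
        D.mul_σ (r x) (r y) (r z) p hx hy hz, castPair_smul]⟩

/-- The choices in the construction of the Dixmier-Douady class given by local sections together
with logarithms of their cocycle. -/
def SecData.toCocycleData {P : BundleGerbe.{v} E M} (D : P.SecData) (w : M → M → M → M → ℂ)
    (hw : ∀ x y z p, p ∈ D.V x → p ∈ D.V y → p ∈ D.V z →
      ContMDiffAt 𝓘(ℝ, E) 𝓘(ℝ, ℂ) ∞ (w x y z) p)
    (he : ∀ x y z p, p ∈ D.V x → p ∈ D.V y → p ∈ D.V z →
      Complex.exp (2 * Real.pi * Complex.I * w x y z p) = D.g x y z p) : P.CocycleData where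
  ι := M
  U := D.V
  isOpen_U x := (D.isPointedCover x).1
  cover x := ⟨x, (D.isPointedCover x).2⟩
  s := D.s
  s_smooth x p hp := (D.s_smooth x p hp).contMDiffWithinAt
  proj_s x p _ := D.proj_s x p
  σ x y p _ _ := D.σ x y p
  σ_smooth x y a := ⟨fun p => ((D.σ x y p /ₛ P.bundle.sec a
      (pair (D.s x p) (D.s y p) (D.proj_eq x y p)) : ℂˣ) : ℂ), by
    rintro p ⟨hx, hy, hp⟩
    exact ((D.σ_smooth x y p hx hy).sdiv_sec (contMDiffAt_pair (D.s_smooth x p hx)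
      (D.s_smooth y p hy) (D.proj_eq x y)) hp).contMDiffWithinAt, fun _ _ _ _ => rfl⟩
  g := D.g
  mul_σ x y z p _ _ _ := D.mul_σ x y z p
  w := w
  w_smooth x y z p hp := (hw x y z p hp.1.1 hp.1.2 hp.2).contMDiffWithinAt
  exp_w x y z p hp := he x y z p hp.1.1 hp.1.2 hp.2

/-- This passes from choices over an arbitrary index type, with partially defined sections, to
everywhere defined sections indexed by points. The later arguments use only the latter form. -/
lemma isDixmierDouadyClass_iff {P : BundleGerbe.{v} E M} {c : CechCohomology M 3} :
    P.IsDixmierDouadyClass c ↔ ∃ D : P.SecData, Represents E D.g c := by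
  constructor
  · rintro ⟨D, r, hr, n, hn, rfl⟩
    obtain ⟨D', hV, hg⟩ := D.toSecData r hr
    have hU : IsPointedCover fun x => D.U (r x) := fun x => ⟨D.isOpen_U _, hr x⟩
    refine ⟨D', fun x => D.U (r x), fun x y z => D.w (r x) (r y) (r z), n, hU,
      fun x y z p hx hy hz => ?_, fun x y z p hx hy hz => ?_, hn, rfl⟩
    · exact (D.w_smooth (r x) (r y) (r z)).contMDiffAt
        ((((hU x).1.inter (hU y).1).inter (hU z).1).mem_nhds ⟨⟨hx, hy⟩, hz⟩)
    · rw [hg x y z p hx hy hz, D.exp_w _ _ _ p ⟨⟨hx, hy⟩, hz⟩]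
  · rintro ⟨D, V, w, n, hV, hw, he, hn, rfl⟩
    -- The logarithms may live on a smaller cover than the sections, so the sections are restricted
    -- to the intersection.
    exact ⟨(D.reindex _ (D.isPointedCover.inter M hV) id fun x => inter_subset_left).toCocycleData w
      (fun x y z p hx hy hz => hw x y z p hx.2 hy.2 hz.2)
      (fun x y z p hx hy hz => he x y z p hx.2 hy.2 hz.2), id,
      fun x => ⟨(D.isPointedCover x).2, (hV x).2⟩, n,
      fun x p hp => hn x p (overlap_inter_right M hp), rfl⟩

/-- For existence, the refinement producing logarithms re-indexes the cocycle, and the sections are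
re-indexed with it. Uniqueness holds because any two choices of sections have cohomologous cocycles.
-/
theorem existsUnique_isDixmierDouadyClass [T2Space M] [ParacompactSpace M]
    (P : BundleGerbe.{v} E M) : ∃! c, P.IsDixmierDouadyClass c := by
  refine existsUnique_of_exists_of_unique ?_ fun c c' h h' => ?_
  · obtain ⟨D⟩ := SecData.nonempty_secData P
    obtain ⟨W, ρ, c, hW, hWV, hc⟩ := exists_represents D.isPointedCover D.g_smooth
      fun x y z t p _ _ _ _ => D.g_cocycle x y z t p
    exact ⟨c, isDixmierDouadyClass_iff.2 ⟨D.reindex W hW ρ hWV, hc⟩⟩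
  · obtain ⟨D, hD⟩ := isDixmierDouadyClass_iff.1 h
    obtain ⟨D', hD'⟩ := isDixmierDouadyClass_iff.1 h'
    obtain ⟨V, k, hV, hk, hk'⟩ := SecData.exists_cohomologous D D'
    exact hD.eq_of_cohomologous hD' hV hk fun x y z p _ _ _ => hk' x y z p

end BundleGerbe

end SectionData

/-! ### Operations on bundle gerbes and their Dixmier-Douady classes -/

section Operations

variable {EX X : Type*} [NormedAddCommGroup EX] [NormedSpace ℝ EX]
  [TopologicalSpace X] [ChartedSpace EX X]
  {EX' X' : Type*} [NormedAddCommGroup EX'] [NormedSpace ℝ EX']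
  [TopologicalSpace X'] [ChartedSpace EX' X']

namespace CStarBundle

variable {P : CStarBundle.{v} EX X} {φ : X' → X} {τ : ∀ x', P.fiber (φ x')} {x : X'}

lemma SmoothAt.dual (h : P.SmoothAt EX' φ τ x) : P.dual.SmoothAt EX' φ τ x := by
  refine (contMDiffAt_units_inv h).congr_of_eventuallyEq (Filter.Eventually.of_forall fun x' => ?_)
  exact congrArg Units.val (inv_sdiv_eq_sdiv_rev (τ x') (P.sec (φ x) (φ x'))).symm

lemma SmoothAt.comp {EX'' X'' : Type*} [NormedAddCommGroup EX''] [NormedSpace ℝ EX'']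
    [TopologicalSpace X''] [ChartedSpace EX'' X''] {k : X'' → X'} {x : X''}
    (h : P.SmoothAt EX' φ τ (k x)) (hk : ContMDiffAt 𝓘(ℝ, EX'') 𝓘(ℝ, EX') ∞ k x) :
    P.SmoothAt EX'' (fun x => φ (k x)) (fun x => τ (k x)) x :=
  ContMDiffAt.comp (g := fun x' => ((τ x' /ₛ P.sec (φ (k x)) (φ x') : ℂˣ) : ℂ)) x h hk

end CStarBundle

variable {E : Type*} [NormedAddCommGroup E] [NormedSpace ℝ E]
  {M : Type u} [TopologicalSpace M] [ChartedSpace E M] [IsManifold 𝓘(ℝ, E) ∞ M]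

open FibredManifold

namespace BundleGerbe

variable {P Q : BundleGerbe.{v} E M}

namespace SecData

/-- The image of local sections under an isomorphism of bundle gerbes. -/
def mapIso (D : P.SecData) (F : Iso P Q) : Q.SecData where
  V := D.V
  isPointedCover := D.isPointedCover
  s x p := F.toDiffeomorph (D.s x p)
  proj_s x p := (F.proj_comp _).trans (D.proj_s x p)
  s_smooth x p hp := F.toDiffeomorph.contMDiff.contMDiffAt.comp p (D.s_smooth x p hp)
  σ x y p := F.map _ (D.σ x y p)
  σ_smooth x y p hx hy := by
    set a := pair (D.s x p) (D.s y p) (D.proj_eq x y p)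
    have hs := contMDiff_mapSq F.proj_comp F.toDiffeomorph.contMDiff
    have h₁ : ContMDiffAt 𝓘(ℝ, E) 𝓘(ℝ, P.base.sq.model) ∞
        (fun q => pair (D.s x q) (D.s y q) (D.proj_eq x y q)) p :=
      contMDiffAt_pair (D.s_smooth x p hx) (D.s_smooth y p hy) _
    have h₂ := ((F.map_smooth a (mapSq F.toDiffeomorph F.proj_comp a)).contMDiffAt
      (((P.bundle.isOpen_baseSet _).inter ((Q.bundle.isOpen_baseSet _).preimage hs.continuous)
        ).mem_nhds ⟨P.bundle.mem_baseSet _, Q.bundle.mem_baseSet _⟩)).comp p h₁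
    refine (contMDiffAt_units_mul (D.σ_smooth x y p hx hy) h₂).congr_of_eventuallyEq
      (Filter.Eventually.of_forall fun q => ?_)
    have h₃ := F.map_smul _ (D.σ x y q /ₛ P.bundle.sec a
      (pair (D.s x q) (D.s y q) (D.proj_eq x y q))) (P.bundle.sec a
      (pair (D.s x q) (D.s y q) (D.proj_eq x y q)))
    rw [sdiv_smul] at h₃
    exact congrArg Units.val ((congrArg (fun r => r /ₛ _) h₃).trans (smul_sdiv_assoc _ _ _))

/-- An isomorphism commutes with products and scalars, so the cocycle is unchanged on the nose and
not merely up to a coboundary. -/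
lemma mapIso_g (D : P.SecData) (F : Iso P Q) : (D.mapIso F).g = D.g := by
  funext x y z p
  refine (eq_smul_iff_sdiv_eq _ _ _).1 ?_
  have h := F.map_mul (D.proj_eq x y p) (D.proj_eq y z p) (D.σ x y p) (D.σ y z p)
  rw [mul_σ, F.map_smul] at h
  exact h.symm

/-- Local sections of the dual bundle gerbe. -/
def dual (D : P.SecData) : P.dual.SecData where
  V := D.V
  isPointedCover := D.isPointedCover
  s := D.s
  proj_s := D.proj_s
  s_smooth := D.s_smooth
  σ := D.σ
  σ_smooth x y p hx hy := (D.σ_smooth x y p hx hy).dual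

lemma dual_g (D : P.SecData) : D.dual.g = fun x y z p => (D.g x y z p)⁻¹ := by
  funext x y z p
  exact (inv_sdiv_eq_sdiv_rev _ _).symm

/-- Local sections of the product of two bundle gerbes. -/
def tensor (D : P.SecData) (D' : Q.SecData) : (P.tensor Q).SecData where
  V x := D.V x ∩ D'.V x
  isPointedCover := D.isPointedCover.inter M D'.isPointedCover
  s x p := pair (D.s x p) (D'.s x p) ((D.proj_s x p).trans (D'.proj_s x p).symm)
  proj_s x p := D.proj_s x p
  s_smooth x p hp := contMDiffAt_pair (D.s_smooth x p hp.1) (D'.s_smooth x p hp.2) _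
  σ x y p := TensorTorsor.tmul
    (T := P.bundle.fiber (pair (D.s x p) (D.s y p) (D.proj_eq x y p)))
    (S := Q.bundle.fiber (pair (D'.s x p) (D'.s y p) (D'.proj_eq x y p)))
    (D.σ x y p) (D'.σ x y p)
  σ_smooth x y p hx hy :=
    contMDiffAt_units_mul (D.σ_smooth x y p hx.1 hy.1) (D'.σ_smooth x y p hx.2 hy.2)

lemma tensor_g (D : P.SecData) (D' : Q.SecData) :
    (D.tensor D').g = fun x y z p => D.g x y z p * D'.g x y z p := rfl

/-- With `q x` a local section of `Q` along `s x`, take `σ x y = (q x)* ⊗ q y`. In the product of `σ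
x y` and `σ y z` the middle pairing of `q y` with itself is `1`. -/
lemma exists_delta_g_eq_one (A : FibredManifold.{v} E M) (Q : CStarBundle.{v} A.model A.Y) :
    ∃ D : (delta A Q).SecData, D.g = fun _ _ _ _ => 1 := by
  choose U s hUo hxU hs hsU using A.exists_local_section
  set D : (delta A Q).SecData :=
    { V := fun x => interior (U x ∩ s x ⁻¹' Q.baseSet (s x x))
      isPointedCover := fun x => ⟨isOpen_interior, mem_interior_iff_mem_nhds.2
        (Filter.inter_mem ((hUo x).mem_nhds (hxU x))
          ((hsU x x (hxU x)).continuousAt.preimage_mem_nhds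
            ((Q.isOpen_baseSet _).mem_nhds (Q.mem_baseSet _))))⟩
      s := s
      proj_s := hs
      s_smooth := fun x p hp => hsU x p (interior_subset hp).1
      σ := fun x y p => TensorTorsor.tmul (T := DualTorsor (Q.fiber (s x p)))
        (S := Q.fiber (s y p))
        (Q.sec (s x x) (s x p)) (Q.sec (s y y) (s y p))
      σ_smooth := fun x y p hx hy => by
        obtain ⟨hx, hx'⟩ := interior_subset hx
        obtain ⟨hy, hy'⟩ := interior_subset hy
        exact contMDiffAt_units_mul
          (CStarBundle.SmoothAt.dual (CStarBundle.smoothAt_sec (hsU x p hx) hx'))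
          (CStarBundle.smoothAt_sec (hsU y p hy) hy') } with hD
  refine ⟨D, ?_⟩
  funext x y z p
  refine (eq_smul_iff_sdiv_eq _ _ _).1 ?_
  have h := deltaMul_tmul (T := Q.fiber (s x p)) (S := Q.fiber (s y p)) (R := Q.fiber (s z p))
    (Q.sec (s x x) (s x p)) (Q.sec (s y y) (s y p)) (Q.sec (s y y) (s y p)) (Q.sec (s z z) (s z p))
  rw [show pairing (Q.sec (s y y) (s y p)) (Q.sec (s y y) (s y p)) = 1 from sdiv_self _] at h
  exact h

end SecData

lemma IsDixmierDouadyClass.map_iso {c : CechCohomology M 3} (h : P.IsDixmierDouadyClass c)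
    (F : Isomorphic P Q) : Q.IsDixmierDouadyClass c := by
  obtain ⟨F⟩ := F
  obtain ⟨D, hD⟩ := isDixmierDouadyClass_iff.1 h
  exact isDixmierDouadyClass_iff.2 ⟨D.mapIso F, by rwa [D.mapIso_g F]⟩

lemma IsDixmierDouadyClass.dual {c : CechCohomology M 3} (h : P.IsDixmierDouadyClass c) :
    P.dual.IsDixmierDouadyClass (-c) := by
  obtain ⟨D, hD⟩ := isDixmierDouadyClass_iff.1 h
  exact isDixmierDouadyClass_iff.2 ⟨D.dual, by rw [D.dual_g]; exact hD.inv⟩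

lemma IsDixmierDouadyClass.tensor {c c' : CechCohomology M 3} (h : P.IsDixmierDouadyClass c)
    (h' : Q.IsDixmierDouadyClass c') : (P.tensor Q).IsDixmierDouadyClass (c + c') := by
  obtain ⟨D, hD⟩ := isDixmierDouadyClass_iff.1 h
  obtain ⟨D', hD'⟩ := isDixmierDouadyClass_iff.1 h'
  exact isDixmierDouadyClass_iff.2 ⟨D.tensor D', by rw [SecData.tensor_g]; exact hD.mul hD'⟩

lemma IsTrivial.isDixmierDouadyClass_zero (h : P.IsTrivial) : P.IsDixmierDouadyClass 0 := by
  obtain ⟨A, Q, F⟩ := h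
  obtain ⟨D, hD⟩ := SecData.exists_delta_g_eq_one A Q
  exact (isDixmierDouadyClass_iff.2 ⟨D, by rw [hD]; exact represents_one⟩).map_iso F

end BundleGerbe

end Operations

/-! ### Bundle gerbes with vanishing Dixmier-Douady class -/

section Triviality

variable {E : Type*} [NormedAddCommGroup E] [NormedSpace ℝ E]
  {M : Type u} [TopologicalSpace M] [ChartedSpace E M] [IsManifold 𝓘(ℝ, E) ∞ M]

open FibredManifold

namespace BundleGerbe

end BundleGerbe

/-! ### Permuting the factors of a threefold product. -/

namespace TensorTorsor

variable {T S R : Type*} [Torsor ℂˣ T] [Torsor ℂˣ S] [Torsor ℂˣ R]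

/-- The isomorphism `T ⊗ (S ⊗ R) → R ⊗ (T ⊗ S)`. -/
def rotate : TensorTorsor T (TensorTorsor S R) → TensorTorsor R (TensorTorsor T S) :=
  lift (fun p t => lift (fun q r => tmul r (tmul p q))
      (fun z q r => by
        rw [tmul_smul, tmul_smul, ← smul_tmul, smul_smul, mul_inv_cancel, one_smul]) t)
    (fun z p t => by
      induction t using TensorTorsor.ind with
      | h q r =>
        rw [smul_tmul, lift_tmul, lift_tmul, tmul_smul_inv])

lemma rotate_smul (z : ℂˣ) (t : TensorTorsor T (TensorTorsor S R)) :
    rotate (z • t) = z • rotate t := by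
  induction t using TensorTorsor.ind with
  | h p t =>
    induction t using TensorTorsor.ind with
    | h q r => exact tmul_smul z r (tmul p q)

end TensorTorsor

namespace BundleGerbe

/-- The bundle gerbes `P ⊗ (R ⊗ Q)` and `Q ⊗ (P ⊗ R)` are isomorphic. -/
def rotateIso (P R Q : BundleGerbe.{v} E M) :
    Iso (P.tensor (R.tensor Q)) (Q.tensor (P.tensor R)) where
  toDiffeomorph :=
    { toFun := fun t => pair (A := Q.base) (B := P.base.prod R.base) (snd (snd t))
        (pair (fst t) (fst (snd t)) (proj_fst_eq t))
        ((proj_fst_eq (snd t)).symm.trans (proj_fst_eq t).symm)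
      invFun := fun t => pair (A := P.base) (B := R.base.prod Q.base) (fst (snd t))
        (pair (snd (snd t)) (fst t) ((proj_fst_eq (snd t)).symm.trans (proj_fst_eq t).symm))
        (proj_fst_eq (snd t))
      left_inv := fun _ => rfl
      right_inv := fun _ => rfl
      contMDiff_toFun := FibredManifold.contMDiff_pair
        (FibredManifold.contMDiff_snd.comp FibredManifold.contMDiff_snd)
        (FibredManifold.contMDiff_pair FibredManifold.contMDiff_fst
          (FibredManifold.contMDiff_fst.comp FibredManifold.contMDiff_snd) _) _
      contMDiff_invFun := FibredManifold.contMDiff_pair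
        (FibredManifold.contMDiff_fst.comp FibredManifold.contMDiff_snd)
        (FibredManifold.contMDiff_pair
          (FibredManifold.contMDiff_snd.comp FibredManifold.contMDiff_snd)
          FibredManifold.contMDiff_fst _) _ }
  proj_comp t := (proj_fst_eq (snd t)).symm.trans (proj_fst_eq t).symm
  map t := TensorTorsor.rotate
    (T := P.bundle.fiber (pair (fst (fst t)) (fst (snd t)) (proj_fst_eq t)))
    (S := R.bundle.fiber (mapSq fst fst_proj (mapSq snd snd_proj t)))
    (R := Q.bundle.fiber (mapSq snd snd_proj (mapSq snd snd_proj t)))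
  map_smul t z u := TensorTorsor.rotate_smul z _
  map_smooth a b := by
    have hP : ContMDiff 𝓘(ℝ, (P.base.prod (R.base.prod Q.base)).sq.model) 𝓘(ℝ, P.base.sq.model) ∞
        (mapSq fst fst_proj : (P.base.prod (R.base.prod Q.base)).sq.Y → P.base.sq.Y) :=
      contMDiff_mapSq fst_proj FibredManifold.contMDiff_fst
    have hRQ : ContMDiff 𝓘(ℝ, (P.base.prod (R.base.prod Q.base)).sq.model)
        𝓘(ℝ, (R.base.prod Q.base).sq.model) ∞
        (mapSq snd snd_proj : (P.base.prod (R.base.prod Q.base)).sq.Y →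
          (R.base.prod Q.base).sq.Y) :=
      contMDiff_mapSq snd_proj FibredManifold.contMDiff_snd
    have hR : ContMDiff 𝓘(ℝ, (R.base.prod Q.base).sq.model) 𝓘(ℝ, R.base.sq.model) ∞
        (mapSq fst fst_proj : (R.base.prod Q.base).sq.Y → R.base.sq.Y) :=
      contMDiff_mapSq fst_proj FibredManifold.contMDiff_fst
    have hQ : ContMDiff 𝓘(ℝ, (R.base.prod Q.base).sq.model) 𝓘(ℝ, Q.base.sq.model) ∞
        (mapSq snd snd_proj : (R.base.prod Q.base).sq.Y → Q.base.sq.Y) :=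
      contMDiff_mapSq snd_proj FibredManifold.contMDiff_snd
    -- In trivialisations the permutation becomes a product of transition functions of the three
    -- bundles.
    have tP := (P.bundle.contMDiffOn_transition (mapSq fst fst_proj a)
      (mapSq fst fst_proj (mapSq snd snd_proj b))).comp hP.contMDiffOn fun _ hx => hx
    have tR := (R.bundle.contMDiffOn_transition (mapSq fst fst_proj (mapSq snd snd_proj a))
      (mapSq snd snd_proj (mapSq snd snd_proj b))).comp (hR.comp hRQ).contMDiffOn fun _ hx => hx
    have tQ := (Q.bundle.contMDiffOn_transition (mapSq snd snd_proj (mapSq snd snd_proj a))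
      (mapSq fst fst_proj b)).comp (hQ.comp hRQ).contMDiffOn fun _ hx => hx
    exact contMDiffOn_units_mul (tQ.mono fun _ hx => ⟨hx.1.2.2, hx.2.1⟩)
      (contMDiffOn_units_mul (tP.mono fun _ hx => ⟨hx.1.1, hx.2.2.1⟩)
        (tR.mono fun _ hx => ⟨hx.1.2.1, hx.2.2.2⟩))
  map_mul h₁₂ h₂₃ p q := by
    revert p q
    -- Every element is a decomposable tensor, and on decomposable tensors compatibility with the
    -- products is definitional.
    have key : ∀ t : (P.base.prod (R.base.prod Q.base)).sq.Y, ∀ u : TensorTorsor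
        (P.bundle.fiber (mapSq fst fst_proj t)) (TensorTorsor
          (R.bundle.fiber (mapSq fst fst_proj (mapSq snd snd_proj t)))
          (Q.bundle.fiber (mapSq snd snd_proj (mapSq snd snd_proj t)))),
        ∃ p r q, u = TensorTorsor.tmul p (TensorTorsor.tmul r q) := fun t u => by
      induction u using TensorTorsor.ind with
      | h p v =>
        induction v using TensorTorsor.ind with
        | h r q => exact ⟨p, r, q, rfl⟩
    intro u u'
    obtain ⟨p, r, q, rfl⟩ := key _ u
    obtain ⟨p', r', q', rfl⟩ := key _ u'
    rfl

/-! ### Algebra of left division. -/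

section Glue

variable {P : BundleGerbe.{v} E M}

/-- Left multiplication is injective. Left division is thus characterised by its defining equation,
independently of the reference element in its construction. -/
lemma ldiv_eq_iff {y₁ y₂ y₃ : P.base.Y} {h₁₂ : P.base.proj y₁ = P.base.proj y₂}
    {h₂₃ : P.base.proj y₂ = P.base.proj y₃} {p : P.bundle.fiber (pair y₁ y₂ h₁₂)}
    {r : P.bundle.fiber (pair y₁ y₃ (h₁₂.trans h₂₃))} {q : P.bundle.fiber (pair y₂ y₃ h₂₃)} :
    P.ldiv h₁₂ h₂₃ p r = q ↔ P.mul h₁₂ h₂₃ p q = r := by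
  refine ⟨fun h => h ▸ P.mul_ldiv h₁₂ h₂₃ p r, fun h => ?_⟩
  exact P.mul_left_cancel h₁₂ h₂₃ ((P.mul_ldiv h₁₂ h₂₃ p r).trans h.symm)

variable (P) in
lemma mul_sdiv_mul_left {y₁ y₂ y₃ : P.base.Y} (h₁₂ : P.base.proj y₁ = P.base.proj y₂)
    (h₂₃ : P.base.proj y₂ = P.base.proj y₃) (p : P.bundle.fiber (pair y₁ y₂ h₁₂))
    (q q' : P.bundle.fiber (pair y₂ y₃ h₂₃)) :
    (P.mul h₁₂ h₂₃ p q /ₛ P.mul h₁₂ h₂₃ p q' : ℂˣ) = q /ₛ q' := by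
  rw [P.mul_eq_smul_mul h₁₂ h₂₃ p p q q', smul_sdiv, sdiv_self, one_mul]

/-- Left division `P_(a,y) × P_(b,z) → P_(y,z)` for equal points `a` and `b`. -/
def ldivOfEq {a b y z : P.base.Y} (e : a = b) (h₁ : P.base.proj a = P.base.proj y)
    (h₂ : P.base.proj b = P.base.proj z) (h : P.base.proj y = P.base.proj z)
    (p : P.bundle.fiber (pair a y h₁)) (q : P.bundle.fiber (pair b z h₂)) :
    P.bundle.fiber (pair y z h) :=
  P.ldiv (e ▸ h₁) h (castPair e rfl (e ▸ h₁) p) q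

/-- For `(y, z) ∈ Y^[2]` the points `s (π y) (π y)` and `s (π z) (π z)` coincide only
propositionally. This characterisation confines the transport to one side of an equation. -/
lemma ldivOfEq_eq_iff {a b y z : P.base.Y} {e : a = b} {h₁ : P.base.proj a = P.base.proj y}
    {h₂ : P.base.proj b = P.base.proj z} {h : P.base.proj y = P.base.proj z}
    {p : P.bundle.fiber (pair a y h₁)} {q : P.bundle.fiber (pair b z h₂)}
    {r : P.bundle.fiber (pair y z h)} :
    ldivOfEq e h₁ h₂ h p q = r ↔ P.mul h₁ h p r = castPair e.symm rfl (h₁.trans h) q := by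
  subst e
  exact ldiv_eq_iff

/-- The inverse scalar is what makes division linear in its first argument when that argument is
regarded in the dual torsor. -/
lemma ldivOfEq_smul_left {a b y z : P.base.Y} (e : a = b) (h₁ : P.base.proj a = P.base.proj y)
    (h₂ : P.base.proj b = P.base.proj z) (h : P.base.proj y = P.base.proj z) (w : ℂˣ)
    (p : P.bundle.fiber (pair a y h₁)) (q : P.bundle.fiber (pair b z h₂)) :
    ldivOfEq e h₁ h₂ h (w • p) q = w⁻¹ • ldivOfEq e h₁ h₂ h p q := by
  rw [ldivOfEq_eq_iff, P.smul_mul, P.mul_smul, smul_inv_smul]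
  exact ldivOfEq_eq_iff.1 rfl

lemma ldivOfEq_smul_right {a b y z : P.base.Y} (e : a = b) (h₁ : P.base.proj a = P.base.proj y)
    (h₂ : P.base.proj b = P.base.proj z) (h : P.base.proj y = P.base.proj z) (w : ℂˣ)
    (p : P.bundle.fiber (pair a y h₁)) (q : P.bundle.fiber (pair b z h₂)) :
    ldivOfEq e h₁ h₂ h p (w • q) = w • ldivOfEq e h₁ h₂ h p q := by
  rw [ldivOfEq_eq_iff, castPair_smul, P.mul_smul]
  exact congrArg _ (ldivOfEq_eq_iff.1 rfl)

/-- This is `(p⁻¹q)(q⁻¹r) = p⁻¹r`, obtained by multiplying both sides by `p` on the left. It is the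
reason that `δ(Q) → P` respects products. -/
lemma mul_ldivOfEq {a b c y z t : P.base.Y} (e : a = b) (e' : b = c)
    (h₁ : P.base.proj a = P.base.proj y) (h₂ : P.base.proj b = P.base.proj z)
    (h₃ : P.base.proj c = P.base.proj t) (h : P.base.proj y = P.base.proj z)
    (h' : P.base.proj z = P.base.proj t) (p : P.bundle.fiber (pair a y h₁))
    (q : P.bundle.fiber (pair b z h₂)) (r : P.bundle.fiber (pair c t h₃)) :
    P.mul h h' (ldivOfEq e h₁ h₂ h p q) (ldivOfEq e' h₂ h₃ h' q r) =
      ldivOfEq (e.trans e') h₁ h₃ (h.trans h') p r := by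
  subst e e'
  refine (ldivOfEq_eq_iff.2 ?_).symm
  rw [← P.mul_assoc h₁ h h', ldivOfEq_eq_iff.1 (rfl : ldivOfEq rfl h₁ h₂ h p q = _)]
  exact ldivOfEq_eq_iff.1 rfl

end Glue

/-! ### Gluing a bundle on `Y` from multiplicative sections. -/

namespace SecData

variable {P : BundleGerbe.{v} E M} (D : P.SecData)

/-- Rescaling local sections of a bundle gerbe, over a smaller cover. -/
lemma exists_g_eq_one {W : M → Set M} (hW : IsPointedCover W) {h : M → M → M → ℂˣ}
    (hh : ∀ x y p, p ∈ W x → p ∈ W y → ContMDiffAt 𝓘(ℝ, E) 𝓘(ℝ, ℂ) ∞ (fun q => (h x y q : ℂ)) p)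
    (hg : ∀ x y z p, p ∈ W x → p ∈ W y → p ∈ W z →
      D.g x y z p * h x z p = h x y p * h y z p) :
    ∃ D' : P.SecData, ∀ x y z p, p ∈ D'.V x → p ∈ D'.V y → p ∈ D'.V z → D'.g x y z p = 1 := by
  refine ⟨{ V := fun x => D.V x ∩ W x
            isPointedCover := D.isPointedCover.inter M hW
            s := D.s
            proj_s := D.proj_s
            s_smooth := fun x p hp => D.s_smooth x p hp.1
            -- The rescaled cocycle is `g` times `h x z` divided by `h x y · h y z`, which is `1` by
            -- `hg`.
            σ := fun x y p => (h x y p)⁻¹ • D.σ x y p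
            σ_smooth := fun x y p hx hy => (D.σ_smooth x y p hx.1 hy.1).smul
              (contMDiffAt_units_inv (hh x y p hx.2 hy.2)) }, fun x y z p hx hy hz => ?_⟩
  refine (eq_smul_iff_sdiv_eq _ _ _).1 ?_
  simp only
  rw [P.smul_mul, P.mul_smul, D.mul_σ, smul_smul, smul_smul, one_smul]
  congr 1
  rw [eq_inv_iff_mul_eq_one, _root_.mul_assoc, hg x y z p hx.2 hy.2 hz.2, ← mul_inv,
    inv_mul_cancel]

variable {D} (hD : ∀ x y z p, p ∈ D.V x → p ∈ D.V y → p ∈ D.V z → D.g x y z p = 1)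

include hD in
lemma mul_σ_of_g_eq_one {x y z p : M} (hx : p ∈ D.V x) (hy : p ∈ D.V y) (hz : p ∈ D.V z) :
    P.mul (D.proj_eq x y p) (D.proj_eq y z p) (D.σ x y p) (D.σ y z p) = D.σ x z p := by
  rw [D.mul_σ, hD x y z p hx hy hz, one_smul]

-- This is the descent condition: passing from index `z` to `x` directly or through `y` gives the
-- same identification.
include hD in
lemma mul_mul_σ {x y z m : M} {y₀ : P.base.Y} (hx : m ∈ D.V x) (hy : m ∈ D.V y) (hz : m ∈ D.V z)
    (h : P.base.proj (D.s z m) = P.base.proj y₀) (t : P.bundle.fiber (pair (D.s z m) y₀ h)) :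
    P.mul (D.proj_eq x z m) h (D.σ x z m) t =
      P.mul (D.proj_eq x y m) ((D.proj_eq y z m).trans h) (D.σ x y m)
        (P.mul (D.proj_eq y z m) h (D.σ y z m) t) := by
  rw [← P.mul_assoc (D.proj_eq x y m) (D.proj_eq y z m) h, mul_σ_of_g_eq_one hD hx hy hz]

variable (D) in
lemma s_proj (x : M) (y : P.base.Y) : P.base.proj (D.s x (P.base.proj y)) = P.base.proj y :=
  D.proj_s x _

variable (D) in
/-- The section `y ↦ (s x (π y), y)` of `Y^[2] → Y`. -/
abbrev φ (x : M) (y : P.base.Y) : P.base.sq.Y := pair (D.s x (P.base.proj y)) y (D.s_proj x y)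

variable (D) in
lemma s_proj_smooth {x : M} {y : P.base.Y} (hy : P.base.proj y ∈ D.V x) :
    ContMDiffAt 𝓘(ℝ, P.base.model) 𝓘(ℝ, P.base.model) ∞ (fun y => D.s x (P.base.proj y)) y :=
  (D.s_smooth x _ hy).comp y contMDiff_proj.contMDiffAt

variable (D) in
lemma φ_smooth {x : M} {y : P.base.Y} (hy : P.base.proj y ∈ D.V x) :
    ContMDiffAt 𝓘(ℝ, P.base.model) 𝓘(ℝ, P.base.sq.model) ∞ (D.φ x) y :=
  contMDiffAt_pair (D.s_proj_smooth hy) contMDiffAt_id (D.s_proj x)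

variable (D) in
/-- The neighbourhood of `a` over which `P_(s x (π y), y)`, with `x = π a`, is trivialised. -/
def nbhd (a : P.base.Y) : Set P.base.Y :=
  interior {y | P.base.proj y ∈ D.V (P.base.proj a) ∧
    D.φ (P.base.proj a) y ∈ P.bundle.baseSet (D.φ (P.base.proj a) a)}

variable (D) in
lemma mem_nbhd (a : P.base.Y) : a ∈ D.nbhd a := by
  have ha := D.isPointedCover (P.base.proj a)
  exact mem_interior_iff_mem_nhds.2 (Filter.inter_mem
    (contMDiff_proj.continuous.continuousAt.preimage_mem_nhds (ha.1.mem_nhds ha.2))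
    ((D.φ_smooth ha.2).continuousAt.preimage_mem_nhds
      ((P.bundle.isOpen_baseSet _).mem_nhds (P.bundle.mem_baseSet _))))

variable (D) in
lemma smoothAt_sec_φ {a y : P.base.Y} (hy : y ∈ D.nbhd a) :
    P.bundle.SmoothAt P.base.model (D.φ (P.base.proj a))
      (fun y' => P.bundle.sec (D.φ (P.base.proj a) a) (D.φ (P.base.proj a) y')) y :=
  CStarBundle.smoothAt_sec (D.φ_smooth (interior_subset hy).1) (interior_subset hy).2

variable (D) in
/-- The local section `y ↦ σ (π y) (π a) * sec (s (π a) (π y), y)` of the trivialising bundle. -/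
def glueSec (a y : P.base.Y) : P.bundle.fiber (D.φ (P.base.proj y) y) :=
  P.mul (D.proj_eq (P.base.proj y) (P.base.proj a) (P.base.proj y)) (D.s_proj (P.base.proj a) y)
    (D.σ (P.base.proj y) (P.base.proj a) (P.base.proj y))
    (P.bundle.sec (D.φ (P.base.proj a) a) (D.φ (P.base.proj a) y))

/-- If the cocycle of `P` is trivial, the bundles `P_(s x (π y), y)` over the sets `π⁻¹ (V x)` are
identified by the sections `σ`, and define a `ℂˣ`-bundle on `Y`. -/
def glue : CStarBundle.{v} P.base.model P.base.Y where
  fiber y := P.bundle.fiber (D.φ (P.base.proj y) y)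
  baseSet := D.nbhd
  isOpen_baseSet _ := isOpen_interior
  mem_baseSet := D.mem_nbhd
  sec := D.glueSec
  contMDiffOn_transition a b := by
    rintro y ⟨hya, hyb⟩
    have ha := (interior_subset hya).1
    have hb := (interior_subset hyb).1
    -- Each `glueSec` contains `σ` with the index `π y'`, on which `σ` depends without any
    -- regularity. In the ratio of two of them this factor cancels, leaving the comparison of the
    -- section at `a` with `σ (π a) (π b)` times the section at `b`, where all indices are fixed.
    have h := (D.smoothAt_sec_φ hya).sdiv (smoothAt_mul (D.s_proj_smooth ha) (D.s_proj_smooth hb)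
      contMDiffAt_id (CStarBundle.SmoothAt.comp (D.σ_smooth (P.base.proj a) (P.base.proj b) _ ha hb)
        contMDiff_proj.contMDiffAt) (D.smoothAt_sec_φ hyb))
    refine (h.congr_of_eventuallyEq ?_).contMDiffWithinAt
    filter_upwards [isOpen_interior.mem_nhds hya, isOpen_interior.mem_nhds hyb] with y' hya' hyb'
    have e := mul_mul_σ hD (D.isPointedCover (P.base.proj y')).2 (interior_subset hya').1
      (interior_subset hyb').1 (D.s_proj (P.base.proj b) y')
      (P.bundle.sec (D.φ (P.base.proj b) b) (D.φ (P.base.proj b) y'))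
    exact congrArg Units.val ((congrArg (fun r => _ /ₛ r) e).trans (P.mul_sdiv_mul_left _ _ _ _ _))

-- The moving indices `m`, `m'` cancel in the quotient, leaving the fixed indices `x₁`, `x₂`, for
-- which smoothness is known. The family `k` is taken over all `n` so that it can be evaluated at
-- both `m` and `m'`.
include hD in
lemma ldivOfEq_glue {x₁ x₂ m m' : M} (e : m = m') {y₁ y₂ : P.base.Y}
    (h₁ : P.base.proj y₁ = m) (h₂ : P.base.proj y₂ = m')
    (hx₁ : m ∈ D.V x₁) (hx₂ : m ∈ D.V x₂)
    (t : P.bundle.fiber (pair (D.s x₁ m) y₁ ((D.proj_s x₁ m).trans h₁.symm)))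
    (k : ∀ n (h : P.base.proj y₂ = n),
      P.bundle.fiber (pair (D.s x₂ n) y₂ ((D.proj_s x₂ n).trans h.symm))) :
    ldivOfEq (congrArg (fun m => D.s m m) e) ((D.proj_s m m).trans h₁.symm)
      ((D.proj_s m' m').trans h₂.symm) (h₁.trans (e.trans h₂.symm))
      (P.mul (D.proj_eq m x₁ m) ((D.proj_s x₁ m).trans h₁.symm) (D.σ m x₁ m) t)
      (P.mul (D.proj_eq m' x₂ m') ((D.proj_s x₂ m').trans h₂.symm) (D.σ m' x₂ m') (k m' h₂)) =
    P.ldiv ((D.proj_s x₁ m).trans h₁.symm) (h₁.trans (e.trans h₂.symm)) t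
      (P.mul (D.proj_eq x₁ x₂ m) ((D.proj_s x₂ m).trans (e.trans h₂.symm)) (D.σ x₁ x₂ m)
        (k m (h₂.trans e.symm))) := by
  subst e
  rw [ldivOfEq_eq_iff, P.mul_assoc, P.mul_ldiv]
  exact (mul_mul_σ hD (D.isPointedCover m).2 hx₁ hx₂ _ _).symm

include hD in
lemma glue_map_smooth (a b : P.base.sq.Y) :
    ContMDiffOn 𝓘(ℝ, P.base.sq.model) 𝓘(ℝ, ℂ) ∞
      (fun p : P.base.sq.Y => ((ldivOfEq (congrArg (fun m => D.s m m) (proj_fst_eq p))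
        (D.s_proj _ (fst p)) (D.s_proj _ (snd p)) (proj_fst_eq p) (D.glueSec (fst a) (fst p))
        (D.glueSec (snd a) (snd p)) /ₛ P.bundle.sec b p : ℂˣ) : ℂ))
      ((fst ⁻¹' D.nbhd (fst a) ∩ snd ⁻¹' D.nbhd (snd a)) ∩ P.bundle.baseSet b) := by
  rintro p ⟨⟨hp₁, hp₂⟩, hpb⟩
  have hm : ContMDiff 𝓘(ℝ, P.base.sq.model) 𝓘(ℝ, E) ∞
      (fun p : P.base.sq.Y => P.base.proj (fst p)) :=
    contMDiff_proj.comp FibredManifold.contMDiff_fst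
  have h₁ := (interior_subset hp₁).1
  have h₂ : P.base.proj (fst p) ∈ D.V (P.base.proj (snd a)) := by
    rw [proj_fst_eq p]
    exact (interior_subset hp₂).1
  have hs₁ := (D.s_smooth _ _ h₁).comp p hm.contMDiffAt
  have hs₂ := (D.s_smooth _ _ h₂).comp p hm.contMDiffAt
  have hf := (FibredManifold.contMDiff_fst (A := P.base) (B := P.base)).contMDiffAt (x := p)
  have hs := (FibredManifold.contMDiff_snd (A := P.base) (B := P.base)).contMDiffAt (x := p)
  have e₁ : ∀ q : P.base.sq.Y, P.base.proj (D.s (P.base.proj (fst a)) (P.base.proj (fst q))) =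
      P.base.proj (fst q) := fun q => D.proj_s _ _
  have e₂ : ∀ q : P.base.sq.Y, P.base.proj (D.s (P.base.proj (snd a)) (P.base.proj (fst q))) =
      P.base.proj (snd q) := fun q => (D.proj_s _ _).trans (proj_fst_eq q)
  have t₁ : P.bundle.SmoothAt P.base.sq.model _ (fun q => P.bundle.sec
      (D.φ (P.base.proj (fst a)) (fst a)) (pair _ _ (e₁ q))) p :=
    CStarBundle.smoothAt_sec (contMDiffAt_pair hs₁ hf e₁) (interior_subset hp₁).2
  have t₂ : P.bundle.SmoothAt P.base.sq.model _ (fun q => P.bundle.sec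
      (D.φ (P.base.proj (snd a)) (snd a)) (pair _ _ (e₂ q))) p := by
    refine CStarBundle.smoothAt_sec (contMDiffAt_pair hs₂ hs e₂) ?_
    -- All sections are evaluated at `π (fst q)`, whereas the trivialising set is described through
    -- `π (snd q)`.
    have h : pair _ _ (e₂ p) = D.φ (P.base.proj (snd a)) (snd p) :=
      FibreProd.ext (congrArg (D.s (P.base.proj (snd a))) (proj_fst_eq p)) rfl
    change pair _ _ (e₂ p) ∈ _
    rw [h]
    exact (interior_subset hp₂).2
  have tσ := CStarBundle.SmoothAt.comp (k := fun p : P.base.sq.Y => P.base.proj (fst p))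
    (D.σ_smooth _ _ _ h₁ h₂) hm.contMDiffAt
  have t₃ := smoothAt_mul hs₁ hs₂ hs tσ t₂
  -- With the moving index eliminated, the map is the left division of the smooth section of `t₁`
  -- into that of `t₃`. Multiplying back recovers `t₃`, so `smoothAt_of_mul` applies.
  have key : P.bundle.SmoothAt P.base.sq.model (fun q => q) (fun q =>
      P.ldiv (e₁ q) (proj_fst_eq q) (P.bundle.sec
        (D.φ (P.base.proj (fst a)) (fst a)) (pair _ _ (e₁ q)))
        (P.mul (D.proj_eq _ _ _) (e₂ q) (D.σ _ _ _) (P.bundle.sec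
          (D.φ (P.base.proj (snd a)) (snd a)) (pair _ _ (e₂ q))))) p := by
    refine smoothAt_of_mul (h₁₂ := e₁) (h₂₃ := proj_fst_eq) hs₁ hf hs t₁ ?_
    simp only [P.mul_ldiv]
    exact t₃
  refine ContMDiffAt.contMDiffWithinAt ?_
  refine (key.sdiv_sec contMDiffAt_id hpb).congr_of_eventuallyEq ?_
  filter_upwards [hm.continuous.continuousAt.preimage_mem_nhds
      ((D.isPointedCover _).1.mem_nhds h₁), hm.continuous.continuousAt.preimage_mem_nhds
      ((D.isPointedCover _).1.mem_nhds h₂)] with q hq₁ hq₂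
  exact congrArg (fun r => ((r /ₛ P.bundle.sec b q : ℂˣ) : ℂ)) (ldivOfEq_glue hD (proj_fst_eq q)
    rfl rfl hq₁ hq₂ _ fun n h => P.bundle.sec (D.φ (P.base.proj (snd a)) (snd a))
      (pair (D.s (P.base.proj (snd a)) n) (snd q) ((D.proj_s _ n).trans h.symm)))

/-- The isomorphism of `P` with the trivial bundle gerbe defined by the glued bundle. -/
def glueIso : Iso (delta P.base (glue hD)) P where
  toDiffeomorph := Diffeomorph.refl 𝓘(ℝ, P.base.model) P.base.Y ∞
  proj_comp _ := rfl
  map p := TensorTorsor.lift (T := DualTorsor ((glue hD).fiber (fst p)))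
    (S := (glue hD).fiber (snd p))
    (fun q r => ldivOfEq (congrArg (fun m => D.s m m) (proj_fst_eq p)) (D.s_proj _ (fst p))
      (D.s_proj _ (snd p)) (proj_fst_eq p) q r)
    (fun z q r => by
      -- Acting by `z` on the dual factor means acting by `z⁻¹` on the underlying element, so the
      -- division contributes `z`, cancelling the `z⁻¹` from the other factor.
      refine (ldivOfEq_smul_left (congrArg (fun m => D.s m m) (proj_fst_eq p)) _ _ _ z⁻¹ _ _).trans
        ?_
      refine (congrArg _ (ldivOfEq_smul_right (congrArg (fun m => D.s m m) (proj_fst_eq p))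
        _ _ _ z⁻¹ _ _)).trans ?_
      rw [inv_inv, smul_inv_smul])
  map_smul p z u := by
    revert u
    refine TensorTorsor.ind (T := DualTorsor ((glue hD).fiber (fst p)))
      (S := (glue hD).fiber (snd p)) fun q r => ?_
    refine (congrArg _ (TensorTorsor.tmul_smul z q r).symm).trans ?_
    exact ldivOfEq_smul_right (congrArg (fun m => D.s m m) (proj_fst_eq p)) _ _ _ z _ _
  map_smooth a b := by
    exact glue_map_smooth hD a b
  map_mul := by
    intro (y₁ : P.base.Y) (y₂ : P.base.Y) (y₃ : P.base.Y)
      (h₁₂ : P.base.proj y₁ = P.base.proj y₂) (h₂₃ : P.base.proj y₂ = P.base.proj y₃)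
    refine TensorTorsor.ind (T := DualTorsor ((glue hD).fiber y₁)) (S := (glue hD).fiber y₂)
      fun q r => TensorTorsor.ind (T := DualTorsor ((glue hD).fiber y₂))
        (S := (glue hD).fiber y₃) fun r' t => ?_
    have e : ∀ {y y' : P.base.Y}, P.base.proj y = P.base.proj y' →
        D.s (P.base.proj y) (P.base.proj y) = D.s (P.base.proj y') (P.base.proj y') :=
      fun h => congrArg (fun m => D.s m m) h
    set q₀ : P.bundle.fiber (D.φ (P.base.proj y₁) y₁) := q
    set r₀ : P.bundle.fiber (D.φ (P.base.proj y₂) y₂) := r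
    set r₀' : P.bundle.fiber (D.φ (P.base.proj y₂) y₂) := r'
    set t₀ : P.bundle.fiber (D.φ (P.base.proj y₃) y₃) := t
    have h := mul_ldivOfEq (e h₁₂) (e h₂₃) (D.s_proj _ y₁) (D.s_proj _ y₂) (D.s_proj _ y₃) h₁₂ h₂₃
      q₀ r₀' t₀
    -- Rescaling `r₀'` to `r₀` produces the scalar `r₀ /ₛ r₀'`, precisely the pairing in the product
    -- of `δ(Q)`. What is left is the cancellation law for divisions.
    have h' := ldivOfEq_smul_right (e h₁₂) (D.s_proj _ y₁) (D.s_proj _ y₂) h₁₂ (r₀ /ₛ r₀') q₀ r₀'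
    rw [sdiv_smul] at h'
    have h'' : P.mul h₁₂ h₂₃ (ldivOfEq (e h₁₂) (D.s_proj _ y₁) (D.s_proj _ y₂) h₁₂ q₀ r₀)
        (ldivOfEq (e h₂₃) (D.s_proj _ y₂) (D.s_proj _ y₃) h₂₃ r₀' t₀) =
        (r₀ /ₛ r₀')⁻¹⁻¹ • ldivOfEq ((e h₁₂).trans (e h₂₃)) (D.s_proj _ y₁) (D.s_proj _ y₃)
          (h₁₂.trans h₂₃) q₀ t₀ := by
      rw [h', P.smul_mul, h, inv_inv]
    exact (ldivOfEq_smul_left ((e h₁₂).trans (e h₂₃)) (D.s_proj _ y₁) (D.s_proj _ y₃)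
      (h₁₂.trans h₂₃) (r₀ /ₛ r₀')⁻¹ q₀ t₀).trans h''.symm

include hD in
lemma isTrivial_of_g_eq_one : P.IsTrivial := ⟨P.base, glue hD, ⟨glueIso hD⟩⟩

end SecData

/-- The cocycle is a coboundary, rescaling by the cochain makes the sections multiplicative, and
multiplicative sections allow the gluing. -/
theorem IsDixmierDouadyClass.isTrivial [FiniteDimensional ℝ E] [T2Space M] [SigmaCompactSpace M]
    {P : BundleGerbe.{v} E M} (h : P.IsDixmierDouadyClass 0) : P.IsTrivial := by
  obtain ⟨D, hD⟩ := isDixmierDouadyClass_iff.1 h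
  obtain ⟨W, k, hW, hk, hg⟩ := hD.exists_eq_coboundary
  obtain ⟨D', hD'⟩ := D.exists_g_eq_one hW hk hg
  exact SecData.isTrivial_of_g_eq_one hD'

end BundleGerbe

end Triviality

lemma BundleGerbe.isDixmierDouadyClass_dixmierDouady {E : Type*} [NormedAddCommGroup E]
    [NormedSpace ℝ E] {M : Type u} [TopologicalSpace M] [T2Space M] [ParacompactSpace M]
    [ChartedSpace E M] [IsManifold 𝓘(ℝ, E) ∞ M] (P : BundleGerbe.{v} E M) :
    P.IsDixmierDouadyClass P.dixmierDouady :=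
  Classical.epsilon_spec P.existsUnique_isDixmierDouadyClass.exists

end

end BundleGerbes

/-! ### The equivalences and the equivalence relation. -/

theorem mainTheorem2 {E : Type w} [NormedAddCommGroup E] [NormedSpace ℝ E]
    [FiniteDimensional ℝ E] {M : Type u} [TopologicalSpace M] [T2Space M] [SigmaCompactSpace M]
    [ChartedSpace E M] [IsManifold 𝓘(ℝ, E) ∞ M] :
    (∀ P : BundleGerbes.BundleGerbe.{v} E M, ∃! c, P.IsDixmierDouadyClass c) ∧
    (∀ P Q : BundleGerbes.BundleGerbe.{v} E M,
      [BundleGerbes.BundleGerbe.StablyIsomorphic P Q,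
        (P.tensor Q.dual).IsTrivial,
        P.dixmierDouady = Q.dixmierDouady].TFAE) ∧
    Equivalence
      (BundleGerbes.BundleGerbe.StablyIsomorphic :
        BundleGerbes.BundleGerbe.{v} E M → BundleGerbes.BundleGerbe.{v} E M → Prop) := by
  -- Together with the Hausdorff and σ-compactness hypotheses this makes `M` paracompact, as the
  -- existence of the class requires.
  have : LocallyCompactSpace M := ChartedSpace.locallyCompactSpace E M
  have h₁ : ∀ P : BundleGerbes.BundleGerbe.{v} E M, ∃! c, P.IsDixmierDouadyClass c :=
    fun P => P.existsUnique_isDixmierDouadyClass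
  have hd : ∀ P : BundleGerbes.BundleGerbe.{v} E M, P.IsDixmierDouadyClass P.dixmierDouady :=
    fun P => P.isDixmierDouadyClass_dixmierDouady
  have heq : ∀ P Q : BundleGerbes.BundleGerbe.{v} E M, P.dixmierDouady = Q.dixmierDouady →
      (P.tensor Q.dual).IsTrivial := fun P Q h => by
    have h' := (hd P).tensor (hd Q).dual
    rw [h, add_neg_cancel] at h'
    exact h'.isTrivial
  have h₂ : ∀ P Q : BundleGerbes.BundleGerbe.{v} E M,
      [BundleGerbes.BundleGerbe.StablyIsomorphic P Q, (P.tensor Q.dual).IsTrivial,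
        P.dixmierDouady = Q.dixmierDouady].TFAE := by
    intro P Q
    tfae_have 1 → 3 := by
      rintro ⟨T₁, T₂, hT₁, hT₂, F⟩
      have h := (((hd P).tensor hT₁.isDixmierDouadyClass_zero).map_iso F)
      have h' := (hd Q).tensor hT₂.isDixmierDouadyClass_zero
      simpa using (h₁ _).unique h h'
    tfae_have 2 → 3 := fun h => by
      have h' := (h₁ _).unique ((hd P).tensor (hd Q).dual) h.isDixmierDouadyClass_zero
      rwa [add_neg_eq_zero] at h'
    tfae_have 3 → 2 := heq P Q
    tfae_have 3 → 1 := fun h => by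
      have hT₁ := ((hd Q).dual).tensor (hd Q)
      rw [neg_add_cancel] at hT₁
      -- The trivial factors are `T₁ = Q* ⊗ Q` and `T₂ = P ⊗ Q*`; the equality of classes is used
      -- only for the second.
      exact ⟨_, _, hT₁.isTrivial, heq P Q h, ⟨BundleGerbes.BundleGerbe.rotateIso P Q.dual Q⟩⟩
    tfae_finish
  refine ⟨h₁, h₂, ?_⟩
  have h₃ : ∀ P Q : BundleGerbes.BundleGerbe.{v} E M,
      BundleGerbes.BundleGerbe.StablyIsomorphic P Q ↔ P.dixmierDouady = Q.dixmierDouady :=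
    fun P Q => (h₂ P Q).out 0 2
  exact ⟨fun P => (h₃ P P).2 rfl, fun h => (h₃ _ _).2 ((h₃ _ _).1 h).symm,
    fun h h' => (h₃ _ _).2 (((h₃ _ _).1 h).trans ((h₃ _ _).1 h'))⟩
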